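/- **Proposition (global holomorphic differential form).** Let $l_1,\dots,l_6$ be linear forms over $\mathbb C$ in the variables $x,y,z$, no three of which have a common zero in $\mathbf P^2(\mathbb C)$. Let $X'\colon w^2=l_1\cdots l_6$ be the corresponding double cover of $\mathbf P^2_{\mathbb C}$, i.e. the surface of this equation in the weighted projective space $\mathbf P(1,1,1,3)$, and let $\pi\colon X\to X'$ be its minimal desingularisation: $X$ is a complex surface, $\pi$ is proper and holomorphic, it is biholomorphic over the regular locus of $X'$, the inverse image of the regular locus is dense in $X$, and every other such map $Y\to X'$ factors holomorphically through $\pi$. Let $l$ be a linear form such that $x,y,l$ are linearly independent, and put $$\omega' := \frac{d\bigl(\frac xl\bigr)\wedge d\bigl(\frac yl\bigr)}{\frac w{l^3}}\,.$$ Then the pull-back $\pi^*\omega'$, which is defined on the dense open subset $\pi^{-1}(\{l\neq0,\ w\neq0\})$ of $X$, extends to a global holomorphic $(2,0)$-form $\omega$ on $X$ without zeros (or poles). -/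

import Mathlib

open scoped Manifold ContDiff Topology

noncomputable section

namespace SixLines

/-! ## The double cover `X' : w² = l₁ ⋯ l₆` of the projective plane -/

/-- Linear forms in the three variables `x`, `y`, `z`. -/
abbrev LinearForm : Type := (Fin 3 → ℂ) →ₗ[ℂ] ℂ

/-- The linear form `x`. -/
abbrev formX : LinearForm := LinearMap.proj 0

/-- The linear form `y`. -/
abbrev formY : LinearForm := LinearMap.proj 1

/-- No point of the projective plane lies on three of the six lines `V(l i)`. -/
def NoThreeConcurrent (l : Fin 6 → LinearForm) : Prop :=
  ∀ i j k : Fin 6, i ≠ j → i ≠ k → j ≠ k →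
    ∀ v : Fin 3 → ℂ, l i v = 0 → l j v = 0 → l k v = 0 → v = 0

/-- The weighted homogeneous polynomial function `w² - l₁ ⋯ l₆` in the variables `(x, y, z)` (of
weight one) and `w` (of weight three). -/
def equation (l : Fin 6 → LinearForm) (p : (Fin 3 → ℂ) × ℂ) : ℂ :=
  p.2 ^ 2 - ∏ i, l i p.1

/-- The punctured affine cone over the double cover: the solutions `((x, y, z), w) ≠ 0` of
`w² = l₁ ⋯ l₆`. As `(x, y, z) = 0` forces `w = 0`, these are the solutions such that
`(x, y, z) ≠ 0`. -/
def Cone (l : Fin 6 → LinearForm) : Type :=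
  {p : (Fin 3 → ℂ) × ℂ // p.1 ≠ 0 ∧ equation l p = 0}

instance (l : Fin 6 → LinearForm) : TopologicalSpace (Cone l) :=
  inferInstanceAs (TopologicalSpace {p : (Fin 3 → ℂ) × ℂ // p.1 ≠ 0 ∧ equation l p = 0})

/-- Two points of the cone are identified if they differ by the action
`t • (x, y, z, w) = (t x, t y, t z, t³ w)` of the multiplicative group. -/
def coneSetoid (l : Fin 6 → LinearForm) : Setoid (Cone l) where
  r p q := ∃ t : ℂ, t ≠ 0 ∧ q.1.1 = t • p.1.1 ∧ q.1.2 = t ^ 3 * p.1.2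
  iseqv :=
    { refl := fun p => ⟨1, one_ne_zero, by simp, by simp⟩
      symm := by
        rintro p q ⟨t, ht, h1, h2⟩
        refine ⟨t⁻¹, inv_ne_zero ht, ?_, ?_⟩
        · rw [h1, smul_smul, inv_mul_cancel₀ ht, one_smul]
        · rw [h2]; field_simp
      trans := by
        rintro p q r ⟨t, ht, h1, h2⟩ ⟨s, hs, h3, h4⟩
        refine ⟨s * t, mul_ne_zero hs ht, ?_, ?_⟩
        · rw [h3, h1, smul_smul]
        · rw [h4, h2]; ring }

/-- The double cover `X' : w² = l₁ ⋯ l₆` of the projective plane, as the set of complex points of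
the surface of that equation in the weighted projective space `P(1, 1, 1, 3)`. -/
def DoubleCover (l : Fin 6 → LinearForm) : Type :=
  Quotient (coneSetoid l)

/-- The classical topology on the double cover. -/
instance (l : Fin 6 → LinearForm) : TopologicalSpace (DoubleCover l) :=
  inferInstanceAs (TopologicalSpace (Quotient (coneSetoid l)))

/-- The point `(x : y : z ; w)` of the double cover. -/
def DoubleCover.mk {l : Fin 6 → LinearForm} (p : Cone l) : DoubleCover l :=
  Quotient.mk (coneSetoid l) p

/-- The regular locus of `X'`, by the Jacobian criterion. (The multiplicative group acts freely on
the cone, so that `X'` is regular at a point if and only if the cone is regular above it.) -/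
def regularLocus (l : Fin 6 → LinearForm) : Set (DoubleCover l) :=
  {P | ∃ p : Cone l, DoubleCover.mk p = P ∧ fderiv ℂ (equation l) p.1 ≠ 0}

/-- The function `m / L` on the double cover, for linear forms `m` and `L`; it is meant to be used
only where `L ≠ 0`. -/
def linearRatio {l : Fin 6 → LinearForm} (m L : LinearForm) : DoubleCover l → ℂ :=
  Quotient.lift (fun p : Cone l => m p.1.1 / L p.1.1) (by
    rintro p q ⟨t, ht, h1, -⟩
    simp only [h1, map_smul, smul_eq_mul]
    rw [mul_div_mul_left _ _ ht])

/-- The function `w / L³` on the double cover, for a linear form `L`; it is meant to be used only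
where `L ≠ 0`. -/
def cubicRatio {l : Fin 6 → LinearForm} (L : LinearForm) : DoubleCover l → ℂ :=
  Quotient.lift (fun p : Cone l => p.1.2 / L p.1.1 ^ 3) (by
    rintro p q ⟨t, ht, h1, h2⟩
    simp only [h1, h2, map_smul, smul_eq_mul, mul_pow]
    rw [mul_div_mul_left _ _ (pow_ne_zero 3 ht)])

/-- The open subset of the double cover where `L ≠ 0` and `w ≠ 0`. -/
def affineUnramified {l : Fin 6 → LinearForm} (L : LinearForm) : Set (DoubleCover l) :=
  {P | ∃ p : Cone l, DoubleCover.mk p = P ∧ L p.1.1 ≠ 0 ∧ p.1.2 ≠ 0}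

/-! ## Holomorphic maps to and from the double cover; desingularisations -/

/-- The model space of complex surfaces. -/
abbrev E2 : Type := EuclideanSpace ℂ (Fin 2)

section

variable {X : Type} [TopologicalSpace X] [ChartedSpace E2 X]

/-- A map from a complex surface to the double cover is holomorphic if, locally, it may be written
as `(x : y : z ; w)` for holomorphic functions `x`, `y`, `z`, and `w`. -/
def IsHolomorphicToCover {l : Fin 6 → LinearForm} (π : X → DoubleCover l) : Prop :=
  ∀ q : X, ∃ U : Set X, IsOpen U ∧ q ∈ U ∧ ∃ F : X → (Fin 3 → ℂ) × ℂ,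
    MDifferentiableOn 𝓘(ℂ, E2) 𝓘(ℂ, (Fin 3 → ℂ) × ℂ) F U ∧
    ∀ q' ∈ U, ∃ h : (F q').1 ≠ 0 ∧ equation l (F q') = 0, π q' = DoubleCover.mk ⟨F q', h⟩

/-- A map `s` to a complex surface is holomorphic on a subset `R` of the double cover if, as a
function of `((x, y, z), w)`, it is locally the restriction to the cone of a holomorphic map on an
open subset of `ℂ³ × ℂ`. -/
def IsHolomorphicFromCoverOn {l : Fin 6 → LinearForm} (s : DoubleCover l → X)
    (R : Set (DoubleCover l)) : Prop :=
  ∀ p : Cone l, DoubleCover.mk p ∈ R →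
    ∃ U : Set ((Fin 3 → ℂ) × ℂ), IsOpen U ∧ p.1 ∈ U ∧ ∃ G : (Fin 3 → ℂ) × ℂ → X,
      MDifferentiableOn 𝓘(ℂ, (Fin 3 → ℂ) × ℂ) 𝓘(ℂ, E2) G U ∧
      ∀ p' : Cone l, p'.1 ∈ U → s (DoubleCover.mk p') = G p'.1

/-- A desingularisation of `X'`: a complex surface together with a proper holomorphic map to `X'`
that is biholomorphic over the regular locus, the inverse image of which is dense. -/
structure IsDesingularisation {l : Fin 6 → LinearForm} (π : X → DoubleCover l) : Prop where
  /-- `X` is a Hausdorff space. -/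
  hausdorff : T2Space X
  /-- `X` is a complex manifold. -/
  manifold : IsManifold 𝓘(ℂ, E2) ω X
  /-- The map to `X'` is holomorphic. -/
  holomorphic : IsHolomorphicToCover π
  /-- The map to `X'` is proper. -/
  proper : IsProperMap π
  /-- No open subset of `X` is contracted to the singular points. -/
  dense_preimage : Dense (π ⁻¹' regularLocus l)
  /-- Over the regular locus, there is a holomorphic inverse map. -/
  exists_inverse : ∃ s : DoubleCover l → X, IsHolomorphicFromCoverOn s (regularLocus l) ∧
    (∀ P ∈ regularLocus l, π (s P) = P) ∧ ∀ q : X, π q ∈ regularLocus l → s (π q) = q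

end

/-- A minimal desingularisation of `X'`: a desingularisation such that every other one factors
holomorphically through it. (Desingularisations are second countable, being compact, so that it is
no restriction to consider only those whose underlying set is in `Type`.) -/
structure IsMinimalDesingularisation {X : Type} [TopologicalSpace X] [ChartedSpace E2 X]
    {l : Fin 6 → LinearForm} (π : X → DoubleCover l) : Prop where
  /-- It is a desingularisation. -/
  isDesingularisation : IsDesingularisation π
  /-- Every desingularisation factors through it. -/
  factors : ∀ (Y : Type) [TopologicalSpace Y] [ChartedSpace E2 Y] (ρ : Y → DoubleCover l),
    IsDesingularisation ρ →
      ∃ f : Y → X, MDifferentiable 𝓘(ℂ, E2) 𝓘(ℂ, E2) f ∧ π ∘ f = ρ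

/-! ## Differential forms of type (2,0) -/

/-- The wedge product of two linear functionals. -/
def wedge {V : Type*} [AddCommGroup V] [Module ℂ V] [TopologicalSpace V] (α β : V →L[ℂ] ℂ) :
    V [⋀^Fin 2]→L[ℂ] ℂ where
  toFun v := α (v 0) * β (v 1) - α (v 1) * β (v 0)
  map_update_add' := by
    intro inst v i a b
    obtain rfl : inst = instDecidableEqFin 2 := Subsingleton.elim _ _
    fin_cases i <;> simp [Function.update] <;> ring
  map_update_smul' := by
    intro inst v i c a
    obtain rfl : inst = instDecidableEqFin 2 := Subsingleton.elim _ _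
    fin_cases i <;> simp [Function.update] <;> ring
  map_eq_zero_of_eq' := by
    intro v i j h hij
    fin_cases i <;> fin_cases j <;> simp_all
  cont := by fun_prop

section

variable {X : Type} [TopologicalSpace X] [ChartedSpace E2 X]

variable (X) in
/-- A (not necessarily continuous) `(2,0)`-form: a complex bilinear alternating form on every
holomorphic tangent space. -/
abbrev TwoForm : Type :=
  ∀ q : X, TangentSpace 𝓘(ℂ, E2) q [⋀^Fin 2]→L[ℂ] ℂ

/-- The expression of a `(2,0)`-form in a chart `e`, i.e. its pull-back along the inverse
of `e`. -/
def TwoForm.inChart (η : TwoForm X) (e : OpenPartialHomeomorph X E2) (u : E2) :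
    E2 [⋀^Fin 2]→L[ℂ] ℂ :=
  (η (e.symm u)).compContinuousLinearMap (mfderiv 𝓘(ℂ, E2) 𝓘(ℂ, E2) e.symm u)

/-- A `(2,0)`-form is holomorphic if its expressions in all charts are holomorphic. -/
def TwoForm.IsHolomorphic (η : TwoForm X) : Prop :=
  ∀ e ∈ atlas E2 X, DifferentiableOn ℂ (η.inChart e) e.target

/-- The pull-back along `π : X → X'` of the form `d(x/L) ∧ d(y/L) / (w/L³)`; it is meant to be used
only where `L ≠ 0` and `w ≠ 0`. -/
def pullbackForm {l : Fin 6 → LinearForm} (π : X → DoubleCover l) (L : LinearForm) : TwoForm X :=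
  fun q => (cubicRatio L (π q))⁻¹ •
    wedge (mfderiv 𝓘(ℂ, E2) 𝓘(ℂ, ℂ) (linearRatio formX L ∘ π) q)
      (mfderiv 𝓘(ℂ, E2) 𝓘(ℂ, ℂ) (linearRatio formY L ∘ π) q)

end

end SixLines

end

/-! Write `f` for the equation, let `A`, `B` be affine coordinates on the plane dual to a basis `e₁,
e₂, n` of `ℂ³`, and let `c` be the corresponding affine coordinate of `w`. Then `d(x/L) ∧ d(y/L) = δ
dA ∧ dB / L³`, where `δ ≠ 0` is the determinant of `x, y, L` on the basis. The powers of `L` cancel,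
and the form becomes `δ dA ∧ dB / c` (`IsAffineAt.pullbackForm_eq`). So it suffices to find, near
every point of `X`, an expression `u dα ∧ dβ` with `u` invertible and `α, β` coordinates. By density
of the original domain such expressions glue (`exists_global_form`).

Over the regular locus this is the Jacobian criterion. Where `w ≠ 0`, `A` and `B` are coordinates.
Where `w = 0`, some partial derivative `f_{e₁}` is nonzero, `c` and `B` are coordinates, and
differentiating `f = 0` gives `δ dA ∧ dB / c = -2δ dc ∧ dB / f_{e₁}`.

At a singular point exactly two of the lines meet. A square root `h` of the product of the other
four forms turns the equation into `c² = ab` with `w = hc`, an ordinary double point. It is resolved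
by a projective line, with charts `(s, a) ↦ (a, b, c) = (a, s²a, sa)`. There the form becomes `δ da
∧ d(s²a) / (h s a) = (2δ/h) da ∧ ds`, which has neither zeros nor poles.

It remains to see that `X` looks like this resolution, although it is known only through its
universal property. Replacing the fibre of `X` over one node by the projective line gives another
desingularisation (`Setup.isDesingularisation_ρ`), so minimality yields a holomorphic map `φ` from
it to `X`, which is surjective. The key point is that `φ` is immersive
(`IsParam.injective_mfderiv`). Its Jacobian has no zeros off the exceptional line, and a holomorphic
function of two variables has no isolated zeros. Hence one degenerate point makes `φ` degenerate
along the whole line (`eventually_zero_on_line` and connectedness). Injectivity off the line then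
forces `φ` to contract the line to a point (`fderiv_line_eq_zero`). In that case the Jacobian
descends to a function on a punctured neighbourhood of this point, without zeros but tending to
zero, which `no_isolated_zero` excludes. So `φ` is a local biholomorphism and the computation in the
chart applies.

Complex differentiability alone is verified for transition maps. Osgood's lemma upgrades it to
analyticity. -/

noncomputable section

namespace SixLines

/-! ## Holomorphic functions of two variables are analytic -/

section Osgood

open Complex Set Metric MeasureTheory

/-- The parameter square of a torus. -/
abbrev Square : Type := Icc (0 : ℝ) (2 * Real.pi) × Icc (0 : ℝ) (2 * Real.pi)

lemma zero_le_two_pi : (0 : ℝ) ≤ 2 * Real.pi := by positivity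

/-- The projection of the plane to the parameter square. -/
def toSquare (x y : ℝ) : Square :=
  (projIcc 0 (2 * Real.pi) zero_le_two_pi x, projIcc 0 (2 * Real.pi) zero_le_two_pi y)

lemma continuous_toSquare : Continuous fun p : ℝ × ℝ => toSquare p.1 p.2 := by
  unfold toSquare
  exact (continuous_projIcc.comp continuous_fst).prodMk (continuous_projIcc.comp continuous_snd)

lemma continuous_integrand (φ : C(Square, ℂ)) (x : ℝ) :
    Continuous fun y => φ (toSquare x y) :=
  φ.continuous.comp (continuous_toSquare.comp (Continuous.prodMk_right x))

lemma continuous_inner (φ : C(Square, ℂ)) :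
    Continuous fun x => ∫ y in (0 : ℝ)..2 * Real.pi, φ (toSquare x y) :=
  intervalIntegral.continuous_parametric_intervalIntegral_of_continuous'
    (f := fun x y => φ (toSquare x y)) (φ.continuous.comp continuous_toSquare) _ _

/-- Integration over the parameter square. -/
def squareIntegral : C(Square, ℂ) →L[ℂ] ℂ :=
  LinearMap.mkContinuous
    { toFun := fun φ => ∫ x in (0 : ℝ)..2 * Real.pi, ∫ y in (0 : ℝ)..2 * Real.pi, φ (toSquare x y)
      map_add' := by
        intro φ ψ
        rw [← intervalIntegral.integral_add ((continuous_inner φ).intervalIntegrable _ _)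
          ((continuous_inner ψ).intervalIntegrable _ _)]
        congr 1; ext x
        rw [← intervalIntegral.integral_add ((continuous_integrand φ x).intervalIntegrable _ _)
          ((continuous_integrand ψ x).intervalIntegrable _ _)]
        rfl
      map_smul' := by
        intro c φ
        simp only [ContinuousMap.coe_smul, Pi.smul_apply, intervalIntegral.integral_smul,
          RingHom.id_apply] }
    ((2 * Real.pi) * (2 * Real.pi)) (by
      intro φ
      have h0 := zero_le_two_pi
      have h1 : ∀ x : ℝ, ‖∫ y in (0 : ℝ)..2 * Real.pi, φ (toSquare x y)‖ ≤ ‖φ‖ * (2 * Real.pi) := by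
        intro x
        have := intervalIntegral.norm_integral_le_of_norm_le_const (a := 0) (b := 2 * Real.pi)
          (f := fun y => φ (toSquare x y)) (C := ‖φ‖) (fun y _ => φ.norm_coe_le_norm _)
        simpa [abs_of_nonneg h0, abs_of_pos Real.pi_pos] using this
      have := intervalIntegral.norm_integral_le_of_norm_le_const (a := 0) (b := 2 * Real.pi)
          (f := fun x => ∫ y in (0 : ℝ)..2 * Real.pi, φ (toSquare x y))
          (C := ‖φ‖ * (2 * Real.pi)) (fun x _ => h1 x)
      simp only [sub_zero, abs_of_nonneg h0] at this
      refine this.trans (le_of_eq ?_)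
      ring)

lemma squareIntegral_apply (φ : C(Square, ℂ)) : squareIntegral φ =
    ∫ x in (0 : ℝ)..2 * Real.pi, ∫ y in (0 : ℝ)..2 * Real.pi, φ (toSquare x y) := rfl

lemma ringInverse_apply {φ : C(Square, ℂ)} (h : IsUnit φ) (x : Square) :
    (Ring.inverse φ) x = (φ x)⁻¹ := by
  have := congrArg (fun ψ : C(Square, ℂ) => ψ x) (Ring.mul_inverse_cancel φ h)
  simp only [ContinuousMap.mul_apply, ContinuousMap.one_apply] at this
  exact eq_inv_of_mul_eq_one_right this

/-- Inversion in a Banach algebra is analytic at units. Taking the whole Cauchy kernel as one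
element of `C(Square, ℂ)` avoids differentiating under the integral sign. -/
lemma analyticAt_cauchyKernel {γ : C(Square, ℂ)} {z : ℂ} (h : ∀ x, γ x ≠ z) :
    AnalyticAt ℂ (fun ζ : ℂ => Ring.inverse (γ - algebraMap ℂ C(Square, ℂ) ζ)) z := by
  have hu : IsUnit (γ - algebraMap ℂ C(Square, ℂ) z) := by
    rw [ContinuousMap.isUnit_iff_forall_ne_zero]
    intro x
    simpa [sub_eq_zero] using h x
  obtain ⟨u, hu⟩ := hu
  have h1 : AnalyticAt ℂ (fun ζ : ℂ => γ - algebraMap ℂ C(Square, ℂ) ζ) z :=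
    analyticAt_const.sub ((Algebra.linearMap ℂ C(Square, ℂ)).toContinuousLinearMap.analyticAt z)
  refine AnalyticAt.fun_comp ?_ h1
  rw [← hu]
  exact analyticAt_inverse u

/-- The one-variable Cauchy formula, applied in each variable on a polydisc, writes `f` as an
integral over the torus. The integrand depends analytically on the point as an element of `C(Square,
ℂ)`, and integration is a continuous linear functional. -/
lemma analyticAt_of_differentiableOn_prod {f : ℂ × ℂ → ℂ} {U : Set (ℂ × ℂ)}
    (hf : DifferentiableOn ℂ f U) (hU : IsOpen U) {p : ℂ × ℂ} (hp : p ∈ U) : AnalyticAt ℂ f p := by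
  obtain ⟨r, hr, hrU⟩ := Metric.nhds_basis_closedBall.mem_iff.1 (hU.mem_nhds hp)
  have hcont : ContinuousOn f (closedBall p r) := hf.continuousOn.mono hrU
  have hsub : closedBall p.1 r ×ˢ closedBall p.2 r = closedBall p r := closedBall_prod_same _ _ _
  have hmem : ∀ x y : ℝ, (circleMap p.1 r x, circleMap p.2 r y) ∈ closedBall p r := by
    intro x y
    rw [← hsub]
    exact ⟨circleMap_mem_closedBall _ hr.le _, circleMap_mem_closedBall _ hr.le _⟩
  -- The part of the integrand independent of the point: constants, velocities of the two circles,
  -- and the values of `f` on the torus.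
  let κ : C(Square, ℂ) := ⟨fun t => (2 * Real.pi * I : ℂ)⁻¹ * (2 * Real.pi * I : ℂ)⁻¹ *
      (deriv (circleMap p.1 r) t.1 * deriv (circleMap p.2 r) t.2) *
      f (circleMap p.1 r t.1, circleMap p.2 r t.2), by
    refine Continuous.mul ?_ ?_
    · simp only [deriv_circleMap]
      fun_prop
    · exact hcont.comp_continuous (by fun_prop) (fun t => hmem _ _)⟩
  let γ₁ : C(Square, ℂ) := ⟨fun t => circleMap p.1 r t.1, by fun_prop⟩
  let γ₂ : C(Square, ℂ) := ⟨fun t => circleMap p.2 r t.2, by fun_prop⟩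
  have hne : ∀ c : ℂ, ∀ z ∈ ball c r, ∀ t : ℝ, circleMap c r t ≠ z := by
    rintro c z hz t rfl
    have := circleMap_mem_sphere c hr.le t
    rw [mem_sphere] at this
    rw [mem_ball] at hz
    exact hz.ne this
  have hcauchy : ∀ q ∈ ball p r, f q = squareIntegral (κ *
      (Ring.inverse (γ₁ - algebraMap ℂ C(Square, ℂ) q.1) *
        Ring.inverse (γ₂ - algebraMap ℂ C(Square, ℂ) q.2))) := by
    intro q hq
    rw [← ball_prod_same] at hq
    have hu₁ : IsUnit (γ₁ - algebraMap ℂ C(Square, ℂ) q.1) := by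
      rw [ContinuousMap.isUnit_iff_forall_ne_zero]
      intro x
      simpa [sub_eq_zero, γ₁] using hne _ _ hq.1 _
    have hu₂ : IsUnit (γ₂ - algebraMap ℂ C(Square, ℂ) q.2) := by
      rw [ContinuousMap.isUnit_iff_forall_ne_zero]
      intro x
      simpa [sub_eq_zero, γ₂] using hne _ _ hq.2 _
    have slice₂ : ∀ z ∈ closedBall p.1 r,
        (2 * Real.pi * I : ℂ)⁻¹ • ∮ w in C(p.2, r), (w - q.2)⁻¹ • f (z, w) = f (z, q.2) := by
      intro z hz
      refine two_pi_I_inv_smul_circleIntegral_sub_inv_smul_of_differentiable_on_off_countable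
        (s := ∅) (f := fun w => f (z, w)) countable_empty hq.2 ?_ ?_
      · refine hcont.comp (by fun_prop) (fun w hw => ?_)
        rw [← hsub]; exact ⟨hz, hw⟩
      · intro w hw
        have : (z, w) ∈ U := hrU (by rw [← hsub]; exact ⟨hz, ball_subset_closedBall hw.1⟩)
        exact (hf.differentiableAt (hU.mem_nhds this)).comp w
          ((differentiableAt_const z).prodMk differentiableAt_id)
    have slice₁ :
        (2 * Real.pi * I : ℂ)⁻¹ • ∮ z in C(p.1, r), (z - q.1)⁻¹ • f (z, q.2) = f (q.1, q.2) := by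
      refine two_pi_I_inv_smul_circleIntegral_sub_inv_smul_of_differentiable_on_off_countable
        (s := ∅) (f := fun z => f (z, q.2)) countable_empty hq.1 ?_ ?_
      · refine hcont.comp (by fun_prop) (fun w hw => ?_)
        rw [← hsub]; exact ⟨hw, ball_subset_closedBall hq.2⟩
      · intro z hz
        have : (z, q.2) ∈ U := hrU (by
          rw [← hsub]; exact ⟨ball_subset_closedBall hz.1, ball_subset_closedBall hq.2⟩)
        exact (hf.differentiableAt (hU.mem_nhds this)).comp z
          (differentiableAt_id.prodMk (differentiableAt_const q.2))
    rw [squareIntegral_apply, show f q = f (q.1, q.2) from rfl, ← slice₁, circleIntegral,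
      ← intervalIntegral.integral_smul]
    refine intervalIntegral.integral_congr (fun x hx => ?_)
    rw [uIcc_of_le zero_le_two_pi] at hx
    rw [← slice₂ _ (circleMap_mem_closedBall _ hr.le x), circleIntegral,
      ← intervalIntegral.integral_smul, ← intervalIntegral.integral_smul,
      ← intervalIntegral.integral_smul, ← intervalIntegral.integral_smul]
    refine intervalIntegral.integral_congr (fun y hy => ?_)
    rw [uIcc_of_le zero_le_two_pi] at hy
    simp only [ContinuousMap.mul_apply, ringInverse_apply hu₁, ringInverse_apply hu₂, toSquare,
      projIcc_of_mem zero_le_two_pi hx, projIcc_of_mem zero_le_two_pi hy, κ, γ₁, γ₂,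
      ContinuousMap.coe_mk, ContinuousMap.sub_apply, smul_eq_mul, algebraMap_apply]
    ring
  have hpb : p ∈ ball p r := mem_ball_self hr
  have hpb' := hpb
  rw [← ball_prod_same] at hpb'
  have h₁ := analyticAt_cauchyKernel (γ := γ₁) (z := p.1) fun x => hne _ _ hpb'.1 _
  have h₂ := analyticAt_cauchyKernel (γ := γ₂) (z := p.2) fun x => hne _ _ hpb'.2 _
  have h₃ : AnalyticAt ℂ (fun q : ℂ × ℂ => κ *
      (Ring.inverse (γ₁ - algebraMap ℂ C(Square, ℂ) q.1) *
        Ring.inverse (γ₂ - algebraMap ℂ C(Square, ℂ) q.2))) p :=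
    analyticAt_const.mul ((h₁.comp_of_eq analyticAt_fst rfl).mul
      (h₂.comp_of_eq analyticAt_snd rfl))
  refine ((squareIntegral.analyticAt _).fun_comp h₃).congr ?_
  filter_upwards [isOpen_ball.mem_nhds hpb] with q hq
  exact (hcauchy q hq).symm

/-- The coordinates on the model space as a continuous linear equivalence. -/
def modelEquiv : E2 ≃L[ℂ] ℂ × ℂ :=
  (EuclideanSpace.equiv (Fin 2) ℂ).trans (ContinuousLinearEquiv.finTwoArrow ℂ ℂ)

lemma analyticAt_of_differentiableOn {f : E2 → ℂ} {U : Set E2}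
    (hf : DifferentiableOn ℂ f U) (hU : IsOpen U) {u : E2} (hu : u ∈ U) : AnalyticAt ℂ f u := by
  have h := analyticAt_of_differentiableOn_prod (f := f ∘ modelEquiv.symm)
    (U := modelEquiv.symm ⁻¹' U) (hf.comp modelEquiv.symm.differentiableOn (fun _ h => h))
    (hU.preimage modelEquiv.symm.continuous) (p := modelEquiv u)
    (by rwa [mem_preimage, modelEquiv.symm_apply_apply])
  have h2 := h.comp (modelEquiv.toContinuousLinearMap.analyticAt u)
  refine h2.congr (Filter.Eventually.of_forall fun v => ?_)
  exact congrArg f (modelEquiv.symm_apply_apply v)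

/-- **Osgood's lemma** in dimension two. -/
lemma contDiffOn_of_differentiableOn {f : E2 → E2} {U : Set E2}
    (hf : DifferentiableOn ℂ f U) (hU : IsOpen U) {n : WithTop ℕ∞} : ContDiffOn ℂ n f U := by
  rw [contDiffOn_euclidean]
  intro i
  rw [differentiableOn_euclidean] at hf
  exact fun u hu =>
    (analyticAt_of_differentiableOn (hf i) hU hu).contDiffAt.contDiffWithinAt

end Osgood

/-! ## Local analysis in the model space -/

section LocalAnalysis

open Complex Set Metric Filter

/-- The point of the model space with the given coordinates. -/
def mk2 (a b : ℂ) : E2 := modelEquiv.symm (a, b)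

@[simp] lemma mk2_zero (a b : ℂ) : mk2 a b 0 = a := rfl

@[simp] lemma mk2_one (a b : ℂ) : mk2 a b 1 = b := rfl

@[simp] lemma mk2_eta (u : E2) : mk2 (u 0) (u 1) = u := modelEquiv.symm_apply_apply u

lemma E2.ext {u v : E2} (h0 : u 0 = v 0) (h1 : u 1 = v 1) : u = v := by
  rw [← mk2_eta u, ← mk2_eta v, h0, h1]

lemma mk2_eq_iff {a b : ℂ} {u : E2} : mk2 a b = u ↔ a = u 0 ∧ b = u 1 := by
  constructor
  · rintro rfl; simp
  · rintro ⟨rfl, rfl⟩; simp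

lemma E2.eq_add (v : E2) : v = v 0 • mk2 1 0 + v 1 • mk2 0 1 := by
  apply E2.ext <;> simp

lemma continuous_mk2 {α : Type*} [TopologicalSpace α] {f g : α → ℂ} (hf : Continuous f)
    (hg : Continuous g) : Continuous fun x => mk2 (f x) (g x) :=
  modelEquiv.symm.continuous.comp (hf.prodMk hg)

lemma DifferentiableAt.mk2 {E : Type*} [NormedAddCommGroup E] [NormedSpace ℂ E] {f g : E → ℂ}
    {x : E} (hf : DifferentiableAt ℂ f x) (hg : DifferentiableAt ℂ g x) :
    DifferentiableAt ℂ (fun x => mk2 (f x) (g x)) x :=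
  modelEquiv.symm.differentiableAt.comp x (hf.prodMk hg)

lemma HasFDerivAt.mk2 {E : Type*} [NormedAddCommGroup E] [NormedSpace ℂ E] {f g : E → ℂ}
    {f' g' : E →L[ℂ] ℂ} {x : E} (hf : HasFDerivAt f f' x) (hg : HasFDerivAt g g' x) :
    HasFDerivAt (fun x => mk2 (f x) (g x))
      ((modelEquiv.symm : ℂ × ℂ →L[ℂ] E2).comp (f'.prod g')) x :=
  modelEquiv.symm.hasFDerivAt.comp x (hf.prodMk hg)

/-- The coordinate functions on the model space. -/
def coordL (i : Fin 2) : E2 →L[ℂ] ℂ := EuclideanSpace.proj i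

@[simp] lemma coordL_apply (i : Fin 2) (u : E2) : coordL i u = u i := rfl

lemma differentiable_coord (i : Fin 2) : Differentiable ℂ fun u : E2 => u i :=
  (coordL i).differentiable

lemma continuous_coord (i : Fin 2) : Continuous fun u : E2 => u i :=
  (coordL i).continuous

/-- A holomorphic function of two variables has no isolated zeros; it suffices that the function is
holomorphic outside the zero. -/
theorem no_isolated_zero {r : E2 → ℂ} {U : Set E2} {p : E2} (hU : U ∈ 𝓝 p)
    (hr : ∀ u ∈ U, u ≠ p → DifferentiableAt ℂ r u) (h0 : ∀ u ∈ U, u ≠ p → r u ≠ 0)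
    (hlim : Tendsto r (𝓝[≠] p) (𝓝 0)) : False := by
  have hc : Continuous fun q : ℂ × ℂ => p + mk2 q.1 q.2 :=
    continuous_const.add (continuous_mk2 continuous_fst continuous_snd)
  have hU' : (fun q : ℂ × ℂ => p + mk2 q.1 q.2) ⁻¹' U ∈ 𝓝 (0 : ℂ × ℂ) := by
    refine hc.continuousAt.preimage_mem_nhds ?_
    have : p + mk2 (0 : ℂ × ℂ).1 (0 : ℂ × ℂ).2 = p := by
      apply E2.ext <;> simp
    rwa [this]
  obtain ⟨ρ, hρ, hρU⟩ := Metric.nhds_basis_closedBall.mem_iff.1 hU'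
  have hsub : closedBall (0 : ℂ) ρ ×ˢ closedBall (0 : ℂ) ρ = closedBall (0 : ℂ × ℂ) ρ :=
    closedBall_prod_same _ _ _
  have hmem : ∀ z ∈ closedBall (0 : ℂ) ρ, ∀ w ∈ closedBall (0 : ℂ) ρ, p + mk2 z w ∈ U := by
    intro z hz w hw
    exact @hρU (z, w) (by rw [← hsub]; exact ⟨hz, hw⟩)
  have hne : ∀ z w : ℂ, (z ≠ 0 ∨ w ≠ 0) → p + mk2 z w ≠ p := by
    intro z w h heq
    have h2 : mk2 z w = 0 := by simpa using heq
    rw [mk2_eq_iff] at h2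
    simp only [PiLp.zero_apply] at h2
    tauto
  -- the bound for `1 / r` on the product of the circle and the disc
  have hK : IsCompact (sphere (0 : ℂ) ρ ×ˢ closedBall (0 : ℂ) ρ) :=
    (isCompact_sphere _ _).prod (isCompact_closedBall _ _)
  have hcontK : ContinuousOn (fun q : ℂ × ℂ => (r (p + mk2 q.1 q.2))⁻¹)
      (sphere (0 : ℂ) ρ ×ˢ closedBall (0 : ℂ) ρ) := by
    rintro ⟨z, w⟩ ⟨hz, hw⟩
    have hz0 : z ≠ 0 := by
      rintro rfl
      simp only [mem_sphere, dist_self] at hz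
      exact hρ.ne hz
    have h1 := hmem z (sphere_subset_closedBall hz) w hw
    have h2 := hne z w (Or.inl hz0)
    have h3 : ContinuousAt (fun q : ℂ × ℂ => r (p + mk2 q.1 q.2)) (z, w) :=
      ContinuousAt.comp (f := fun q : ℂ × ℂ => p + mk2 q.1 q.2) (x := (z, w))
        (hr _ h1 h2).continuousAt hc.continuousAt
    exact (h3.inv₀ (h0 _ h1 h2)).continuousWithinAt
  obtain ⟨C, hC⟩ := hK.exists_bound_of_continuousOn hcontK
  -- the maximum principle on slices
  have hbound : ∀ w ∈ closedBall (0 : ℂ) ρ, w ≠ 0 → ‖(r (p + mk2 0 w))⁻¹‖ ≤ C := by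
    intro w hw hw0
    refine Complex.norm_le_of_forall_mem_frontier_norm_le (U := ball (0 : ℂ) ρ)
      (f := fun z => (r (p + mk2 z w))⁻¹) isBounded_ball ?_ ?_
      (subset_closure (mem_ball_self hρ))
    · refine DifferentiableOn.diffContOnCl (fun z hz => ?_)
      rw [closure_ball _ hρ.ne'] at hz
      have h1 := hmem z hz w hw
      have h2 := hne z w (Or.inr hw0)
      have h3 : DifferentiableAt ℂ (fun z : ℂ => p + mk2 z w) z :=
        (differentiableAt_const p).add
          (DifferentiableAt.mk2 differentiableAt_id (differentiableAt_const w))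
      have h4 : DifferentiableAt ℂ (fun z : ℂ => r (p + mk2 z w)) z := (hr _ h1 h2).comp z h3
      exact (h4.inv (h0 _ h1 h2)).differentiableWithinAt
    · intro z hz
      rw [frontier_ball _ hρ.ne'] at hz
      exact hC (z, w) ⟨hz, hw⟩
  -- Along the axis through `p` the function `1 / r` must blow up, against the bound `C`.
  have hray : Tendsto (fun w : ℂ => p + mk2 0 w) (𝓝[≠] 0) (𝓝[≠] p) := by
    refine tendsto_nhdsWithin_iff.2 ⟨?_, ?_⟩
    · have h3 : Continuous (fun w : ℂ => p + mk2 0 w) :=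
        continuous_const.add (continuous_mk2 continuous_const continuous_id)
      have h4 := h3.tendsto 0
      have h5 : p + mk2 0 0 = p := by
        apply E2.ext <;> simp
      rw [h5] at h4
      exact h4.mono_left nhdsWithin_le_nhds
    · filter_upwards [self_mem_nhdsWithin] with w hw
      exact hne 0 w (Or.inr hw)
  have hlim' : Tendsto (fun w : ℂ => ‖r (p + mk2 0 w)‖) (𝓝[≠] 0) (𝓝 0) := by
    simpa using (hlim.comp hray).norm
  have hC0 : 0 < |C| + 1 := by positivity
  have hev : ∀ᶠ w : ℂ in 𝓝[≠] 0, ‖r (p + mk2 0 w)‖ < (|C| + 1)⁻¹ :=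
    hlim'.eventually_lt_const (by positivity)
  have hev2 : ∀ᶠ w : ℂ in 𝓝[≠] 0, w ∈ closedBall (0 : ℂ) ρ :=
    nhdsWithin_le_nhds (closedBall_mem_nhds 0 hρ)
  obtain ⟨w, h1, h2, h3⟩ := (hev.and (hev2.and self_mem_nhdsWithin)).exists
  have h4 := hbound w h2 h3
  have h5 : r (p + mk2 0 w) ≠ 0 :=
    h0 _ (hmem 0 (mem_closedBall_self hρ.le) w h2) (hne 0 w (Or.inr h3))
  rw [norm_inv] at h4
  have h6 : 0 < ‖r (p + mk2 0 w)‖ := norm_pos_iff.2 h5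
  have h7 := inv_lt_inv₀ hC0 (inv_pos.2 hC0) |>.2
  have h8 : |C| + 1 < ‖r (p + mk2 0 w)‖⁻¹ := by
    rw [lt_inv_comm₀ hC0 h6]; exact h1
  linarith [le_abs_self C]

/-- If a holomorphic function of two variables vanishes only on the line `u 1 = 0` then its zero set
is open in this line. -/
theorem eventually_zero_on_line {r : E2 → ℂ} {U : Set E2} {s : ℂ} (hU : IsOpen U)
    (hs : mk2 s 0 ∈ U) (hr : DifferentiableOn ℂ r U) (h0 : ∀ u ∈ U, u 1 ≠ 0 → r u ≠ 0)
    (hz : r (mk2 s 0) = 0) : ∀ᶠ t in 𝓝 s, r (mk2 t 0) = 0 := by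
  have hline : DifferentiableAt ℂ (fun t : ℂ => mk2 t 0) s :=
    DifferentiableAt.mk2 differentiableAt_id (differentiableAt_const _)
  have han : AnalyticAt ℂ (fun t : ℂ => r (mk2 t 0)) s := by
    have hline' : Differentiable ℂ (fun t : ℂ => mk2 t 0) :=
      fun t => DifferentiableAt.mk2 differentiableAt_id (differentiableAt_const _)
    exact (hr.comp hline'.differentiableOn (fun t ht => ht)).analyticAt
      ((hU.preimage hline'.continuous).mem_nhds hs)
  -- If the zero were isolated on the line, it would be isolated in the plane, as there are no zeros
  -- off the line.
  rcases han.eventually_eq_zero_or_eventually_ne_zero with h | h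
  · exact h
  · exfalso
    rw [eventually_nhdsWithin_iff] at h
    have hc : Tendsto (fun u : E2 => u 0) (𝓝 (mk2 s 0)) (𝓝 s) := (continuous_coord 0).tendsto _
    have hV : U ∩ {u : E2 | u 0 ∈ ({s}ᶜ : Set ℂ) → r (mk2 (u 0) 0) ≠ 0} ∈ 𝓝 (mk2 s 0) :=
      inter_mem (hU.mem_nhds hs) (hc.eventually h)
    refine no_isolated_zero (r := r) hV
      (fun u hu _ => hr.differentiableAt (hU.mem_nhds hu.1)) ?_ ?_
    · intro u hu hne
      by_cases h1 : u 1 = 0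
      · have h2 : u 0 ≠ s := by
          rintro h3
          exact hne (E2.ext h3 h1)
        have h3 := hu.2 h2
        have h4 : mk2 (u 0) 0 = u := by rw [mk2_eq_iff]; exact ⟨rfl, h1.symm⟩
        rwa [h4] at h3
      · exact h0 u hu.1 h1
    · have := (hr.differentiableAt (hU.mem_nhds hs)).continuousAt.tendsto
      rw [hz] at this
      exact this.mono_left nhdsWithin_le_nhds

/-- A holomorphic function of one variable that is injective on a punctured neighbourhood of a point
has nonzero derivative there. -/
theorem deriv_ne_zero_of_injOn {k : ℂ → ℂ} {V : Set ℂ} {c : ℂ} (hk : AnalyticAt ℂ k c)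
    (hV : V ∈ 𝓝 c) (hinj : InjOn k (V \ {c})) : deriv k c ≠ 0 := by
  intro hd
  have hk1 : AnalyticAt ℂ (fun z => k z - k c) c := hk.sub analyticAt_const
  have hne : ¬ ∀ᶠ z in 𝓝 c, k z - k c = 0 := by
    intro h
    have h1 : ∀ᶠ z in 𝓝[≠] c, z ∈ V \ {c} ∧ k z - k c = 0 := by
      filter_upwards [nhdsWithin_le_nhds h, nhdsWithin_le_nhds hV, self_mem_nhdsWithin]
        with z h1 h2 h3
      exact ⟨⟨h2, h3⟩, h1⟩
    obtain ⟨z, hz⟩ := h1.exists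
    have h2 : ∀ᶠ y in 𝓝[≠] c, y ≠ z :=
      nhdsWithin_le_nhds (isOpen_ne.mem_nhds (Ne.symm hz.1.2))
    obtain ⟨y, hy, hyz⟩ := (h1.and h2).exists
    exact hyz (hinj hy.1 hz.1 (by rw [sub_eq_zero.1 hy.2, sub_eq_zero.1 hz.2]))
  -- Here `n` is the order of vanishing of `k - k c`. A zero derivative forces `n ≥ 2`, and then `k`
  -- is locally an `n`-th power, hence not injective.
  obtain ⟨n, g, hg, hg0, hgn⟩ := (hk1.exists_eventuallyEq_pow_smul_nonzero_iff).2 hne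
  have hn2 : 2 ≤ n := by
    by_contra! hlt
    interval_cases n
    · have := hgn.self_of_nhds
      simp at this
      exact hg0 this.symm
    · have h1 : HasDerivAt (fun z => k z - k c) (g c) c := by
        have h2 : HasDerivAt (fun z => (z - c) ^ 1 • g z) (g c) c := by
          refine (((hasDerivAt_id c).sub_const c).mul
            hg.differentiableAt.hasDerivAt).congr_deriv ?_ |>.congr_of_eventuallyEq ?_
          · simp
          · exact Eventually.of_forall fun z => by simp
        exact h2.congr_of_eventuallyEq hgn
      have h3 : HasDerivAt k (g c) c := by simpa using h1.add_const (k c)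
      exact hg0 (h3.deriv.symm.trans hd)
  -- an `n`-th root of `g`
  let φ : ℂ → ℂ := fun z => (z - c) * exp (log (g z / g c) / n)
  have hslit : g c / g c ∈ slitPlane := by rw [div_self hg0]; exact one_mem_slitPlane
  have hlog : AnalyticAt ℂ (fun z => exp (log (g z / g c) / n)) c :=
    (((hg.div_const).clog hslit).div_const).cexp'
  have hφ : AnalyticAt ℂ φ c := (analyticAt_id.sub analyticAt_const).mul hlog
  have hφ' : HasStrictDerivAt φ 1 c := by
    have h1 := ((hasDerivAt_id c).sub_const c).mul hlog.differentiableAt.hasDerivAt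
    have h2 : HasDerivAt φ 1 c := by
      refine h1.congr_deriv ?_
      simp [div_self hg0]
    have h3 := hφ.hasStrictDerivAt
    rwa [h2.deriv] at h3
  have hmap := hφ'.map_nhds_eq one_ne_zero
  have hφc : φ c = 0 := by simp [φ]
  rw [hφc] at hmap
  have hpow : ∀ᶠ z in 𝓝 c, k z = k c + φ z ^ n * g c := by
    have h1 : ∀ᶠ z in 𝓝 c, g z ≠ 0 := hg.continuousAt.eventually_ne hg0
    filter_upwards [hgn, h1] with z hz hz1
    have h2 : exp (log (g z / g c) / n) ^ n = g z / g c := by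
      rw [← exp_nat_mul, mul_div_cancel₀, exp_log (div_ne_zero hz1 hg0)]
      exact_mod_cast (by omega : n ≠ 0)
    rw [mul_pow, h2, mul_assoc, div_mul_cancel₀ _ hg0, ← sub_eq_iff_eq_add', hz, smul_eq_mul]
  have himg : φ '' (V ∩ {z | k z = k c + φ z ^ n * g c}) ∈ 𝓝 (0 : ℂ) := by
    rw [← hmap]
    exact image_mem_map (inter_mem hV hpow)
  obtain ⟨ε, hε, hεV⟩ := Metric.nhds_basis_closedBall.mem_iff.1 himg
  -- The points `ε` and `ζ ε` both lie in the image of the local coordinate `φ` and have the same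
  -- `n`-th power.
  let ζ : ℂ := exp (2 * Real.pi * I / n)
  have hζ : IsPrimitiveRoot ζ n := Complex.isPrimitiveRoot_exp n (by omega)
  have hεn : ‖(ε : ℂ)‖ ≤ ε := by rw [Complex.norm_of_nonneg hε.le]
  obtain ⟨z₁, ⟨hz₁, hz₁'⟩, h₁⟩ := hεV (mem_closedBall_zero_iff.2 hεn)
  obtain ⟨z₂, ⟨hz₂, hz₂'⟩, h₂⟩ := hεV (a := ζ * ε) (mem_closedBall_zero_iff.2 (by
    rw [norm_mul, hζ.norm'_eq_one (by omega), one_mul]; exact hεn))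
  have hε0 : (ε : ℂ) ≠ 0 := by exact_mod_cast hε.ne'
  have hz₁c : z₁ ≠ c := by rintro rfl; rw [hφc] at h₁; exact hε0 h₁.symm
  have hz₂c : z₂ ≠ c := by
    rintro rfl; rw [hφc] at h₂
    exact mul_ne_zero (hζ.ne_zero (by omega)) hε0 h₂.symm
  have heq : k z₁ = k z₂ := by
    rw [hz₁', hz₂', h₁, h₂, mul_pow, hζ.pow_eq_one, one_mul]
  have h3 := hinj ⟨hz₁, hz₁c⟩ ⟨hz₂, hz₂c⟩ heq
  rw [h3, h₂] at h₁
  have h4 : ζ = 1 := mul_right_cancel₀ hε0 (h₁.trans (one_mul _).symm)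
  exact hζ.ne_one (by omega) h4

/-- A holomorphic map that is injective off the line `u 1 = 0` and degenerate at a point of this
line contracts the direction of the line. -/
theorem fderiv_line_eq_zero {ψ : E2 → E2} {U : Set E2} {y : E2} (hU : IsOpen U) (hy : y ∈ U)
    (hy1 : y 1 = 0) (hψ : DifferentiableOn ℂ ψ U) (hinj : InjOn ψ (U ∩ {u | u 1 ≠ 0}))
    (hdeg : ¬ Function.Injective (fderiv ℂ ψ y)) : fderiv ℂ ψ y (mk2 1 0) = 0 := by
  -- Otherwise the kernel of the differential is transverse to the line. On the level curve through
  -- `y` of a suitable component of `ψ`, the other component has derivative zero at `y`, yet it is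
  -- injective on the rest of the curve, which lies off the line.
  by_contra hne
  set T := fderiv ℂ ψ y with hT
  obtain ⟨v, hv, hTv⟩ : ∃ v, v ≠ 0 ∧ T v = 0 := by
    rw [injective_iff_map_eq_zero] at hdeg
    push Not at hdeg
    obtain ⟨v, h1, h2⟩ := hdeg
    exact ⟨v, h2, h1⟩
  have hv1 : v 1 ≠ 0 := by
    intro h
    rw [E2.eq_add v, h, zero_smul, add_zero, map_smul, smul_eq_zero] at hTv
    rcases hTv with h0 | h0
    · exact hv (E2.ext h0 h)
    · exact hne h0
  obtain ⟨i, i', hi, hii'⟩ : ∃ i i' : Fin 2, T (mk2 1 0) i ≠ 0 ∧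
      ∀ u v : E2, u i = v i → u i' = v i' → u = v := by
    by_cases h : T (mk2 1 0) 0 = 0
    · refine ⟨1, 0, fun h1 => hne (E2.ext h h1), fun u v h1 h2 => E2.ext h2 h1⟩
    · exact ⟨0, 1, h, fun u v h1 h2 => E2.ext h1 h2⟩
  have hψy : HasFDerivAt ψ T y := (hψ.differentiableAt (hU.mem_nhds hy)).hasFDerivAt
  have hψc : ContDiffAt ℂ ω ψ y :=
    (contDiffOn_of_differentiableOn hψ hU).contDiffAt (hU.mem_nhds hy)
  let Φ : E2 → E2 := fun u => mk2 (ψ u i) (u 1)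
  have hΦd : ∀ u ∈ U, DifferentiableAt ℂ Φ u := fun u hu =>
    DifferentiableAt.mk2 ((coordL i).differentiableAt.comp u (hψ.differentiableAt (hU.mem_nhds hu)))
      (differentiable_coord 1 u)
  have hΦc : ContDiffAt ℂ ω Φ y :=
    (contDiffOn_of_differentiableOn (fun u hu => (hΦd u hu).differentiableWithinAt) hU).contDiffAt
      (hU.mem_nhds hy)
  let Φ' : E2 →L[ℂ] E2 :=
    (modelEquiv.symm : ℂ × ℂ →L[ℂ] E2).comp (((coordL i).comp T).prod (coordL 1))
  have hΦ'a : ∀ u, Φ' u = mk2 (T u i) (u 1) := fun u => rfl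
  have hΦ' : HasFDerivAt Φ Φ' y :=
    HasFDerivAt.mk2 ((coordL i).hasFDerivAt.comp y hψy) (coordL 1).hasFDerivAt
  have hker : LinearMap.ker (Φ' : E2 →ₗ[ℂ] E2) = ⊥ := by
    rw [LinearMap.ker_eq_bot']
    intro u hu
    have hu' : mk2 (T u i) (u 1) = 0 := hu
    rw [mk2_eq_iff] at hu'
    obtain ⟨h1, h2⟩ := hu'
    simp only [PiLp.zero_apply] at h1 h2
    rw [E2.eq_add u, h2, zero_smul, add_zero, map_smul, PiLp.smul_apply, smul_eq_mul,
      mul_eq_zero] at h1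
    rcases h1 with h1 | h1
    · exact E2.ext h1 h2
    · exact absurd h1 hi
  let Ψ : E2 ≃L[ℂ] E2 := ContinuousLinearEquiv.ofBijective Φ' hker
    (LinearMap.range_eq_top.2 (LinearMap.injective_iff_surjective.1 (LinearMap.ker_eq_bot.1 hker)))
  have hΨ : HasFDerivAt Φ (Ψ : E2 →L[ℂ] E2) y := hΦ'
  have hω : (ω : WithTop ℕ∞) ≠ 0 := by simp
  let χ := hΦc.localInverse hΨ hω
  have hχc : ContDiffAt ℂ ω χ (Φ y) := hΦc.to_localInverse hΨ hω
  have hstrict : HasStrictFDerivAt Φ (Ψ : E2 →L[ℂ] E2) y := hΦc.hasStrictFDerivAt' hΨ hω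
  have hχy : χ (Φ y) = y := hstrict.localInverse_apply_image
  have hχr : ∀ᶠ z in 𝓝 (Φ y), Φ (χ z) = z := hstrict.eventually_right_inverse
  have hχd : HasFDerivAt χ (Ψ.symm : E2 →L[ℂ] E2) (Φ y) := hstrict.to_localInverse.hasFDerivAt
  -- the curve on which one coordinate of `ψ` is constant
  let ℓ : ℂ → E2 := fun a => mk2 (ψ y i) a
  have hℓ0 : ℓ 0 = Φ y := by simp [ℓ, Φ, hy1]
  have hℓc : ContDiff ℂ ω ℓ := modelEquiv.symm.contDiff.comp (contDiff_const.prodMk contDiff_id)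
  have hℓd : HasDerivAt ℓ (mk2 0 1) 0 := by
    have := (modelEquiv.symm : ℂ × ℂ →L[ℂ] E2).hasFDerivAt.comp_hasDerivAt (0 : ℂ)
      ((hasDerivAt_const (0 : ℂ) (ψ y i)).prodMk (hasDerivAt_id (0 : ℂ)))
    exact this
  let γ : ℂ → E2 := fun a => χ (ℓ a)
  have hγ0 : γ 0 = y := by simp only [γ, hℓ0, hχy]
  have hγc : ContDiffAt ℂ ω γ 0 := by
    have h1 : ContDiffAt ℂ ω χ (ℓ 0) := by rw [hℓ0]; exact hχc
    exact h1.comp 0 hℓc.contDiffAt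
  have hγd : HasDerivAt γ (Ψ.symm (mk2 0 1)) 0 := by
    have h1 : HasFDerivAt χ (Ψ.symm : E2 →L[ℂ] E2) (ℓ 0) := by rw [hℓ0]; exact hχd
    exact h1.comp_hasDerivAt (0 : ℂ) hℓd
  set τ := Ψ.symm (mk2 0 1) with hτ
  have hτ' : mk2 (T τ i) (τ 1) = mk2 0 1 := by
    have : Ψ τ = mk2 0 1 := Ψ.apply_symm_apply _
    exact this
  rw [mk2_eq_iff] at hτ'
  simp only [mk2_zero, mk2_one] at hτ'
  -- `T` has rank one, with image spanned by `T (mk2 1 0)`, whose `i`-th coordinate is nonzero.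
  -- Since `T τ` has `i`-th coordinate zero, it vanishes.
  have hTτ : T τ = 0 := by
    have h1 : T τ = (τ 0 - (v 1)⁻¹ * v 0) • T (mk2 1 0) := by
      have h2 : τ = (v 1)⁻¹ • v + (τ 0 - (v 1)⁻¹ * v 0) • mk2 1 0 := by
        apply E2.ext
        · simp
        · simp [hτ'.2, inv_mul_cancel₀ hv1]
      conv_lhs => rw [h2]
      rw [map_add, map_smul, hTv, smul_zero, zero_add, map_smul]
    have h3 := hτ'.1
    rw [h1, PiLp.smul_apply, smul_eq_mul, mul_eq_zero] at h3
    rcases h3 with h3 | h3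
    · rw [h1, h3, zero_smul]
    · exact absurd h3 hi
  let k : ℂ → ℂ := fun a => ψ (γ a) i'
  have hkc : AnalyticAt ℂ k 0 := by
    have h1 : ContDiffAt ℂ ω ψ (γ 0) := by rw [hγ0]; exact hψc
    have h2 : ContDiffAt ℂ ω k 0 :=
      ((coordL i').contDiff.contDiffAt.comp 0 (h1.comp 0 hγc))
    exact h2.analyticAt
  have hkd : HasDerivAt k 0 0 := by
    have h1 : HasFDerivAt ψ T (γ 0) := by rw [hγ0]; exact hψy
    have h2 := (coordL i').hasFDerivAt.comp_hasDerivAt (0 : ℂ) (h1.comp_hasDerivAt (0 : ℂ) hγd)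
    rw [hTτ, map_zero] at h2
    exact h2
  have hV : ∀ᶠ a in 𝓝 (0 : ℂ), γ a ∈ U ∧ Φ (γ a) = ℓ a := by
    have h1 : Tendsto γ (𝓝 0) (𝓝 y) := by
      have := hγd.continuousAt.tendsto
      rwa [hγ0] at this
    have h2 : Tendsto ℓ (𝓝 0) (𝓝 (Φ y)) := by
      have := hℓd.continuousAt.tendsto
      rwa [hℓ0] at this
    exact (h1.eventually (hU.mem_nhds hy)).and (h2.eventually hχr)
  refine deriv_ne_zero_of_injOn hkc hV ?_ hkd.deriv
  rintro a ⟨⟨ha, ha2⟩, ha0⟩ b ⟨⟨hb, hb2⟩, hb0⟩ hab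
  have ha' := mk2_eq_iff.1 ha2
  have hb' := mk2_eq_iff.1 hb2
  simp only [ℓ, mk2_zero, mk2_one] at ha' hb'
  have h1 : ψ (γ a) = ψ (γ b) := hii' _ _ (ha'.1.trans hb'.1.symm) hab
  have h2 := hinj ⟨ha, by simpa [ha'.2] using ha0⟩ ⟨hb, by simpa [hb'.2] using hb0⟩ h1
  rw [← ha'.2, ← hb'.2, h2]

end LocalAnalysis

/-! ## The topology of the double cover -/

section CoverTopology

open Set Filter

variable {l : Fin 6 → LinearForm}

/-- The action of a scalar on the weighted affine space. -/
def act (t : ℂ) : (Fin 3 → ℂ) × ℂ →L[ℂ] (Fin 3 → ℂ) × ℂ :=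
  (t • ContinuousLinearMap.id ℂ (Fin 3 → ℂ)).prodMap (t ^ 3 • ContinuousLinearMap.id ℂ ℂ)

@[simp] lemma act_apply (t : ℂ) (p : (Fin 3 → ℂ) × ℂ) : act t p = (t • p.1, t ^ 3 * p.2) := rfl

lemma equation_act (t : ℂ) (p : (Fin 3 → ℂ) × ℂ) :
    equation l (act t p) = t ^ 6 * equation l p := by
  simp only [equation, act_apply, map_smul, smul_eq_mul, Finset.prod_mul_distrib,
    Finset.prod_const, Finset.card_univ, Fintype.card_fin]
  ring

/-- The point of the cone with the given coordinates. -/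
def Cone.mk (p : (Fin 3 → ℂ) × ℂ) (h : p.1 ≠ 0 ∧ equation l p = 0) : Cone l := ⟨p, h⟩

@[simp] lemma Cone.mk_val (p : (Fin 3 → ℂ) × ℂ) (h : p.1 ≠ 0 ∧ equation l p = 0) :
    (Cone.mk p h).1 = p := rfl

lemma act_mem {t : ℂ} (ht : t ≠ 0) {p : (Fin 3 → ℂ) × ℂ} (h : p.1 ≠ 0 ∧ equation l p = 0) :
    (act t p).1 ≠ 0 ∧ equation l (act t p) = 0 :=
  ⟨smul_ne_zero ht h.1, by rw [equation_act, h.2, mul_zero]⟩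

lemma mk_eq_mk {p q : Cone l} : DoubleCover.mk p = DoubleCover.mk q ↔
    ∃ t : ℂ, t ≠ 0 ∧ q.1 = act t p.1 := by
  refine (Quotient.eq (r := coneSetoid l)).trans ?_
  constructor
  · rintro ⟨t, ht, h1, h2⟩
    exact ⟨t, ht, Prod.ext h1 h2⟩
  · rintro ⟨t, ht, h⟩
    exact ⟨t, ht, congrArg Prod.fst h, congrArg Prod.snd h⟩

lemma mk_act {t : ℂ} (ht : t ≠ 0) {p : (Fin 3 → ℂ) × ℂ} (h : p.1 ≠ 0 ∧ equation l p = 0) :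
    DoubleCover.mk (Cone.mk (act t p) (act_mem ht h)) = DoubleCover.mk (Cone.mk p h) :=
  (mk_eq_mk.2 ⟨t, ht, rfl⟩).symm

lemma mk_surjective (P : DoubleCover l) : ∃ p : Cone l, DoubleCover.mk p = P :=
  Quotient.exists_rep P

lemma continuous_mk : Continuous (DoubleCover.mk (l := l)) := continuous_quotient_mk'

lemma continuous_coneVal : Continuous fun p : Cone l => p.1 := continuous_subtype_val

/-- The quotient is by a group acting through continuous maps, so the saturation of an open set is a
union of open translates. -/
lemma isOpenMap_mk : IsOpenMap (DoubleCover.mk (l := l)) := by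
  intro U hU
  have : IsOpen (DoubleCover.mk ⁻¹' (DoubleCover.mk (l := l) '' U)) := by
    have h : DoubleCover.mk ⁻¹' (DoubleCover.mk (l := l) '' U) =
        ⋃ t : {t : ℂ // t ≠ 0}, (fun p : Cone l => Cone.mk (act t p.1) (act_mem t.2 p.2)) ⁻¹' U := by
      ext p
      simp only [mem_preimage, mem_image, mem_iUnion]
      constructor
      · rintro ⟨q, hq, h⟩
        obtain ⟨t, ht, h1⟩ := mk_eq_mk.1 h.symm
        refine ⟨⟨t, ht⟩, ?_⟩
        have : q = Cone.mk (act t p.1) (act_mem ht p.2) := Subtype.ext h1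
        have h2 : Cone.mk (act t p.1) (act_mem ht p.2) ∈ U := this ▸ hq
        exact h2
      · rintro ⟨t, ht⟩
        exact ⟨_, ht, mk_act t.2 p.2⟩
    rw [h]
    refine isOpen_iUnion fun t => hU.preimage ?_
    exact Continuous.subtype_mk ((act t).continuous.comp continuous_coneVal) _
  exact this

@[simp] lemma linearRatio_mk (a b : LinearForm) (p : Cone l) :
    linearRatio a b (DoubleCover.mk p) = a p.1.1 / b p.1.1 := rfl

@[simp] lemma cubicRatio_mk (b : LinearForm) (p : Cone l) :
    cubicRatio b (DoubleCover.mk p) = p.1.2 / b p.1.1 ^ 3 := rfl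

lemma continuous_linearForm (m : LinearForm) : Continuous m := m.continuous_of_finiteDimensional

/-- The open subset of the double cover where a linear form does not vanish. -/
def nonvanishing (l : Fin 6 → LinearForm) (m : LinearForm) : Set (DoubleCover l) :=
  {P | ∃ p : Cone l, DoubleCover.mk p = P ∧ m p.1.1 ≠ 0}

lemma mk_mem_nonvanishing {m : LinearForm} {p : Cone l} :
    DoubleCover.mk p ∈ nonvanishing l m ↔ m p.1.1 ≠ 0 := by
  constructor
  · rintro ⟨q, hq, h⟩
    obtain ⟨t, ht, h1⟩ := mk_eq_mk.1 hq.symm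
    rw [h1, act_apply, map_smul, smul_eq_mul] at h
    exact right_ne_zero_of_mul h
  · exact fun h => ⟨p, rfl, h⟩

/-! ### The regular locus -/

lemma differentiable_linearForm (m : LinearForm) : Differentiable ℂ m :=
  m.toContinuousLinearMap.differentiable

lemma contDiff_equation : ContDiff ℂ ω (equation l) := by
  have h : ∀ m : LinearForm, ContDiff ℂ ω (fun p : (Fin 3 → ℂ) × ℂ => m p.1) :=
    fun m => m.toContinuousLinearMap.contDiff.comp contDiff_fst
  unfold equation
  exact (contDiff_snd.pow 2).sub (contDiff_prod fun i _ => h (l i))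

lemma differentiable_equation : Differentiable ℂ (equation l) :=
  contDiff_equation.differentiable (by simp)

/-- Obtained by differentiating the weighted homogeneity. It makes the Jacobian criterion
independent of the representative on the cone. -/
lemma fderiv_equation_act {t : ℂ} (ht : t ≠ 0) (p : (Fin 3 → ℂ) × ℂ) :
    fderiv ℂ (equation l) (act t p) = 0 ↔ fderiv ℂ (equation l) p = 0 := by
  have h1 : (fderiv ℂ (equation l) (act t p)).comp (act t) = t ^ 6 • fderiv ℂ (equation l) p := by
    have h2 : HasFDerivAt (equation l ∘ act t) ((fderiv ℂ (equation l) (act t p)).comp (act t)) p :=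
      (differentiable_equation _).hasFDerivAt.comp p (act t).hasFDerivAt
    have h3 : equation l ∘ act t = fun p => t ^ 6 * equation l p := funext (equation_act t)
    rw [h3] at h2
    exact h2.unique ((differentiable_equation p).hasFDerivAt.const_mul _)
  constructor
  · intro h
    rw [h, ContinuousLinearMap.zero_comp] at h1
    exact (smul_eq_zero.1 h1.symm).resolve_left (pow_ne_zero _ ht)
  · intro h
    rw [h] at h1
    refine ContinuousLinearMap.ext fun v => ?_
    have h2 : act t (act t⁻¹ v) = v := by
      rw [act_apply, act_apply]
      refine Prod.ext ?_ ?_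
      · simp [smul_smul, mul_inv_cancel₀ ht]
      · simp only
        field_simp
    rw [← h2]
    have h3 := congrArg (fun f : (Fin 3 → ℂ) × ℂ →L[ℂ] ℂ => f (act t⁻¹ v)) h1
    simpa using h3

lemma mk_mem_regularLocus {p : Cone l} :
    DoubleCover.mk p ∈ regularLocus l ↔ fderiv ℂ (equation l) p.1 ≠ 0 := by
  constructor
  · rintro ⟨q, hq, h⟩
    obtain ⟨t, ht, h1⟩ := mk_eq_mk.1 hq.symm
    rwa [h1, ne_eq, fderiv_equation_act ht] at h
  · exact fun h => ⟨p, rfl, h⟩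

lemma isOpen_regularLocus : IsOpen (regularLocus l) := by
  have h : regularLocus l =
      DoubleCover.mk '' {p : Cone l | fderiv ℂ (equation l) p.1 ≠ 0} := by
    ext P
    constructor
    · rintro ⟨p, h, h'⟩; exact ⟨p, h', h⟩
    · rintro ⟨p, h', h⟩; exact ⟨p, h, h'⟩
  rw [h]
  refine isOpenMap_mk _ ?_
  have hc : Continuous (fderiv ℂ (equation l)) := contDiff_equation.continuous_fderiv (by simp)
  exact isOpen_ne.preimage (hc.comp continuous_coneVal)

lemma hasFDerivAt_equation (p : (Fin 3 → ℂ) × ℂ) :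
    HasFDerivAt (equation l)
      ((2 * p.2) • ContinuousLinearMap.snd ℂ (Fin 3 → ℂ) ℂ -
        ∑ i, (∏ j ∈ Finset.univ.erase i, l j p.1) •
          (l i).toContinuousLinearMap.comp (ContinuousLinearMap.fst ℂ (Fin 3 → ℂ) ℂ)) p := by
  have h1 : HasFDerivAt (fun p : (Fin 3 → ℂ) × ℂ => p.2 ^ 2)
      ((2 * p.2) • ContinuousLinearMap.snd ℂ (Fin 3 → ℂ) ℂ) p := by
    have := (hasFDerivAt_snd (𝕜 := ℂ) (p := p)).pow 2
    refine this.congr_fderiv ?_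
    refine ContinuousLinearMap.ext fun v => ?_
    simp
  refine h1.sub ?_
  exact HasFDerivAt.finsetProd (u := Finset.univ) (g := fun i (p : (Fin 3 → ℂ) × ℂ) => l i p.1)
    fun i _ => ((l i).toContinuousLinearMap.hasFDerivAt.comp p hasFDerivAt_fst)

lemma fderiv_equation_apply (p q : (Fin 3 → ℂ) × ℂ) :
    fderiv ℂ (equation l) p q =
      2 * p.2 * q.2 - ∑ i, (∏ j ∈ Finset.univ.erase i, l j p.1) * l i q.1 := by
  rw [(hasFDerivAt_equation p).fderiv]
  simp

lemma mem_regularLocus_of_snd_ne_zero {p : Cone l} (h : p.1.2 ≠ 0) :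
    DoubleCover.mk p ∈ regularLocus l := by
  rw [mk_mem_regularLocus]
  intro h0
  have := fderiv_equation_apply (l := l) p.1 (0, 1)
  rw [h0] at this
  simp at this
  exact h this

/-- At a singular point of the double cover, two of the linear forms vanish. -/
lemma exists_of_notMem_regularLocus (hl : NoThreeConcurrent l) {p : Cone l}
    (h : DoubleCover.mk p ∉ regularLocus l) :
    p.1.2 = 0 ∧ ∃ i j : Fin 6, i ≠ j ∧ l i p.1.1 = 0 ∧ l j p.1.1 = 0 := by
  have hw : p.1.2 = 0 := by
    by_contra hw
    exact h (mem_regularLocus_of_snd_ne_zero hw)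
  refine ⟨hw, ?_⟩
  rw [mk_mem_regularLocus, not_not] at h
  have heq := p.2.2
  rw [equation, hw, zero_pow two_ne_zero, zero_sub, neg_eq_zero, Finset.prod_eq_zero_iff] at heq
  obtain ⟨i, -, hi⟩ := heq
  by_contra! hne
  -- Any two further forms have a common nonzero zero on `ℂ³`. If `l i` were the zero form, three of
  -- the lines would pass through it.
  have hli : ∃ v, l i v ≠ 0 := by
    by_contra! h0
    obtain ⟨j, k, hij, hik, hjk⟩ : ∃ j k : Fin 6, i ≠ j ∧ i ≠ k ∧ j ≠ k := by
      clear hi hne h0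
      revert i; decide
    have hker : 0 < Module.finrank ℂ (LinearMap.ker ((l j).prod (l k))) := by
      have h1 := LinearMap.finrank_range_add_finrank_ker ((l j).prod (l k))
      have h2 := Submodule.finrank_le (LinearMap.range ((l j).prod (l k)))
      simp only [Module.finrank_prod, Module.finrank_self, Module.finrank_fin_fun] at h1 h2
      omega
    obtain ⟨⟨v, hv⟩, hv0⟩ := (Module.finrank_pos_iff_exists_ne_zero (R := ℂ)).1 hker
    rw [LinearMap.mem_ker] at hv
    exact hv0 (Subtype.ext (hl i j k hij hik hjk v (h0 v) (congrArg Prod.fst hv)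
      (congrArg Prod.snd hv)))
  obtain ⟨v, hv⟩ := hli
  -- Every summand but the `i`-th contains the factor `l i p = 0`, so the product of the other forms
  -- at `p` must vanish.
  have h2 := fderiv_equation_apply (l := l) p.1 (v, 0)
  rw [h, Finset.sum_eq_single i] at h2
  · simp only [zero_apply, mul_zero, zero_sub, zero_eq_neg, mul_eq_zero] at h2
    rcases h2 with h2 | h2
    · rw [Finset.prod_eq_zero_iff] at h2
      obtain ⟨j, hj, hj0⟩ := h2
      exact hne i j (Finset.ne_of_mem_erase hj).symm hi hj0
    · exact hv h2
  · intro j _ hj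
    rw [Finset.prod_eq_zero (i := i) _ hi, zero_mul]
    simp [hj.symm]
  · simp

/-- Each term of the derivative of the product omits only one factor, so one of the two vanishing
factors survives. -/
lemma notMem_regularLocus {p : Cone l} (hw : p.1.2 = 0) {i j : Fin 6} (hij : i ≠ j)
    (hi : l i p.1.1 = 0) (hj : l j p.1.1 = 0) : DoubleCover.mk p ∉ regularLocus l := by
  rw [mk_mem_regularLocus, not_not]
  refine ContinuousLinearMap.ext fun q => ?_
  rw [fderiv_equation_apply, hw, Finset.sum_eq_zero]
  · simp
  · intro k _
    by_cases hk : k = i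
    · subst hk
      rw [Finset.prod_eq_zero (i := j) _ hj, zero_mul]
      simp [hij.symm]
    · rw [Finset.prod_eq_zero (i := i) _ hi, zero_mul]
      simp [Ne.symm hk]

end CoverTopology

/-! ## Holomorphic maps to the double cover -/

section HolAt

open Set Filter

variable {l : Fin 6 → LinearForm}
variable {M : Type*} [TopologicalSpace M] [ChartedSpace E2 M]
variable {M' : Type*} [TopologicalSpace M'] [ChartedSpace E2 M']

/-- A map to the double cover can be written as `(x : y : z ; w)` near a point, for functions
that are complex differentiable at the point. -/
def HolAt (P : M → DoubleCover l) (y : M) : Prop :=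
  ∃ F : M → (Fin 3 → ℂ) × ℂ, MDifferentiableAt 𝓘(ℂ, E2) 𝓘(ℂ, (Fin 3 → ℂ) × ℂ) F y ∧
    ∀ᶠ y' in 𝓝 y, ∃ h : (F y').1 ≠ 0 ∧ equation l (F y') = 0, P y' = DoubleCover.mk (Cone.mk (F y') h)

lemma IsHolomorphicToCover.holAt {X : Type} [TopologicalSpace X] [ChartedSpace E2 X]
    {π : X → DoubleCover l} (hπ : IsHolomorphicToCover π) (q : X) : HolAt π q := by
  obtain ⟨U, hU, hq, F, hF, h⟩ := hπ q
  exact ⟨F, hF.mdifferentiableAt (hU.mem_nhds hq), eventually_of_mem (hU.mem_nhds hq) h⟩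

lemma HolAt.comp {P : M → DoubleCover l} {f : M' → M} {y : M'} (hP : HolAt P (f y))
    (hf : MDifferentiableAt 𝓘(ℂ, E2) 𝓘(ℂ, E2) f y) : HolAt (P ∘ f) y := by
  obtain ⟨F, hF, h⟩ := hP
  exact ⟨F ∘ f, hF.comp y hf, hf.continuousAt.tendsto.eventually h⟩

/-- Holomorphy of a composite is tested on a local lift to the cone, where `f` is given by the
function `g` of the homogeneous coordinates. -/
lemma HolAt.mdifferentiableAt_comp {P : M → DoubleCover l} {y : M} {f : DoubleCover l → ℂ}
    {g : (Fin 3 → ℂ) × ℂ → ℂ} (hP : HolAt P y) (hfg : ∀ p : Cone l, f (DoubleCover.mk p) = g p.1)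
    (hg : ∀ p : Cone l, DoubleCover.mk p = P y → DifferentiableAt ℂ g p.1) :
    MDifferentiableAt 𝓘(ℂ, E2) 𝓘(ℂ, ℂ) (f ∘ P) y := by
  obtain ⟨F, hF, h⟩ := hP
  obtain ⟨h0, h1⟩ := h.self_of_nhds
  have h2 : MDifferentiableAt 𝓘(ℂ, E2) 𝓘(ℂ, ℂ) (g ∘ F) y :=
    (hg _ h1.symm).mdifferentiableAt.comp y hF
  refine h2.congr_of_eventuallyEq ?_
  filter_upwards [h] with z ⟨hz, hz'⟩
  simp only [Function.comp_apply, hz']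
  exact hfg (Cone.mk (F z) hz)

lemma HolAt.linearRatio {P : M → DoubleCover l} {y : M} (hP : HolAt P y) (a : LinearForm)
    {b : LinearForm} (hb : P y ∈ nonvanishing l b) :
    MDifferentiableAt 𝓘(ℂ, E2) 𝓘(ℂ, ℂ) (linearRatio a b ∘ P) y := by
  refine hP.mdifferentiableAt_comp (g := fun p => a p.1 / b p.1) (fun p => rfl) fun p hp => ?_
  have h : b p.1.1 ≠ 0 := by rwa [← hp, mk_mem_nonvanishing] at hb
  have h1 : ∀ m : LinearForm, DifferentiableAt ℂ (fun p : (Fin 3 → ℂ) × ℂ => m p.1) p.1 :=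
    fun m => (differentiable_linearForm m).differentiableAt.comp _ differentiableAt_fst
  simpa only [div_eq_mul_inv] using (h1 a).fun_mul ((h1 b).fun_inv h)

lemma HolAt.cubicRatio {P : M → DoubleCover l} {y : M} (hP : HolAt P y)
    {b : LinearForm} (hb : P y ∈ nonvanishing l b) :
    MDifferentiableAt 𝓘(ℂ, E2) 𝓘(ℂ, ℂ) (cubicRatio b ∘ P) y := by
  refine hP.mdifferentiableAt_comp (g := fun p => p.2 / b p.1 ^ 3) (fun p => rfl) fun p hp => ?_
  have h : b p.1.1 ≠ 0 := by rwa [← hp, mk_mem_nonvanishing] at hb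
  have h1 : DifferentiableAt ℂ (fun p : (Fin 3 → ℂ) × ℂ => b p.1) p.1 :=
    (differentiable_linearForm b).differentiableAt.comp _ differentiableAt_fst
  simpa only [div_eq_mul_inv] using
    differentiableAt_snd.fun_mul ((h1.fun_pow 3).fun_inv (pow_ne_zero 3 h))

lemma HolAt.continuousAt {P : M → DoubleCover l} {y : M} (hP : HolAt P y) : ContinuousAt P y := by
  obtain ⟨F, hF, h⟩ := hP
  obtain ⟨h0, h1⟩ := h.self_of_nhds
  rw [ContinuousAt, h1]
  refine fun V hV => mem_map.2 ?_
  have hV' : DoubleCover.mk ⁻¹' V ∈ 𝓝 (Cone.mk (F y) h0) :=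
    continuous_mk.continuousAt.preimage_mem_nhds hV
  have hV'' : ∃ O ∈ 𝓝 (F y), Subtype.val ⁻¹' O ⊆ DoubleCover.mk (l := l) ⁻¹' V :=
    mem_nhds_subtype _ _ _ |>.1 hV'
  obtain ⟨O, hO, hOV⟩ := hV''
  filter_upwards [h, hF.continuousAt.preimage_mem_nhds hO] with z ⟨hz, hz'⟩ hzO
  rw [mem_preimage, hz']
  exact @hOV (Cone.mk (F z) hz) hzO

lemma IsHolomorphicFromCoverOn.mdifferentiableAt_comp {X : Type} [TopologicalSpace X]
    [ChartedSpace E2 X] {s : DoubleCover l → X} {R : Set (DoubleCover l)}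
    (hs : IsHolomorphicFromCoverOn s R) {P : M → DoubleCover l} {y : M} (hP : HolAt P y)
    (hy : P y ∈ R) : MDifferentiableAt 𝓘(ℂ, E2) 𝓘(ℂ, E2) (s ∘ P) y := by
  obtain ⟨F, hF, h⟩ := hP
  obtain ⟨h0, h1⟩ := h.self_of_nhds
  obtain ⟨U, hU, hpU, G, hG, hsG⟩ := hs (Cone.mk (F y) h0) (by rwa [← h1])
  have h2 : MDifferentiableAt 𝓘(ℂ, E2) 𝓘(ℂ, E2) (G ∘ F) y :=
    (hG.mdifferentiableAt (hU.mem_nhds hpU)).comp y hF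
  refine h2.congr_of_eventuallyEq ?_
  filter_upwards [h, hF.continuousAt.preimage_mem_nhds (hU.mem_nhds hpU)] with z ⟨hz, hz'⟩ hzU
  simp only [Function.comp_apply, hz', hsG (Cone.mk (F z) hz) hzU, Cone.mk_val]

end HolAt

/-! ## The nodes of the double cover -/

section Nodes

open Set Filter

variable {l : Fin 6 → LinearForm} {N : DoubleCover l}

/-- Local coordinates at a node `N` of the double cover: a basis of the space whose dual basis
consists of the two linear forms vanishing at the node and a third one, such that the product of the
six linear forms is the product of the first two coordinates and a square of a holomorphic
function. -/
structure Node (l : Fin 6 → LinearForm) (N : DoubleCover l) where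
  (i j : Fin 6)
  (e₁ e₂ n : Fin 3 → ℂ)
  (m : LinearForm)
  (ε : ℝ)
  (h : ℂ × ℂ → ℂ)
  ne : i ≠ j
  decomp : ∀ v, v = l i v • e₁ + l j v • e₂ + m v • n
  dual₁ : l i e₁ = 1 ∧ l j e₁ = 0 ∧ m e₁ = 0
  dual₂ : l i e₂ = 0 ∧ l j e₂ = 1 ∧ m e₂ = 0
  dual₃ : l i n = 0 ∧ l j n = 0 ∧ m n = 1
  ε_pos : 0 < ε
  differentiableAt_h : ∀ a b : ℂ, ‖a‖ < ε → ‖b‖ < ε → DifferentiableAt ℂ h (a, b)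
  h_ne_zero : ∀ a b : ℂ, h (a, b) ≠ 0
  prod_eq : ∀ a b : ℂ, ‖a‖ < ε → ‖b‖ < ε →
    ∏ k, l k (a • e₁ + b • e₂ + n) = a * b * h (a, b) ^ 2
  other_ne_zero : ∀ a b : ℂ, ‖a‖ < ε → ‖b‖ < ε → ∀ k, k ≠ i → k ≠ j →
    l k (a • e₁ + b • e₂ + n) ≠ 0
  mem_cone : n ≠ 0 ∧ equation l (n, 0) = 0
  mk_eq : DoubleCover.mk (Cone.mk (n, 0) mem_cone) = N

lemma exists_dual_basis (hl : NoThreeConcurrent l) {i j k : Fin 6} (hij : i ≠ j) (hik : i ≠ k)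
    (hjk : j ≠ k) : ∃ e₁ e₂ e₃ : Fin 3 → ℂ,
      (∀ v, v = l i v • e₁ + l j v • e₂ + l k v • e₃) ∧ (l i e₁ = 1 ∧ l j e₁ = 0 ∧ l k e₁ = 0) ∧
      (l i e₂ = 0 ∧ l j e₂ = 1 ∧ l k e₂ = 0) ∧ (l i e₃ = 0 ∧ l j e₃ = 0 ∧ l k e₃ = 1) := by
  let T : (Fin 3 → ℂ) →ₗ[ℂ] (Fin 3 → ℂ) := LinearMap.pi ![l i, l j, l k]
  have hT : Function.Injective T := by
    rw [injective_iff_map_eq_zero]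
    intro v hv
    exact hl i j k hij hik hjk v (congrFun hv 0) (congrFun hv 1) (congrFun hv 2)
  have hT' : Function.Surjective T := LinearMap.injective_iff_surjective.1 hT
  obtain ⟨e₁, h₁⟩ := hT' ![1, 0, 0]
  obtain ⟨e₂, h₂⟩ := hT' ![0, 1, 0]
  obtain ⟨e₃, h₃⟩ := hT' ![0, 0, 1]
  have d₁ : l i e₁ = 1 ∧ l j e₁ = 0 ∧ l k e₁ = 0 := ⟨congrFun h₁ 0, congrFun h₁ 1, congrFun h₁ 2⟩
  have d₂ : l i e₂ = 0 ∧ l j e₂ = 1 ∧ l k e₂ = 0 := ⟨congrFun h₂ 0, congrFun h₂ 1, congrFun h₂ 2⟩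
  have d₃ : l i e₃ = 0 ∧ l j e₃ = 0 ∧ l k e₃ = 1 := ⟨congrFun h₃ 0, congrFun h₃ 1, congrFun h₃ 2⟩
  refine ⟨e₁, e₂, e₃, fun v => ?_, d₁, d₂, d₃⟩
  rw [← sub_eq_zero]
  refine hl i j k hij hik hjk _ ?_ ?_ ?_ <;> simp [d₁, d₂, d₃]

set_option maxHeartbeats 1000000 in
/-- Every singular point of the double cover has local coordinates. -/
theorem exists_node (hl : NoThreeConcurrent l) (hN : N ∉ regularLocus l) : Nonempty (Node l N) := by
  obtain ⟨p, rfl⟩ := mk_surjective N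
  obtain ⟨hw, i, j, hij, hi, hj⟩ := exists_of_notMem_regularLocus hl hN
  obtain ⟨k, hik, hjk⟩ : ∃ k : Fin 6, i ≠ k ∧ j ≠ k := by
    clear hi hj hij
    revert i j; decide
  obtain ⟨e₁, e₂, n, hdec, d₁, d₂, d₃⟩ := exists_dual_basis hl hij hik hjk
  have hp : p.1.1 = l k p.1.1 • n := by
    have := hdec p.1.1
    rwa [hi, hj, zero_smul, zero_smul, zero_add, zero_add] at this
  have hk : l k p.1.1 ≠ 0 := by
    intro h
    rw [h, zero_smul] at hp
    exact p.2.1 hp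
  have hn : n ≠ 0 := by
    rintro rfl
    simpa using d₃.2.2
  have hcone : n ≠ 0 ∧ equation l (n, 0) = 0 := by
    refine ⟨hn, ?_⟩
    rw [equation, Finset.prod_eq_zero (Finset.mem_univ i) d₃.1]
    simp
  -- The product of the four forms that do not vanish at the node. Dividing `w` by a square root of
  -- it leaves the equation `c² = ab`.
  let g : ℂ × ℂ → ℂ := fun q => ∏ r ∈ (Finset.univ.erase i).erase j,
    l r (q.1 • e₁ + q.2 • e₂ + n)
  have hgd : Differentiable ℂ g := by
    have h1 : ∀ r, ContDiff ℂ 1 fun q : ℂ × ℂ => l r (q.1 • e₁ + q.2 • e₂ + n) := fun r =>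
      (l r).toContinuousLinearMap.contDiff.comp
        (((contDiff_fst.smul contDiff_const).add (contDiff_snd.smul contDiff_const)).add
          contDiff_const)
    exact (contDiff_prod fun r _ => h1 r).differentiable one_ne_zero
  have hg0 : g 0 ≠ 0 := by
    rw [Finset.prod_ne_zero_iff]
    intro r hr h0
    simp only [Finset.mem_erase, Finset.mem_univ, and_true] at hr
    simp only [Prod.fst_zero, Prod.snd_zero, zero_smul, zero_add] at h0
    exact hn (hl i j r hij hr.2.symm hr.1.symm n d₃.1 d₃.2.1 h0)
  obtain ⟨c, hc⟩ := IsAlgClosed.exists_pow_nat_eq (g 0) (n := 2) (by norm_num)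
  have hc0 : c ≠ 0 := by rintro rfl; rw [zero_pow two_ne_zero] at hc; exact hg0 hc.symm
  have hslit : (fun q => g q / g 0) ⁻¹' Complex.slitPlane ∈ 𝓝 (0 : ℂ × ℂ) := by
    refine (hgd.continuous.div_const (g 0)).continuousAt.preimage_mem_nhds ?_
    rw [div_self hg0]
    exact Complex.isOpen_slitPlane.mem_nhds Complex.one_mem_slitPlane
  obtain ⟨ε, hε, hεs⟩ := Metric.mem_nhds_iff.1 hslit
  have hmem : ∀ a b : ℂ, ‖a‖ < ε → ‖b‖ < ε → g (a, b) / g 0 ∈ Complex.slitPlane := by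
    intro a b ha hb
    refine @hεs (a, b) ?_
    rw [mem_ball_zero_iff, Prod.norm_mk, max_lt_iff]
    exact ⟨ha, hb⟩
  have hgne : ∀ a b : ℂ, ‖a‖ < ε → ‖b‖ < ε → g (a, b) ≠ 0 := by
    intro a b ha hb h0
    have := Complex.slitPlane_ne_zero (hmem a b ha hb)
    rw [h0, zero_div] at this
    exact this rfl
  refine ⟨{
    i := i, j := j, e₁ := e₁, e₂ := e₂, n := n, m := l k, ε := ε
    -- A branch of the square root of `g`, holomorphic where `g / g 0` stays in the slit plane.
    -- Written as an exponential it has no zeros anywhere, even where the logarithm is not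
    -- holomorphic.
    h := fun q => c * Complex.exp (Complex.log (g q / g 0) / 2)
    ne := hij
    decomp := hdec
    dual₁ := d₁
    dual₂ := d₂
    dual₃ := d₃
    ε_pos := hε
    differentiableAt_h := fun a b ha hb => by
      have h1 : DifferentiableAt ℂ (fun q => g q / g 0) (a, b) := by
        simpa only [div_eq_mul_inv] using (hgd (a, b)).mul_const (g 0)⁻¹
      have h2 : DifferentiableAt ℂ (fun q => Complex.log (g q / g 0) / 2) (a, b) := by
        simpa only [div_eq_mul_inv] using (h1.clog (hmem a b ha hb)).mul_const (2 : ℂ)⁻¹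
      exact h2.cexp.const_mul c
    h_ne_zero := fun a b => mul_ne_zero hc0 (Complex.exp_ne_zero _)
    prod_eq := ?_
    other_ne_zero := ?_
    mem_cone := hcone
    mk_eq := ?_ }⟩
  · intro a b ha hb
    have h1 : Complex.exp (Complex.log (g (a, b) / g 0) / 2) ^ 2 = g (a, b) / g 0 := by
      rw [← Complex.exp_nat_mul, Nat.cast_ofNat, mul_div_cancel₀ _ two_ne_zero, Complex.exp_log]
      exact div_ne_zero (hgne a b ha hb) hg0
    rw [mul_pow, h1, hc, mul_div_cancel₀ _ hg0, ← Finset.mul_prod_erase _ _ (Finset.mem_univ i),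
      ← Finset.mul_prod_erase _ _ (Finset.mem_erase.2 ⟨hij.symm, Finset.mem_univ j⟩), ← mul_assoc]
    congr 2
    · simp [d₁, d₂, d₃]
    · simp [d₁, d₂, d₃]
  · intro a b ha hb r hri hrj h0
    refine hgne a b ha hb (Finset.prod_eq_zero (i := r) ?_ h0)
    simp [hri, hrj]
  · rw [mk_eq_mk]
    exact ⟨l k p.1.1, hk, Prod.ext hp (by simp [hw])⟩

namespace Node

/-- The exchange of the two linear forms that vanish at the node. -/
def swap (d : Node l N) : Node l N where
  i := d.j
  j := d.i
  e₁ := d.e₂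
  e₂ := d.e₁
  n := d.n
  m := d.m
  ε := d.ε
  h := fun q => d.h (q.2, q.1)
  ne := d.ne.symm
  decomp v := by rw [add_comm (l d.j v • d.e₂)]; exact d.decomp v
  dual₁ := ⟨d.dual₂.2.1, d.dual₂.1, d.dual₂.2.2⟩
  dual₂ := ⟨d.dual₁.2.1, d.dual₁.1, d.dual₁.2.2⟩
  dual₃ := ⟨d.dual₃.2.1, d.dual₃.1, d.dual₃.2.2⟩
  ε_pos := d.ε_pos
  differentiableAt_h a b ha hb :=
    DifferentiableAt.fun_comp' (f := fun q : ℂ × ℂ => (q.2, q.1)) (a, b) (d.differentiableAt_h b a hb ha)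
      (differentiableAt_snd.prodMk differentiableAt_fst)
  h_ne_zero a b := d.h_ne_zero b a
  prod_eq a b ha hb := by
    rw [add_comm (a • d.e₂), d.prod_eq b a hb ha, mul_comm b a]
  other_ne_zero a b ha hb k hk hk' := by
    rw [add_comm (a • d.e₂)]; exact d.other_ne_zero b a hb ha k hk' hk
  mem_cone := d.mem_cone
  mk_eq := d.mk_eq

variable (d : Node l N)

/-- The vector with the given affine coordinates. -/
def vec (a b : ℂ) : Fin 3 → ℂ := a • d.e₁ + b • d.e₂ + d.n

lemma swap_vec (a b : ℂ) : d.swap.vec a b = d.vec b a := by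
  simp only [vec, swap, add_comm (a • d.e₂)]

@[simp] lemma i_vec (a b : ℂ) : l d.i (d.vec a b) = a := by
  simp [vec, d.dual₁, d.dual₂, d.dual₃]

@[simp] lemma j_vec (a b : ℂ) : l d.j (d.vec a b) = b := by
  simp [vec, d.dual₁, d.dual₂, d.dual₃]

@[simp] lemma m_vec (a b : ℂ) : d.m (d.vec a b) = 1 := by
  simp [vec, d.dual₁, d.dual₂, d.dual₃]

lemma vec_ne_zero (a b : ℂ) : d.vec a b ≠ 0 := by
  intro h
  have := d.m_vec a b
  rw [h, map_zero] at this
  exact zero_ne_one this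

lemma vec_mem_cone {a b c : ℂ} (ha : ‖a‖ < d.ε) (hb : ‖b‖ < d.ε) (hc : c ^ 2 = a * b) :
    (d.vec a b, d.h (a, b) * c).1 ≠ 0 ∧ equation l (d.vec a b, d.h (a, b) * c) = 0 := by
  refine ⟨d.vec_ne_zero a b, ?_⟩
  rw [equation, vec, d.prod_eq a b ha hb, mul_pow, hc]
  ring

/-- The neighbourhood of the node where the first two coordinates are small. -/
def nhd (δ : ℝ) : Set (DoubleCover l) :=
  {P | ∃ p : Cone l, DoubleCover.mk p = P ∧
    ‖l d.i p.1.1‖ < δ * ‖d.m p.1.1‖ ∧ ‖l d.j p.1.1‖ < δ * ‖d.m p.1.1‖}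

lemma mk_mem_nhd {δ : ℝ} {p : Cone l} : DoubleCover.mk p ∈ d.nhd δ ↔
    ‖l d.i p.1.1‖ < δ * ‖d.m p.1.1‖ ∧ ‖l d.j p.1.1‖ < δ * ‖d.m p.1.1‖ := by
  constructor
  · rintro ⟨q, hq, h⟩
    obtain ⟨t, ht, h1⟩ := mk_eq_mk.1 hq.symm
    simp only [h1, act_apply, map_smul, smul_eq_mul, norm_mul] at h
    have ht' : 0 < ‖t‖ := norm_pos_iff.2 ht
    rw [mul_left_comm, mul_lt_mul_iff_right₀ ht', mul_lt_mul_iff_right₀ ht'] at h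
    exact h
  · exact fun h => ⟨p, rfl, h⟩

lemma swap_nhd (δ : ℝ) : d.swap.nhd δ = d.nhd δ := by
  ext P
  obtain ⟨p, rfl⟩ := mk_surjective P
  rw [mk_mem_nhd, mk_mem_nhd]
  exact and_comm

lemma isOpen_nhd (δ : ℝ) : IsOpen (d.nhd δ) := by
  have h : d.nhd δ = DoubleCover.mk '' {p : Cone l |
      ‖l d.i p.1.1‖ < δ * ‖d.m p.1.1‖ ∧ ‖l d.j p.1.1‖ < δ * ‖d.m p.1.1‖} := by
    ext P
    constructor
    · rintro ⟨p, h, h'⟩; exact ⟨p, h', h⟩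
    · rintro ⟨p, h', h⟩; exact ⟨p, h, h'⟩
  rw [h]
  refine isOpenMap_mk _ ?_
  have hc : ∀ m : LinearForm, Continuous fun p : Cone l => ‖m p.1.1‖ := fun m =>
    ((continuous_linearForm m).comp (continuous_fst.comp continuous_coneVal)).norm
  exact (isOpen_lt (hc _) (continuous_const.mul (hc _))).inter
    (isOpen_lt (hc _) (continuous_const.mul (hc _)))

lemma node_mem_nhd {δ : ℝ} (hδ : 0 < δ) : N ∈ d.nhd δ := by
  have h : DoubleCover.mk (Cone.mk (d.n, 0) d.mem_cone) ∈ d.nhd δ := by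
    rw [mk_mem_nhd]
    simpa [d.dual₃] using hδ
  rwa [d.mk_eq] at h

lemma nhd_subset_nonvanishing {δ : ℝ} : d.nhd δ ⊆ nonvanishing l d.m := by
  intro P hP
  obtain ⟨p, rfl⟩ := mk_surjective P
  rw [mk_mem_nhd] at hP
  rw [mk_mem_nonvanishing]
  intro h
  rw [h, norm_zero, mul_zero] at hP
  exact absurd hP.1 (norm_nonneg _).not_gt

/-- Only the component along `n` remains, and the equation forces `w = 0`. -/
lemma eq_node {p : Cone l} (hi : l d.i p.1.1 = 0) (hj : l d.j p.1.1 = 0) :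
    DoubleCover.mk p = N := by
  rw [← d.mk_eq, eq_comm, mk_eq_mk]
  have h1 : p.1.1 = d.m p.1.1 • d.n := by
    have := d.decomp p.1.1
    rwa [hi, hj, zero_smul, zero_smul, zero_add, zero_add] at this
  have h2 : p.1.2 = 0 := by
    have := p.2.2
    rw [equation, Finset.prod_eq_zero (Finset.mem_univ d.i) hi, sub_zero] at this
    exact pow_eq_zero_iff two_ne_zero |>.1 this
  refine ⟨d.m p.1.1, fun h => p.2.1 ?_, Prod.ext h1 (by simp [h2])⟩
  rw [h1, h, zero_smul]

/-- The node and any other point have disjoint open neighbourhoods. -/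
lemma exists_separation {P : DoubleCover l} (hP : P ≠ N) : ∃ δ : ℝ, 0 < δ ∧ δ ≤ d.ε ∧
    ∃ V : Set (DoubleCover l), IsOpen V ∧ P ∈ V ∧ Disjoint V (d.nhd δ) := by
  obtain ⟨p, rfl⟩ := mk_surjective P
  have h1 : 0 < max ‖l d.i p.1.1‖ ‖l d.j p.1.1‖ := by
    by_contra! h
    rw [max_le_iff, norm_le_zero_iff, norm_le_zero_iff] at h
    exact hP (d.eq_node h.1 h.2)
  -- The denominator `‖m‖ + 1` also covers points at infinity for the affine chart, where `m`
  -- vanishes.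
  obtain ⟨δ, hδ, hδ'⟩ : ∃ δ : ℝ, 0 < δ ∧ δ * ‖d.m p.1.1‖ < max ‖l d.i p.1.1‖ ‖l d.j p.1.1‖ := by
    refine ⟨max ‖l d.i p.1.1‖ ‖l d.j p.1.1‖ / (‖d.m p.1.1‖ + 1), by positivity, ?_⟩
    rw [div_mul_eq_mul_div, div_lt_iff₀ (by positivity)]
    nlinarith
  refine ⟨min δ d.ε, lt_min hδ d.ε_pos, min_le_right _ _, DoubleCover.mk '' {q : Cone l |
    δ * ‖d.m q.1.1‖ < max ‖l d.i q.1.1‖ ‖l d.j q.1.1‖}, ?_, ⟨p, hδ', rfl⟩, ?_⟩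
  · refine isOpenMap_mk _ ?_
    have hc : ∀ m : LinearForm, Continuous fun p : Cone l => ‖m p.1.1‖ := fun m =>
      ((continuous_linearForm m).comp (continuous_fst.comp continuous_coneVal)).norm
    exact isOpen_lt (continuous_const.mul (hc _)) ((hc _).max (hc _))
  · rw [Set.disjoint_left]
    rintro _ ⟨q, hq, rfl⟩ hq'
    rw [mk_mem_nhd] at hq'
    have h2 : min δ d.ε * ‖d.m q.1.1‖ ≤ δ * ‖d.m q.1.1‖ :=
      mul_le_mul_of_nonneg_right (min_le_left _ _) (norm_nonneg _)
    exact lt_asymm hq (max_lt (hq'.1.trans_le h2) (hq'.2.trans_le h2))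

lemma node_notMem_regularLocus (d : Node l N) : N ∉ regularLocus l := by
  rw [← d.mk_eq]
  exact notMem_regularLocus rfl d.ne d.dual₃.1 d.dual₃.2.1

/-- The first coordinate. -/
def A : DoubleCover l → ℂ := linearRatio (l d.i) d.m

/-- The second coordinate. -/
def B : DoubleCover l → ℂ := linearRatio (l d.j) d.m

/-- The third coordinate, whose square is the product of the first two. -/
def C (P : DoubleCover l) : ℂ := cubicRatio d.m P / d.h (d.A P, d.B P)

@[simp] lemma A_mk_vec {a b w : ℂ} (h) : d.A (DoubleCover.mk (Cone.mk (d.vec a b, w) h)) = a := by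
  simp [A]

@[simp] lemma B_mk_vec {a b w : ℂ} (h) : d.B (DoubleCover.mk (Cone.mk (d.vec a b, w) h)) = b := by
  simp [B]

@[simp] lemma C_mk_vec {a b c : ℂ} (h) :
    d.C (DoubleCover.mk (Cone.mk (d.vec a b, d.h (a, b) * c) h)) = c := by
  simp [C, mul_div_cancel_left₀ _ (d.h_ne_zero a b)]

lemma mk_vec_mem_nhd {δ : ℝ} {a b w : ℂ} (h) : DoubleCover.mk (Cone.mk (d.vec a b, w) h) ∈ d.nhd δ ↔
    ‖a‖ < δ ∧ ‖b‖ < δ := by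
  rw [mk_mem_nhd]
  simp

/-- Every point of the neighbourhood is determined by its coordinates. -/
lemma exists_eq_mk_vec {P : DoubleCover l} (hP : P ∈ d.nhd d.ε) :
    ∃ a b c : ℂ, ‖a‖ < d.ε ∧ ‖b‖ < d.ε ∧ c ^ 2 = a * b ∧
      ∃ h, P = DoubleCover.mk (Cone.mk (d.vec a b, d.h (a, b) * c) h) := by
  have hm := d.nhd_subset_nonvanishing hP
  obtain ⟨p, rfl⟩ := mk_surjective P
  rw [mk_mem_nonvanishing] at hm
  have hv : (d.m p.1.1)⁻¹ • p.1.1 =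
      d.vec (l d.i p.1.1 / d.m p.1.1) (l d.j p.1.1 / d.m p.1.1) := by
    conv_lhs => arg 2; rw [d.decomp p.1.1]
    simp only [smul_add, smul_smul, vec, inv_mul_cancel₀ hm, one_smul, div_eq_inv_mul]
  set a := l d.i p.1.1 / d.m p.1.1
  set b := l d.j p.1.1 / d.m p.1.1
  have hm' : 0 < ‖d.m p.1.1‖ := norm_pos_iff.2 hm
  rw [mk_mem_nhd] at hP
  have ha : ‖a‖ < d.ε := by rw [norm_div, div_lt_iff₀ hm']; exact hP.1
  have hb : ‖b‖ < d.ε := by rw [norm_div, div_lt_iff₀ hm']; exact hP.2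
  have hact : act (d.m p.1.1)⁻¹ p.1 =
      (d.vec a b, d.h (a, b) * ((d.m p.1.1)⁻¹ ^ 3 * p.1.2 / d.h (a, b))) := by
    rw [act_apply, hv, mul_div_cancel₀ _ (d.h_ne_zero a b)]
  have hmem := act_mem (inv_ne_zero hm) p.2
  refine ⟨a, b, (d.m p.1.1)⁻¹ ^ 3 * p.1.2 / d.h (a, b), ha, hb, ?_, hact ▸ hmem, ?_⟩
  · have h1 := hmem.2
    rw [hact, equation, vec, d.prod_eq a b ha hb, mul_pow, sub_eq_zero] at h1
    refine mul_left_cancel₀ (pow_ne_zero 2 (d.h_ne_zero a b)) (h1.trans ?_)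
    ring
  · have h1 : Cone.mk (d.vec a b, d.h (a, b) * ((d.m p.1.1)⁻¹ ^ 3 * p.1.2 / d.h (a, b)))
        (hact ▸ hmem) = Cone.mk (act (d.m p.1.1)⁻¹ p.1) hmem := Subtype.ext hact.symm
    rw [h1]
    exact (mk_act (inv_ne_zero hm) p.2).symm

/-- Two forms vanish at a singular point. Near the node the only candidates are `l i` and `l j`, and
their common zero is the node itself. -/
lemma mem_regularLocus (hl : NoThreeConcurrent l) {P : DoubleCover l} (hP : P ∈ d.nhd d.ε)
    (hPN : P ≠ N) : P ∈ regularLocus l := by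
  obtain ⟨a, b, c, ha, hb, hc, h, rfl⟩ := d.exists_eq_mk_vec hP
  by_contra hreg
  obtain ⟨-, r, t, hrt, hr, ht⟩ := exists_of_notMem_regularLocus hl hreg
  have key : ∀ r, l r (d.vec a b) = 0 → r = d.i ∨ r = d.j := by
    intro r hr
    by_contra! hne
    exact d.other_ne_zero a b ha hb r hne.1 hne.2 hr
  have h' : l d.i (d.vec a b) = 0 ∧ l d.j (d.vec a b) = 0 := by
    rcases key r hr with rfl | rfl <;> rcases key t ht with rfl | rfl
    · exact absurd rfl hrt
    · exact ⟨hr, ht⟩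
    · exact ⟨ht, hr⟩
    · exact absurd rfl hrt
  exact hPN (d.eq_node h'.1 h'.2)

/-- The domain of a chart of the resolution of the node. -/
def dom : Set E2 := {u | ‖u 1‖ < d.ε ∧ ‖u 0 ^ 2 * u 1‖ < d.ε}

lemma isOpen_dom : IsOpen d.dom :=
  (isOpen_lt (continuous_coord 1).norm continuous_const).inter
    (isOpen_lt (((continuous_coord 0).pow 2).mul (continuous_coord 1)).norm continuous_const)

lemma mem_dom_of_one_eq_zero {u : E2} (h : u 1 = 0) : u ∈ d.dom := by
  simp [dom, h, d.ε_pos]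

/-- The resolution of the node, in a chart, in homogeneous coordinates. -/
def F (u : E2) : (Fin 3 → ℂ) × ℂ :=
  (d.vec (u 1) (u 0 ^ 2 * u 1), d.h (u 1, u 0 ^ 2 * u 1) * (u 0 * u 1))

/-- The substitution `a = u 1`, `b = u 0 ^ 2 * u 1`, `c = u 0 * u 1` solves `c² = ab`. The
coordinate `u 0` is the slope `c / a`. -/
lemma F_mem {u : E2} (hu : u ∈ d.dom) : (d.F u).1 ≠ 0 ∧ equation l (d.F u) = 0 :=
  d.vec_mem_cone hu.1 hu.2 (by ring)

lemma differentiableAt_F {u : E2} (hu : u ∈ d.dom) : DifferentiableAt ℂ d.F u := by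
  have h0 := (differentiable_coord 0).differentiableAt (x := u)
  have h1 := (differentiable_coord 1).differentiableAt (x := u)
  have h2 : DifferentiableAt ℂ (fun u : E2 => u 0 ^ 2 * u 1) u := (h0.fun_pow 2).fun_mul h1
  have h3 : DifferentiableAt ℂ (fun u : E2 => d.h (u 1, u 0 ^ 2 * u 1)) u :=
    DifferentiableAt.fun_comp' (f := fun u : E2 => (u 1, u 0 ^ 2 * u 1)) u
      (d.differentiableAt_h _ _ hu.1 hu.2) (h1.prodMk h2)
  refine DifferentiableAt.prodMk ?_ (h3.fun_mul (h0.fun_mul h1))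
  exact ((h1.smul_const _).fun_add (h2.smul_const _)).add_const _

open Classical in
/-- The resolution of the node, in a chart. -/
def proj (u : E2) : DoubleCover l :=
  if h : u ∈ d.dom then DoubleCover.mk (Cone.mk (d.F u) (d.F_mem h)) else N

lemma proj_eq {u : E2} (hu : u ∈ d.dom) : d.proj u = DoubleCover.mk (Cone.mk (d.F u) (d.F_mem hu)) :=
  dif_pos hu

lemma holAt_proj {u : E2} (hu : u ∈ d.dom) : HolAt d.proj u := by
  refine ⟨d.F, (d.differentiableAt_F hu).mdifferentiableAt, ?_⟩
  filter_upwards [d.isOpen_dom.mem_nhds hu] with v hv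
  exact ⟨d.F_mem hv, d.proj_eq hv⟩

lemma A_proj {u : E2} (hu : u ∈ d.dom) : d.A (d.proj u) = u 1 := by
  rw [d.proj_eq hu]; exact d.A_mk_vec _

lemma B_proj {u : E2} (hu : u ∈ d.dom) : d.B (d.proj u) = u 0 ^ 2 * u 1 := by
  rw [d.proj_eq hu]; exact d.B_mk_vec _

lemma C_proj {u : E2} (hu : u ∈ d.dom) : d.C (d.proj u) = u 0 * u 1 := by
  rw [d.proj_eq hu]; exact d.C_mk_vec _

lemma proj_mem_nhd {u : E2} (hu : u ∈ d.dom) {δ : ℝ} :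
    d.proj u ∈ d.nhd δ ↔ ‖u 1‖ < δ ∧ ‖u 0 ^ 2 * u 1‖ < δ := by
  rw [d.proj_eq hu]; exact d.mk_vec_mem_nhd _

lemma proj_mem_nhd_self {u : E2} (hu : u ∈ d.dom) : d.proj u ∈ d.nhd d.ε :=
  (d.proj_mem_nhd hu).2 hu

lemma A_node : d.A N = 0 := by
  have h : d.A (DoubleCover.mk (Cone.mk (d.n, 0) d.mem_cone)) = 0 := by
    rw [A, linearRatio_mk, Cone.mk_val, d.dual₃.1, zero_div]
  rwa [d.mk_eq] at h

lemma proj_eq_node_iff {u : E2} (hu : u ∈ d.dom) : d.proj u = N ↔ u 1 = 0 := by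
  constructor
  · intro h
    rw [← d.A_proj hu, h, d.A_node]
  · intro h
    rw [d.proj_eq hu]
    refine d.eq_node ?_ ?_
    · exact (d.i_vec _ _).trans h
    · exact (d.j_vec _ _).trans (by rw [h, mul_zero])

/-- The chart of the resolution of the node, off the exceptional curve. -/
def coord (P : DoubleCover l) : E2 := mk2 (d.C P / d.A P) (d.A P)

lemma coord_proj {u : E2} (hu : u ∈ d.dom) (h : u 1 ≠ 0) : d.coord (d.proj u) = u := by
  rw [coord, mk2_eq_iff, d.A_proj hu, d.C_proj hu, mul_div_cancel_right₀ _ h]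
  exact ⟨rfl, rfl⟩

lemma sq_C {P : DoubleCover l} (hP : P ∈ d.nhd d.ε) : d.C P ^ 2 = d.A P * d.B P := by
  obtain ⟨a, b, c, ha, hb, hc, h, rfl⟩ := d.exists_eq_mk_vec hP
  rw [A_mk_vec, B_mk_vec, C_mk_vec, hc]

lemma norm_lt {P : DoubleCover l} (hP : P ∈ d.nhd d.ε) {δ : ℝ} :
    P ∈ d.nhd δ ↔ ‖d.A P‖ < δ ∧ ‖d.B P‖ < δ := by
  obtain ⟨a, b, c, ha, hb, hc, h, rfl⟩ := d.exists_eq_mk_vec hP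
  rw [A_mk_vec, B_mk_vec, mk_vec_mem_nhd]

/-- From `c² = ab` and `a ≠ 0` one recovers `b = (c / a)² a`, so slope and first coordinate
determine the point. -/
lemma coord_mem_dom {P : DoubleCover l} (hP : P ∈ d.nhd d.ε) (hA : d.A P ≠ 0) :
    d.coord P ∈ d.dom ∧ d.proj (d.coord P) = P := by
  obtain ⟨a, b, c, ha, hb, hc, h, rfl⟩ := d.exists_eq_mk_vec hP
  rw [A_mk_vec] at hA
  have hB : (c / a) ^ 2 * a = b := by
    rw [div_pow, hc]; field_simp
  have hmem : d.coord (DoubleCover.mk (Cone.mk (d.vec a b, d.h (a, b) * c) h)) ∈ d.dom := by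
    rw [coord, A_mk_vec, C_mk_vec]
    exact ⟨ha, by simpa [hB] using hb⟩
  refine ⟨hmem, ?_⟩
  rw [d.proj_eq hmem]
  congr 1
  refine Subtype.ext ?_
  change d.F _ = _
  simp only [F, coord, A_mk_vec, C_mk_vec, mk2_zero, mk2_one, hB, div_mul_cancel₀ _ hA,
    Cone.mk_val]

lemma eq_node_of_A_B {P : DoubleCover l} (hP : P ∈ d.nhd d.ε) (hA : d.A P = 0) (hB : d.B P = 0) :
    P = N := by
  obtain ⟨a, b, c, ha, hb, hc, h, rfl⟩ := d.exists_eq_mk_vec hP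
  rw [A_mk_vec] at hA
  rw [B_mk_vec] at hB
  exact d.eq_node ((d.i_vec a b).trans hA) ((d.j_vec a b).trans hB)

/-! ### The change of charts -/

/-- The change of charts of the resolution of the node. -/
def flip (u : E2) : E2 := mk2 (u 0)⁻¹ (u 0 ^ 2 * u 1)

lemma flip_one_eq_zero {u : E2} (h : u 0 ≠ 0) : flip u 1 = 0 ↔ u 1 = 0 := by
  simp [flip, h]

lemma flip_mem_dom {u : E2} (hu : u ∈ d.dom) (h : u 0 ≠ 0) : flip u ∈ d.swap.dom := by
  refine ⟨hu.2, ?_⟩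
  have : (flip u 0) ^ 2 * flip u 1 = u 1 := by
    simp only [flip, mk2_zero, mk2_one]; field_simp
  rw [this]
  exact hu.1

lemma proj_flip {u : E2} (hu : u ∈ d.dom) (h : u 0 ≠ 0) : d.swap.proj (flip u) = d.proj u := by
  rw [d.swap.proj_eq (d.flip_mem_dom hu h), d.proj_eq hu]
  congr 1
  refine Subtype.ext ?_
  change d.swap.F _ = d.F _
  have h1 : (flip u 0) ^ 2 * flip u 1 = u 1 := by
    simp only [flip, mk2_zero, mk2_one]; field_simp
  have h2 : flip u 0 * flip u 1 = u 0 * u 1 := by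
    simp only [flip, mk2_zero, mk2_one]; field_simp
  simp only [F, h1, h2, swap_vec]
  rfl

lemma differentiableAt_flip {u : E2} (h : u 0 ≠ 0) : DifferentiableAt ℂ flip u := by
  have h0 := (differentiable_coord 0).differentiableAt (x := u)
  have h1 := (differentiable_coord 1).differentiableAt (x := u)
  exact DifferentiableAt.mk2 (h0.fun_inv h) ((h0.fun_pow 2).fun_mul h1)

/-- Two points in the two charts have the same image, other than the node, if and only if they
correspond to each other under the change of charts. -/
lemma proj_eq_proj_swap {u v : E2} (hu : u ∈ d.dom) (hv : v ∈ d.swap.dom) (h1 : u 1 ≠ 0)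
    (h : d.proj u = d.swap.proj v) : u 0 ≠ 0 ∧ v = flip u := by
  have hA := d.A_proj hu
  have hB := d.B_proj hu
  have hC := d.C_proj hu
  rw [h] at hA hB hC
  have hA' : d.A (d.swap.proj v) = v 0 ^ 2 * v 1 := d.swap.B_proj hv
  have hB' : d.B (d.swap.proj v) = v 1 := d.swap.A_proj hv
  have hC' : d.C (d.swap.proj v) = v 0 * v 1 := d.swap.C_proj hv
  rw [hA'] at hA
  rw [hB'] at hB
  rw [hC'] at hC
  have hv1 : v 1 ≠ 0 := by
    intro h0
    rw [h0, mul_zero] at hA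
    exact h1 hA.symm
  have hu0 : u 0 ≠ 0 := by
    intro h0
    rw [h0] at hB
    simp only [ne_eq, OfNat.ofNat_ne_zero, not_false_eq_true, zero_pow, zero_mul] at hB
    exact hv1 hB
  refine ⟨hu0, E2.ext ?_ hB⟩
  -- The third coordinate `c` is `u 0 * u 1` in one chart and `v 0 * v 1` in the other, whereas `u 1
  -- = v 0 ^ 2 * v 1`.
  have h2 : v 0 * (u 0 * u 1) = u 1 := by rw [← hC, ← hA]; ring
  have h3 : v 0 * u 0 = 1 := mul_right_cancel₀ h1 (by rw [one_mul, mul_assoc]; exact h2)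
  exact eq_inv_of_mul_eq_one_left h3

/-! ### Holomorphy of the coordinates -/

variable {M : Type*} [TopologicalSpace M] [ChartedSpace E2 M]

lemma mdifferentiableAt_A {P : M → DoubleCover l} {y : M} (hP : HolAt P y)
    (hy : P y ∈ d.nhd d.ε) : MDifferentiableAt 𝓘(ℂ, E2) 𝓘(ℂ, ℂ) (d.A ∘ P) y :=
  hP.linearRatio _ (d.nhd_subset_nonvanishing hy)

lemma mdifferentiableAt_C {P : M → DoubleCover l} {y : M} (hP : HolAt P y)
    (hy : P y ∈ d.nhd d.ε) : MDifferentiableAt 𝓘(ℂ, E2) 𝓘(ℂ, ℂ) (d.C ∘ P) y := by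
  have hA := d.mdifferentiableAt_A hP hy
  have hB : MDifferentiableAt 𝓘(ℂ, E2) 𝓘(ℂ, ℂ) (d.B ∘ P) y :=
    hP.linearRatio _ (d.nhd_subset_nonvanishing hy)
  have hC := hP.cubicRatio (d.nhd_subset_nonvanishing hy)
  have hAB := (d.norm_lt hy).1 hy
  have hh : MDifferentiableAt 𝓘(ℂ, E2) 𝓘(ℂ, ℂ) (d.h ∘ fun x => ((d.A ∘ P) x, (d.B ∘ P) x)) y :=
    (d.differentiableAt_h _ _ hAB.1 hAB.2).mdifferentiableAt.comp y (hA.prodMk_space hB)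
  have hi : MDifferentiableAt 𝓘(ℂ, E2) 𝓘(ℂ, ℂ) ((fun z : ℂ => z⁻¹) ∘ (d.h ∘ fun x => ((d.A ∘ P) x, (d.B ∘ P) x))) y :=
    (differentiableAt_inv (d.h_ne_zero _ _)).mdifferentiableAt.comp y hh
  exact hC.mul hi

lemma mdifferentiableAt_coord {P : M → DoubleCover l} {y : M} (hP : HolAt P y)
    (hy : P y ∈ d.nhd d.ε) (hA : d.A (P y) ≠ 0) :
    MDifferentiableAt 𝓘(ℂ, E2) 𝓘(ℂ, E2) (d.coord ∘ P) y := by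
  have h1 := d.mdifferentiableAt_A hP hy
  have h2 := d.mdifferentiableAt_C hP hy
  have h3 : MDifferentiableAt 𝓘(ℂ, E2) 𝓘(ℂ, ℂ) ((fun z : ℂ => z⁻¹) ∘ (d.A ∘ P)) y :=
    (differentiableAt_inv hA).mdifferentiableAt.comp y h1
  exact modelEquiv.symm.differentiableAt.mdifferentiableAt.comp y ((h2.mul h3).prodMk_space h1)

end Node

end Nodes

/-! ## The resolution of one node -/

section Resolution

open Set Filter

variable {l : Fin 6 → LinearForm} {X : Type} [TopologicalSpace X] [ChartedSpace E2 X]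

/-- A desingularisation of the double cover with an inverse map over the regular locus, and a
node of the double cover. -/
structure Setup (π : X → DoubleCover l) (N : DoubleCover l) where
  noThree : NoThreeConcurrent l
  desing : IsDesingularisation π
  s : DoubleCover l → X
  holo_s : IsHolomorphicFromCoverOn s (regularLocus l)
  right_inv : ∀ P ∈ regularLocus l, π (s P) = P
  left_inv : ∀ q : X, π q ∈ regularLocus l → s (π q) = q
  d : Node l N

namespace Setup

variable {π : X → DoubleCover l} {N : DoubleCover l} (S : Setup π N)

/-- The node with its two orders of the linear forms vanishing there. -/
def node : Bool → Node l N
  | true => S.d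
  | false => S.d.swap

lemma node_not (b : Bool) : S.node (!b) = (S.node b).swap := by cases b <;> rfl

/-- The points of the exceptional curve, in two charts. -/
def pt : Bool → ℂ → Option ℂ
  | true, t => some t
  | false, t => if t = 0 then none else some t⁻¹

lemma pt_injective (b : Bool) : Function.Injective (pt b) := by
  intro t t' h
  cases b
  · simp only [pt] at h
    split_ifs at h with h1 h2 h2
    · rw [h1, h2]
    · exact inv_injective (Option.some_injective _ h)
  · exact Option.some_injective _ h

/-- The usual gluing of the projective line `Option ℂ` from two affine lines, with `none` as the
point at infinity. -/
lemma pt_eq_pt_not {b : Bool} {t t' : ℂ} : pt b t = pt (!b) t' ↔ t ≠ 0 ∧ t' = t⁻¹ := by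
  cases b
  · simp only [pt, Bool.not_false]
    split_ifs with h
    · simp [h]
    · simp [h, eq_comm]
  · simp only [pt, Bool.not_true]
    split_ifs with h
    · simp [h]
      rintro h1 h2
      exact h1 h2.symm
    · rw [Option.some_inj]
      constructor
      · rintro rfl
        exact ⟨inv_ne_zero h, (inv_inv _).symm⟩
      · rintro ⟨-, rfl⟩
        exact (inv_inv _).symm

lemma exists_pt (e : Option ℂ) : ∃ b t, pt b t = e := by
  cases e with
  | none => exact ⟨false, 0, by simp [pt]⟩
  | some t => exact ⟨true, t, rfl⟩

/-- The surface obtained from a desingularisation by replacing the inverse image of the node by a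
projective line. -/
@[nolint unusedArguments]
def Blow (_ : Setup π N) : Type := {q : X // π q ≠ N} ⊕ Option ℂ

open Classical in
/-- The inclusion of the complement of the inverse image of the node. -/
def i₀ (q : X) : S.Blow := if h : π q ≠ N then Sum.inl ⟨q, h⟩ else Sum.inr none

/-- The inclusion of the exceptional curve. -/
def iE (e : Option ℂ) : S.Blow := Sum.inr e

/-- The parametrisation of a neighbourhood of an affine part of the exceptional curve. -/
def j (b : Bool) (u : E2) : S.Blow :=
  if u 1 = 0 then S.iE (pt b (u 0)) else S.i₀ (S.s ((S.node b).proj u))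

/-- The map to the double cover. -/
def ρ (y : S.Blow) : DoubleCover l := Sum.elim (fun q => π q.1) (fun _ => N) y

lemma cases_blow (y : S.Blow) : (∃ q, π q ≠ N ∧ S.i₀ q = y) ∨ ∃ e, S.iE e = y := by
  rcases y with ⟨q, h⟩ | e
  · exact Or.inl ⟨q, h, dif_pos h⟩
  · exact Or.inr ⟨e, rfl⟩

lemma i₀_eq {q : X} (h : π q ≠ N) : S.i₀ q = Sum.inl ⟨q, h⟩ := dif_pos h

lemma i₀_ne_iE {q : X} (h : π q ≠ N) (e : Option ℂ) : S.i₀ q ≠ S.iE e := by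
  rw [i₀_eq _ h]; exact Sum.inl_ne_inr

lemma iE_injective : Function.Injective S.iE := Sum.inr_injective

lemma i₀_injOn : InjOn S.i₀ {q | π q ≠ N} := by
  intro q hq q' hq' h
  rw [i₀_eq _ hq, i₀_eq _ hq'] at h
  exact congrArg Subtype.val (Sum.inl_injective h)

@[simp] lemma ρ_i₀ {q : X} (h : π q ≠ N) : S.ρ (S.i₀ q) = π q := by rw [i₀_eq _ h]; rfl

@[simp] lemma ρ_iE (e : Option ℂ) : S.ρ (S.iE e) = N := rfl

lemma proj_regular {b : Bool} {u : E2} (hu : u ∈ (S.node b).dom) (h : u 1 ≠ 0) :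
    (S.node b).proj u ∈ regularLocus l :=
  (S.node b).mem_regularLocus S.noThree ((S.node b).proj_mem_nhd_self hu)
    (by rwa [ne_eq, (S.node b).proj_eq_node_iff hu])

lemma ne_node_of_regular (S : Setup π N) {P : DoubleCover l} (h : P ∈ regularLocus l) : P ≠ N := by
  intro h'
  exact S.d.node_notMem_regularLocus (h' ▸ h)

lemma π_s_proj {b : Bool} {u : E2} (hu : u ∈ (S.node b).dom) (h : u 1 ≠ 0) :
    π (S.s ((S.node b).proj u)) = (S.node b).proj u :=
  S.right_inv _ (S.proj_regular hu h)

lemma π_s_proj_ne {b : Bool} {u : E2} (hu : u ∈ (S.node b).dom) (h : u 1 ≠ 0) :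
    π (S.s ((S.node b).proj u)) ≠ N := by
  rw [S.π_s_proj hu h]
  exact S.ne_node_of_regular (S.proj_regular hu h)

lemma j_of_eq {b : Bool} {u : E2} (h : u 1 = 0) : S.j b u = S.iE (pt b (u 0)) := if_pos h

lemma j_of_ne {b : Bool} {u : E2} (h : u 1 ≠ 0) :
    S.j b u = S.i₀ (S.s ((S.node b).proj u)) := if_neg h

lemma ρ_j {b : Bool} {u : E2} (hu : u ∈ (S.node b).dom) : S.ρ (S.j b u) = (S.node b).proj u := by
  by_cases h : u 1 = 0
  · rw [S.j_of_eq h, ρ_iE, eq_comm, (S.node b).proj_eq_node_iff hu, h]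
  · rw [S.j_of_ne h, S.ρ_i₀ (S.π_s_proj_ne hu h), S.π_s_proj hu h]

lemma j_eq_i₀_iff {b : Bool} {u : E2} {q : X} (hu : u ∈ (S.node b).dom) (hq : π q ≠ N) :
    S.j b u = S.i₀ q ↔ u 1 ≠ 0 ∧ S.s ((S.node b).proj u) = q := by
  by_cases h : u 1 = 0
  · rw [S.j_of_eq h]
    simp only [h, ne_eq, not_true_eq_false, false_and, iff_false]
    exact (S.i₀_ne_iE hq _).symm
  · rw [S.j_of_ne h]
    simp only [ne_eq, h, not_false_eq_true, true_and]
    exact ⟨fun h' => S.i₀_injOn (S.π_s_proj_ne hu h) hq h', fun h' => by rw [h']⟩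

lemma coord_spec {b : Bool} {q : X} (hq : π q ∈ (S.node b).nhd (S.node b).ε)
    (hA : (S.node b).A (π q) ≠ 0) : (S.node b).coord (π q) ∈ (S.node b).dom ∧
      π q ≠ N ∧ S.j b ((S.node b).coord (π q)) = S.i₀ q := by
  obtain ⟨h1, h2⟩ := (S.node b).coord_mem_dom hq hA
  have hN : π q ≠ N := by
    intro h
    rw [h, (S.node b).A_node] at hA
    exact hA rfl
  refine ⟨h1, hN, (S.j_eq_i₀_iff h1 hN).2 ⟨hA, ?_⟩⟩
  rw [h2]
  exact S.left_inv _ ((S.node b).mem_regularLocus S.noThree hq hN)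

lemma j_eq_i₀_iff_coord {b : Bool} {u : E2} {q : X} (hu : u ∈ (S.node b).dom) (hq : π q ≠ N) :
    S.j b u = S.i₀ q ↔ π q ∈ (S.node b).nhd (S.node b).ε ∧ (S.node b).A (π q) ≠ 0 ∧
      u = (S.node b).coord (π q) := by
  constructor
  · intro h
    obtain ⟨h1, rfl⟩ := (S.j_eq_i₀_iff hu hq).1 h
    rw [S.π_s_proj hu h1]
    refine ⟨(S.node b).proj_mem_nhd_self hu, ?_, ((S.node b).coord_proj hu h1).symm⟩
    rwa [(S.node b).A_proj hu]
  · rintro ⟨h1, h2, rfl⟩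
    exact (S.coord_spec h1 h2).2.2

/-- Off the line, a point is recovered from its image in the double cover. On the line, where that
image is constantly the node, its position on the projective line is used. -/
lemma j_injOn (b : Bool) : InjOn (S.j b) (S.node b).dom := by
  intro u hu v hv h
  have hρ := congrArg S.ρ h
  rw [S.ρ_j hu, S.ρ_j hv] at hρ
  have h1 : u 1 = v 1 := by
    rw [← (S.node b).A_proj hu, hρ, (S.node b).A_proj hv]
  by_cases h0 : u 1 = 0
  · rw [S.j_of_eq h0, S.j_of_eq (h1 ▸ h0)] at h
    exact E2.ext (pt_injective b (S.iE_injective h)) h1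
  · rw [← (S.node b).coord_proj hu h0, hρ, (S.node b).coord_proj hv (h1 ▸ h0)]

/-- The change of charts is found by comparing images in the double cover off the line, and by the
gluing of the projective line on it. -/
lemma j_eq_j_not_iff {b : Bool} {u v : E2} (hu : u ∈ (S.node b).dom) (hv : v ∈ (S.node (!b)).dom) :
    S.j b u = S.j (!b) v ↔ u 0 ≠ 0 ∧ v = Node.flip u := by
  have hn := S.node_not b
  rw [hn] at hv
  by_cases h : u 1 = 0
  · rw [S.j_of_eq h]
    by_cases h' : v 1 = 0
    · rw [S.j_of_eq h', S.iE_injective.eq_iff, pt_eq_pt_not]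
      refine and_congr_right fun h0 => ⟨fun h1 => E2.ext h1 ?_, fun h1 => by rw [h1]; rfl⟩
      rw [h', eq_comm, Node.flip_one_eq_zero h0, h]
    · rw [S.j_of_ne h']
      rw [← hn] at hv
      simp only [(S.i₀_ne_iE (S.π_s_proj_ne hv h') _).symm, false_iff, not_and]
      rintro h0 rfl
      exact h' ((Node.flip_one_eq_zero h0).2 h)
  · rw [S.j_of_ne h]
    constructor
    · intro h1
      have hρ := congrArg S.ρ h1
      rw [S.ρ_i₀ (S.π_s_proj_ne hu h), S.π_s_proj hu h, S.ρ_j (by rwa [hn]), hn] at hρ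
      exact (S.node b).proj_eq_proj_swap hu hv h hρ
    · rintro ⟨h0, rfl⟩
      have h1 : Node.flip u 1 ≠ 0 := by rwa [ne_eq, Node.flip_one_eq_zero h0]
      rw [S.j_of_ne h1, hn, (S.node b).proj_flip hu h0]

/-! ### The topology -/

lemma continuous_π (S : Setup π N) : Continuous π :=
  continuous_iff_continuousAt.2 fun q => (S.desing.holomorphic.holAt q).continuousAt

lemma isOpen_ne_node (S : Setup π N) : IsOpen {P : DoubleCover l | P ≠ N} := by
  rw [isOpen_iff_mem_nhds]
  intro P hP
  obtain ⟨δ, hδ, -, V, hV, hPV, hVd⟩ := S.d.exists_separation hP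
  filter_upwards [hV.mem_nhds hPV] with Q hQ h
  exact Set.disjoint_left.1 hVd hQ (h ▸ S.d.node_mem_nhd hδ)

lemma isOpen_ne (S : Setup π N) : IsOpen {q | π q ≠ N} := S.isOpen_ne_node.preimage S.continuous_π

lemma mdifferentiableAt_s_comp {M : Type*} [TopologicalSpace M] [ChartedSpace E2 M]
    {P : M → DoubleCover l} {y : M} (hP : HolAt P y) (hy : P y ∈ regularLocus l) :
    MDifferentiableAt 𝓘(ℂ, E2) 𝓘(ℂ, E2) (S.s ∘ P) y :=
  S.holo_s.mdifferentiableAt_comp hP hy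

lemma mdifferentiableAt_s_proj {b : Bool} {u : E2} (hu : u ∈ (S.node b).dom) (h : u 1 ≠ 0) :
    MDifferentiableAt 𝓘(ℂ, E2) 𝓘(ℂ, E2) (fun u => S.s ((S.node b).proj u)) u :=
  S.mdifferentiableAt_s_comp ((S.node b).holAt_proj hu) (S.proj_regular hu h)

lemma mdifferentiableAt_coord {b : Bool} {q : X} (hq : π q ∈ (S.node b).nhd (S.node b).ε)
    (hA : (S.node b).A (π q) ≠ 0) :
    MDifferentiableAt 𝓘(ℂ, E2) 𝓘(ℂ, E2) (fun q => (S.node b).coord (π q)) q :=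
  (S.node b).mdifferentiableAt_coord (S.desing.holomorphic.holAt q) hq hA

/-- The final topology for the three parametrisations. Their continuity is then automatic, and only
their openness requires an argument. -/
instance : TopologicalSpace S.Blow where
  IsOpen U := IsOpen {q | π q ≠ N ∧ S.i₀ q ∈ U} ∧ ∀ b, IsOpen {u | u ∈ (S.node b).dom ∧ S.j b u ∈ U}
  isOpen_univ := by
    simp only [mem_univ, and_true]
    exact ⟨S.isOpen_ne, fun b => (S.node b).isOpen_dom⟩
  isOpen_inter U V hU hV := by
    refine ⟨?_, fun b => ?_⟩
    · convert hU.1.inter hV.1 using 1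
      ext q; simp only [mem_inter_iff, mem_ofPred_eq]; tauto
    · convert (hU.2 b).inter (hV.2 b) using 1
      ext q; simp only [mem_inter_iff, mem_ofPred_eq]; tauto
  isOpen_sUnion 𝒰 h𝒰 := by
    refine ⟨?_, fun b => ?_⟩
    · have : {q | π q ≠ N ∧ S.i₀ q ∈ ⋃₀ 𝒰} = ⋃ U ∈ 𝒰, {q | π q ≠ N ∧ S.i₀ q ∈ U} := by
        ext q; simp only [mem_sUnion, mem_ofPred_eq, mem_iUnion, exists_prop]; tauto
      rw [this]
      exact isOpen_biUnion fun U hU => (h𝒰 U hU).1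
    · have : {u | u ∈ (S.node b).dom ∧ S.j b u ∈ ⋃₀ 𝒰} =
          ⋃ U ∈ 𝒰, {u | u ∈ (S.node b).dom ∧ S.j b u ∈ U} := by
        ext q; simp only [mem_sUnion, mem_ofPred_eq, mem_iUnion, exists_prop]; tauto
      rw [this]
      exact isOpen_biUnion fun U hU => (h𝒰 U hU).2 b

lemma isOpen_iff {U : Set S.Blow} : IsOpen U ↔ IsOpen {q | π q ≠ N ∧ S.i₀ q ∈ U} ∧
    ∀ b, IsOpen {u | u ∈ (S.node b).dom ∧ S.j b u ∈ U} := Iff.rfl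

lemma continuousOn_i₀ : ContinuousOn S.i₀ {q | π q ≠ N} := by
  rw [continuousOn_open_iff S.isOpen_ne]
  exact fun U hU => (S.isOpen_iff.1 hU).1

lemma continuousOn_j (b : Bool) : ContinuousOn (S.j b) (S.node b).dom := by
  rw [continuousOn_open_iff (S.node b).isOpen_dom]
  exact fun U hU => (S.isOpen_iff.1 hU).2 b

/-- In the charts around the exceptional line, the image is pulled back by `s ∘ proj`, which is
continuous off the line. -/
lemma isOpen_image_i₀ {O : Set X} (hO : IsOpen O) (hON : O ⊆ {q | π q ≠ N}) :
    IsOpen (S.i₀ '' O) := by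
  refine S.isOpen_iff.2 ⟨?_, fun b => ?_⟩
  · convert hO using 1
    ext q
    refine ⟨?_, fun h => ⟨hON h, q, h, rfl⟩⟩
    rintro ⟨hq, q', hq', h⟩
    rwa [← S.i₀_injOn (hON hq') hq h]
  · rw [isOpen_iff_mem_nhds]
    rintro u ⟨hu, q, hq, h⟩
    obtain ⟨h1, rfl⟩ := (S.j_eq_i₀_iff hu (hON hq)).1 h.symm
    filter_upwards [(S.node b).isOpen_dom.mem_nhds hu,
      (continuous_coord 1).continuousAt.eventually_ne h1,
      (S.mdifferentiableAt_s_proj hu h1).continuousAt.preimage_mem_nhds (hO.mem_nhds hq)]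
      with v hv hv1 hvO
    exact ⟨hv, _, hvO, (S.j_of_ne hv1).symm⟩

/-- Pulling back to `X` uses continuity of `coord ∘ π`, and pulling back to the other chart uses
continuity of `flip`. -/
lemma isOpen_image_j {b : Bool} {O : Set E2} (hO : IsOpen O) (hOd : O ⊆ (S.node b).dom) :
    IsOpen (S.j b '' O) := by
  refine S.isOpen_iff.2 ⟨?_, fun b' => ?_⟩
  · rw [isOpen_iff_mem_nhds]
    rintro q ⟨hq, u, hu, h⟩
    obtain ⟨h1, h2, rfl⟩ := (S.j_eq_i₀_iff_coord (hOd hu) hq).1 h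
    have hc := (S.mdifferentiableAt_coord h1 h2).continuousAt
    have hA := ((S.node b).mdifferentiableAt_A (S.desing.holomorphic.holAt q) h1).continuousAt
    filter_upwards [((S.node b).isOpen_nhd _ |>.preimage S.continuous_π).mem_nhds h1,
      hA.eventually_ne h2, hc.preimage_mem_nhds (hO.mem_nhds hu)] with q' h1' h2' hO'
    obtain ⟨-, h3, h4⟩ := S.coord_spec h1' h2'
    exact ⟨h3, _, hO', h4⟩
  · by_cases hb : b' = b
    · subst hb
      convert hO using 1
      ext u
      refine ⟨?_, fun h => ⟨hOd h, u, h, rfl⟩⟩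
      rintro ⟨hu, v, hv, h⟩
      rwa [← S.j_injOn b' (hOd hv) hu h]
    · obtain rfl : b = !b' := by cases b <;> cases b' <;> simp_all
      rw [isOpen_iff_mem_nhds]
      rintro u ⟨hu, v, hv, h⟩
      obtain ⟨h0, rfl⟩ := (S.j_eq_j_not_iff hu (hOd hv)).1 h.symm
      filter_upwards [(S.node b').isOpen_dom.mem_nhds hu,
        (continuous_coord 0).continuousAt.eventually_ne h0,
        (Node.differentiableAt_flip h0).continuousAt.preimage_mem_nhds (hO.mem_nhds hv)]
        with w hw hw0 hwO
      exact ⟨hw, _, hwO, ((S.j_eq_j_not_iff hw (hOd hwO)).2 ⟨hw0, rfl⟩).symm⟩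

lemma isOpenMap_domRestrict {α β : Type*} [TopologicalSpace α] [TopologicalSpace β] {f : α → β}
    {s : Set α} (hs : IsOpen s) (hf : ∀ O, IsOpen O → O ⊆ s → IsOpen (f '' O)) :
    IsOpenMap (s.domRestrict f) := by
  intro O hO
  have : s.domRestrict f '' O = f '' (Subtype.val '' O) := by
    rw [image_image]; rfl
  rw [this]
  refine hf _ (hs.isOpenMap_subtype_val _ hO) ?_
  rintro _ ⟨x, -, rfl⟩
  exact x.2

/-- The inclusion of the complement of the inverse image of the node, as a partial homeomorphism. -/
def J₀ : OpenPartialHomeomorph X S.Blow :=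
  -- The value of `s` at the node has no meaning; it merely inhabits `X`.
  haveI : Nonempty X := ⟨S.s N⟩
  OpenPartialHomeomorph.ofContinuousOpenRestrict (S.i₀_injOn.toPartialEquiv _ _) S.continuousOn_i₀
    (isOpenMap_domRestrict S.isOpen_ne fun _ hO h => S.isOpen_image_i₀ hO h) S.isOpen_ne

/-- The parametrisation of a part of the resolution, as a partial homeomorphism. -/
def J (b : Bool) : OpenPartialHomeomorph E2 S.Blow :=
  OpenPartialHomeomorph.ofContinuousOpenRestrict ((S.j_injOn b).toPartialEquiv _ _)
    (S.continuousOn_j b)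
    (isOpenMap_domRestrict (S.node b).isOpen_dom fun _ hO h => S.isOpen_image_j hO h)
    (S.node b).isOpen_dom

lemma exists_J (e : Option ℂ) : ∃ b, S.iE e ∈ (S.J b).target := by
  obtain ⟨b, t, rfl⟩ := exists_pt e
  have h1 : mk2 t 0 ∈ (S.node b).dom := (S.node b).mem_dom_of_one_eq_zero rfl
  refine ⟨b, ?_⟩
  have h2 : S.j b (mk2 t 0) = S.iE (pt b t) := S.j_of_eq rfl
  rw [← h2]
  exact (S.J b).map_source h1

/-- The charts of the resolution. -/
def charts : Set (OpenPartialHomeomorph S.Blow E2) :=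
  {e | (∃ e' ∈ atlas E2 X, e = S.J₀.symm.trans e') ∨ ∃ b, e = (S.J b).symm}

lemma exists_chart (y : S.Blow) : ∃ e ∈ S.charts, y ∈ e.source := by
  rcases S.cases_blow y with ⟨q, hq, rfl⟩ | ⟨e, rfl⟩
  · refine ⟨_, Or.inl ⟨chartAt E2 q, chart_mem_atlas E2 q, rfl⟩, ?_⟩
    rw [OpenPartialHomeomorph.trans_source]
    refine ⟨S.J₀.map_source hq, ?_⟩
    have : S.J₀.symm (S.i₀ q) = q := S.J₀.left_inv hq
    rw [mem_preimage, this]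
    exact mem_chart_source E2 q
  · obtain ⟨b, hb⟩ := S.exists_J e
    exact ⟨_, Or.inr ⟨b, rfl⟩, hb⟩

instance : ChartedSpace E2 S.Blow where
  atlas := S.charts
  chartAt y := (S.exists_chart y).choose
  mem_chart_source y := (S.exists_chart y).choose_spec.2
  chart_mem_atlas y := (S.exists_chart y).choose_spec.1

lemma J_symm_mem_atlas (b : Bool) : (S.J b).symm ∈ atlas E2 S.Blow := Or.inr ⟨b, rfl⟩

lemma J₀_symm_trans_mem_atlas {e : OpenPartialHomeomorph X E2} (he : e ∈ atlas E2 X) :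
    S.J₀.symm.trans e ∈ atlas E2 S.Blow := Or.inl ⟨e, he, rfl⟩

/-! ### The complex structure -/

lemma differentiableAt_of_chart (S : Setup π N) {e : OpenPartialHomeomorph X E2} (he : e ∈ atlas E2 X)
    {f : E2 → X} {u : E2} (hf : MDifferentiableAt 𝓘(ℂ, E2) 𝓘(ℂ, E2) f u) (hu : f u ∈ e.source) :
    DifferentiableAt ℂ (e ∘ f) u := by
  have := S.desing.manifold
  have : IsManifold 𝓘(ℂ, E2) 1 X := IsManifold.of_le (n := ω) le_top
  exact mdifferentiableAt_iff_differentiableAt.1 ((mdifferentiableAt_atlas he hu).comp u hf)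

lemma mdifferentiableAt_chart_symm (S : Setup π N) {e : OpenPartialHomeomorph X E2} (he : e ∈ atlas E2 X)
    {u : E2} (hu : u ∈ e.target) : MDifferentiableAt 𝓘(ℂ, E2) 𝓘(ℂ, E2) e.symm u := by
  have := S.desing.manifold
  have : IsManifold 𝓘(ℂ, E2) 1 X := IsManifold.of_le (n := ω) le_top
  exact mdifferentiableAt_atlas_symm he hu

lemma J_symm_i₀ {b : Bool} {q : X} (hq : π q ≠ N) (h : S.i₀ q ∈ (S.J b).target) :
    π q ∈ (S.node b).nhd (S.node b).ε ∧ (S.node b).A (π q) ≠ 0 ∧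
      (S.J b).symm (S.i₀ q) = (S.node b).coord (π q) :=
  (S.j_eq_i₀_iff_coord ((S.J b).map_target h) hq).1 ((S.J b).right_inv h)

/-- Besides the transition maps of `X`, the changes of charts are `coord ∘ π` and `s ∘ proj`, read
in charts of `X`, and `flip`. Differentiability is enough, since `contDiffOn_of_differentiableOn`
upgrades it to a complex structure. -/
lemma differentiableOn_transition {e e' : OpenPartialHomeomorph S.Blow E2}
    (he : e ∈ atlas E2 S.Blow) (he' : e' ∈ atlas E2 S.Blow) :
    DifferentiableOn ℂ (e.symm.trans e') (e.symm.trans e').source := by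
  intro u hu
  refine DifferentiableAt.differentiableWithinAt ?_
  have hopen := (e.symm.trans e').open_source.mem_nhds hu
  rcases he with ⟨e, he, rfl⟩ | ⟨b, rfl⟩ <;> rcases he' with ⟨e', he', rfl⟩ | ⟨b', rfl⟩
  · have key : ∀ v ∈ ((S.J₀.symm.trans e).symm.trans (S.J₀.symm.trans e')).source,
        v ∈ e.target ∧ e.symm v ∈ e'.source ∧
          ((S.J₀.symm.trans e).symm.trans (S.J₀.symm.trans e')) v = e' (e.symm v) := by
      intro v hv
      simp only [OpenPartialHomeomorph.trans_source, OpenPartialHomeomorph.trans_symm_eq_symm_trans_symm, OpenPartialHomeomorph.symm_symm,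
        OpenPartialHomeomorph.symm_source, mem_inter_iff, mem_preimage,
        OpenPartialHomeomorph.coe_trans, Function.comp_apply] at hv ⊢
      have := S.J₀.left_inv hv.1.2
      rw [this] at hv ⊢
      exact ⟨hv.1.1, hv.2.2, rfl⟩
    have h1 := key u hu
    refine (S.differentiableAt_of_chart he' (S.mdifferentiableAt_chart_symm he h1.1)
      h1.2.1).congr_of_eventuallyEq ?_
    filter_upwards [hopen] with v hv
    exact (key v hv).2.2
  · have key : ∀ v ∈ ((S.J₀.symm.trans e).symm.trans (S.J b').symm).source,
        v ∈ e.target ∧ π (e.symm v) ∈ (S.node b').nhd (S.node b').ε ∧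
          (S.node b').A (π (e.symm v)) ≠ 0 ∧
          ((S.J₀.symm.trans e).symm.trans (S.J b').symm) v =
            (S.node b').coord (π (e.symm v)) := by
      intro v hv
      simp only [OpenPartialHomeomorph.trans_source, OpenPartialHomeomorph.trans_symm_eq_symm_trans_symm, OpenPartialHomeomorph.symm_symm,
        OpenPartialHomeomorph.symm_source, mem_inter_iff, mem_preimage,
        OpenPartialHomeomorph.coe_trans, Function.comp_apply] at hv ⊢
      exact ⟨hv.1.1, S.J_symm_i₀ hv.1.2 hv.2⟩
    have h1 := key u hu
    refine (mdifferentiableAt_iff_differentiableAt.1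
      ((S.mdifferentiableAt_coord h1.2.1 h1.2.2.1).comp u
        (S.mdifferentiableAt_chart_symm he h1.1))).congr_of_eventuallyEq ?_
    filter_upwards [hopen] with v hv
    exact (key v hv).2.2.2
  · have key : ∀ v ∈ ((S.J b).symm.symm.trans (S.J₀.symm.trans e')).source,
        v ∈ (S.node b).dom ∧ v 1 ≠ 0 ∧ S.s ((S.node b).proj v) ∈ e'.source ∧
          ((S.J b).symm.symm.trans (S.J₀.symm.trans e')) v = e' (S.s ((S.node b).proj v)) := by
      intro v hv
      simp only [OpenPartialHomeomorph.trans_source, OpenPartialHomeomorph.symm_symm,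
        OpenPartialHomeomorph.symm_source, mem_inter_iff, mem_preimage,
        OpenPartialHomeomorph.coe_trans, Function.comp_apply] at hv ⊢
      have hN : π (S.J₀.symm (S.J b v)) ≠ N := S.J₀.map_target hv.2.1
      obtain ⟨h1, h2⟩ := (S.j_eq_i₀_iff hv.1 hN).1 (S.J₀.right_inv hv.2.1).symm
      rw [h2]
      exact ⟨hv.1, h1, hv.2.2, rfl⟩
    have h1 := key u hu
    refine (S.differentiableAt_of_chart he' (S.mdifferentiableAt_s_proj h1.1 h1.2.1)
      h1.2.2.1).congr_of_eventuallyEq ?_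
    filter_upwards [hopen] with v hv
    exact (key v hv).2.2.2
  · by_cases hb : b' = b
    · subst hb
      refine differentiableAt_id.congr_of_eventuallyEq ?_
      filter_upwards [hopen] with v hv
      exact (S.J b').left_inv hv.1
    · obtain rfl : b' = !b := by cases b <;> cases b' <;> simp_all
      have key : ∀ v ∈ ((S.J b).symm.symm.trans (S.J (!b)).symm).source, v 0 ≠ 0 ∧
          ((S.J b).symm.symm.trans (S.J (!b)).symm) v = Node.flip v := by
        intro v hv
        exact (S.j_eq_j_not_iff hv.1 ((S.J (!b)).map_target hv.2)).1
          ((S.J (!b)).right_inv hv.2).symm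
      refine (Node.differentiableAt_flip (key u hu).1).congr_of_eventuallyEq ?_
      filter_upwards [hopen] with v hv
      exact (key v hv).2

instance isManifold : IsManifold 𝓘(ℂ, E2) ω S.Blow := by
  refine isManifold_of_contDiffOn _ _ _ fun e e' he he' => ?_
  simp only [modelWithCornersSelf_coe, modelWithCornersSelf_coe_symm, Function.id_comp,
    Function.comp_id, preimage_id, range_id, inter_univ]
  exact contDiffOn_of_differentiableOn (S.differentiableOn_transition he he')
    (e.symm.trans e').open_source

end Setup

end Resolution

section Resolution

open Set Filter

variable {l : Fin 6 → LinearForm} {X : Type} [TopologicalSpace X] [ChartedSpace E2 X]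

namespace Setup

variable {π : X → DoubleCover l} {N : DoubleCover l} (S : Setup π N)

/-! ### The resolution is a desingularisation -/

lemma mdifferentiableAt_J {b : Bool} {u : E2} (hu : u ∈ (S.node b).dom) :
    MDifferentiableAt 𝓘(ℂ, E2) 𝓘(ℂ, E2) (S.j b) u := by
  have : IsManifold 𝓘(ℂ, E2) 1 S.Blow := IsManifold.of_le (n := ω) le_top
  exact mdifferentiableAt_atlas_symm (S.J_symm_mem_atlas b) hu

lemma mdifferentiableAt_J_symm {b : Bool} {y : S.Blow} (hy : y ∈ (S.J b).target) :
    MDifferentiableAt 𝓘(ℂ, E2) 𝓘(ℂ, E2) (S.J b).symm y := by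
  have : IsManifold 𝓘(ℂ, E2) 1 S.Blow := IsManifold.of_le (n := ω) le_top
  exact mdifferentiableAt_atlas (S.J_symm_mem_atlas b) hy

lemma mdifferentiableAt_i₀ {q : X} (hq : π q ≠ N) :
    MDifferentiableAt 𝓘(ℂ, E2) 𝓘(ℂ, E2) S.i₀ q := by
  have := S.desing.manifold
  have : IsManifold 𝓘(ℂ, E2) 1 X := IsManifold.of_le (n := ω) le_top
  have : IsManifold 𝓘(ℂ, E2) 1 S.Blow := IsManifold.of_le (n := ω) le_top
  set e := chartAt E2 q
  have he : e ∈ atlas E2 X := chart_mem_atlas E2 q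
  have hqe : q ∈ e.source := mem_chart_source E2 q
  have h1 : MDifferentiableAt 𝓘(ℂ, E2) 𝓘(ℂ, E2) e q := mdifferentiableAt_atlas he hqe
  have h2 : e q ∈ (S.J₀.symm.trans e).target := by
    rw [OpenPartialHomeomorph.trans_target]
    refine ⟨e.map_source hqe, ?_⟩
    rw [mem_preimage, e.left_inv hqe]
    exact hq
  have h3 := mdifferentiableAt_atlas_symm (I := 𝓘(ℂ, E2)) (S.J₀_symm_trans_mem_atlas he) h2
  refine (h3.comp q h1).congr_of_eventuallyEq ?_
  filter_upwards [e.open_source.mem_nhds hqe] with q' hq'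
  have : e.symm (e q') = q' := e.left_inv hq'
  change S.i₀ q' = S.J₀ (e.symm (e q'))
  rw [this]
  rfl

lemma mdifferentiableAt_J₀_symm {q : X} (hq : π q ≠ N) :
    MDifferentiableAt 𝓘(ℂ, E2) 𝓘(ℂ, E2) S.J₀.symm (S.i₀ q) := by
  have := S.desing.manifold
  have : IsManifold 𝓘(ℂ, E2) 1 X := IsManifold.of_le (n := ω) le_top
  have : IsManifold 𝓘(ℂ, E2) 1 S.Blow := IsManifold.of_le (n := ω) le_top
  have hinv : S.J₀.symm (S.i₀ q) = q := S.J₀.left_inv hq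
  set e := chartAt E2 q
  have he : e ∈ atlas E2 X := chart_mem_atlas E2 q
  have hqe : q ∈ e.source := mem_chart_source E2 q
  have h2 : S.i₀ q ∈ (S.J₀.symm.trans e).source := by
    rw [OpenPartialHomeomorph.trans_source]
    refine ⟨S.J₀.map_source hq, ?_⟩
    rw [mem_preimage, hinv]
    exact hqe
  have h3 := mdifferentiableAt_atlas (I := 𝓘(ℂ, E2)) (S.J₀_symm_trans_mem_atlas he) h2
  have h4 : MDifferentiableAt 𝓘(ℂ, E2) 𝓘(ℂ, E2) e.symm ((S.J₀.symm.trans e) (S.i₀ q)) := by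
    refine mdifferentiableAt_atlas_symm he ?_
    exact (S.J₀.symm.trans e).map_source h2 |>.1
  refine (h4.comp _ h3).congr_of_eventuallyEq ?_
  filter_upwards [(S.J₀.symm.trans e).open_source.mem_nhds h2] with y hy
  exact (e.left_inv hy.2).symm

lemma isHolomorphicToCover_ρ : IsHolomorphicToCover S.ρ := by
  intro y
  rcases S.cases_blow y with ⟨q, hq, rfl⟩ | ⟨e, rfl⟩
  · obtain ⟨U, hU, hqU, F, hF, h⟩ := S.desing.holomorphic q
    refine ⟨S.i₀ '' (U ∩ {q | π q ≠ N}), S.isOpen_image_i₀ (hU.inter S.isOpen_ne)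
      inter_subset_right, ⟨q, ⟨hqU, hq⟩, rfl⟩, F ∘ S.J₀.symm, ?_, ?_⟩
    · rintro _ ⟨q', ⟨hq'U, hq'⟩, rfl⟩
      have hinv : S.J₀.symm (S.i₀ q') = q' := S.J₀.left_inv hq'
      have h1 := S.mdifferentiableAt_J₀_symm hq'
      refine (MDifferentiableAt.comp _ ?_ h1).mdifferentiableWithinAt
      rw [hinv]
      exact hF.mdifferentiableAt (hU.mem_nhds hq'U)
    · rintro _ ⟨q', ⟨hq'U, hq'⟩, rfl⟩
      have hinv : S.J₀.symm (S.i₀ q') = q' := S.J₀.left_inv hq'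
      simp only [Function.comp_apply, hinv, S.ρ_i₀ hq']
      exact h q' hq'U
  · obtain ⟨b, hb⟩ := S.exists_J e
    refine ⟨(S.J b).target, (S.J b).open_target, hb, (S.node b).F ∘ (S.J b).symm, ?_, ?_⟩
    · intro y hy
      exact (((S.node b).differentiableAt_F ((S.J b).map_target hy)).mdifferentiableAt.comp y
        (S.mdifferentiableAt_J_symm hy)).mdifferentiableWithinAt
    · intro y hy
      have h1 : (S.J b).symm y ∈ (S.node b).dom := (S.J b).map_target hy
      refine ⟨(S.node b).F_mem h1, ?_⟩
      have h2 : S.j b ((S.J b).symm y) = y := (S.J b).right_inv hy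
      conv_lhs => rw [← h2]
      rw [S.ρ_j h1, (S.node b).proj_eq h1]
      rfl

lemma continuous_ρ : Continuous S.ρ :=
  continuous_iff_continuousAt.2 fun y => (S.isHolomorphicToCover_ρ.holAt y).continuousAt

lemma separated_of_mem_target {Z Y : Type*} [TopologicalSpace Z] [TopologicalSpace Y] [T2Space Z]
    (e : OpenPartialHomeomorph Z Y) {y y' : Y} (hy : y ∈ e.target) (hy' : y' ∈ e.target)
    (h : y ≠ y') : ∃ u v : Set Y, IsOpen u ∧ IsOpen v ∧ y ∈ u ∧ y' ∈ v ∧ Disjoint u v := by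
  obtain ⟨u, v, hu, hv, hyu, hyv, huv⟩ := t2_separation (e.symm.injOn.ne hy hy' h)
  refine ⟨_, _, e.isOpen_inter_preimage_symm hu, e.isOpen_inter_preimage_symm hv,
    ⟨hy, hyu⟩, ⟨hy', hyv⟩, ?_⟩
  exact (huv.preimage e.symm).mono inter_subset_right inter_subset_right

/-- Separation already takes place in the double cover, between the node and `π q`. -/
lemma separated_i₀_iE {q : X} (hq : π q ≠ N) (e : Option ℂ) :
    ∃ u v : Set S.Blow, IsOpen u ∧ IsOpen v ∧ S.i₀ q ∈ u ∧ S.iE e ∈ v ∧ Disjoint u v := by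
  obtain ⟨δ, hδ, -, V, hV, hqV, hVd⟩ := S.d.exists_separation hq
  refine ⟨S.ρ ⁻¹' V, S.ρ ⁻¹' S.d.nhd δ, hV.preimage S.continuous_ρ,
    (S.d.isOpen_nhd δ).preimage S.continuous_ρ, ?_, S.d.node_mem_nhd hδ, hVd.preimage _⟩
  rw [mem_preimage, S.ρ_i₀ hq]
  exact hqV

/-- Two points of the exceptional line lie in a common chart unless they are the origins of the two
charts. -/
lemma separated_iE_iE {e e' : Option ℂ} (h : e ≠ e') :
    ∃ u v : Set S.Blow, IsOpen u ∧ IsOpen v ∧ S.iE e ∈ u ∧ S.iE e' ∈ v ∧ Disjoint u v := by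
  have hmem : ∀ b t, S.iE (pt b t) ∈ (S.J b).target := by
    intro b t
    have h1 : S.j b (mk2 t 0) = S.iE (pt b t) := S.j_of_eq rfl
    rw [← h1]
    exact (S.J b).map_source ((S.node b).mem_dom_of_one_eq_zero rfl)
  have hne : S.iE e ≠ S.iE e' := S.iE_injective.ne h
  obtain ⟨b, t, rfl⟩ := exists_pt e
  obtain ⟨b', t', rfl⟩ := exists_pt e'
  by_cases hb : b' = b
  · subst hb
    exact separated_of_mem_target (S.J b') (hmem _ _) (hmem _ _) hne
  · obtain rfl : b' = !b := by cases b <;> cases b' <;> simp_all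
    by_cases ht : t = 0
    · by_cases ht' : t' = 0
      -- The change of charts inverts `u 0`, so the parts with `‖u 0‖ < 1` of the two charts do not
      -- meet.
      · have hopen : ∀ b, IsOpen ((S.node b).dom ∩ {u : E2 | ‖u 0‖ < 1}) := fun b =>
          (S.node b).isOpen_dom.inter (isOpen_lt (continuous_coord 0).norm continuous_const)
        refine ⟨_, _, S.isOpen_image_j (hopen b) inter_subset_left,
          S.isOpen_image_j (hopen (!b)) inter_subset_left, ?_, ?_, ?_⟩
        · exact ⟨mk2 t 0, ⟨(S.node b).mem_dom_of_one_eq_zero rfl, by simp [ht]⟩, S.j_of_eq rfl⟩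
        · exact ⟨mk2 t' 0, ⟨(S.node (!b)).mem_dom_of_one_eq_zero rfl, by simp [ht']⟩, S.j_of_eq rfl⟩
        · rw [Set.disjoint_left]
          rintro _ ⟨u, ⟨hu, hu1⟩, rfl⟩ ⟨v, ⟨hv, hv1⟩, hv'⟩
          obtain ⟨h0, rfl⟩ := (S.j_eq_j_not_iff hu hv).1 hv'.symm
          simp only [Node.flip, mk2_zero, mem_ofPred_eq, norm_inv] at hv1 hu1
          have h2 : 0 < ‖u 0‖ := norm_pos_iff.2 h0
          exact absurd ((inv_lt_one₀ h2).1 hv1) hu1.not_gt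
      · have h1 : pt (!b) t' = pt b t'⁻¹ := by
          conv_rhs => rw [← Bool.not_not b]
          exact pt_eq_pt_not.2 ⟨ht', rfl⟩
        rw [h1] at hne ⊢
        exact separated_of_mem_target (S.J b) (hmem _ _) (hmem _ _) hne
    · have h1 : pt b t = pt (!b) t⁻¹ := pt_eq_pt_not.2 ⟨ht, rfl⟩
      rw [h1] at hne ⊢
      exact separated_of_mem_target (S.J (!b)) (hmem _ _) (hmem _ _) hne

instance : T2Space S.Blow where
  t2 := by
    have := S.desing.hausdorff
    intro y y' h
    rcases S.cases_blow y with ⟨q, hq, rfl⟩ | ⟨e, rfl⟩ <;>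
      rcases S.cases_blow y' with ⟨q', hq', rfl⟩ | ⟨e', rfl⟩
    · exact separated_of_mem_target S.J₀ (S.J₀.map_source hq) (S.J₀.map_source hq') h
    · exact S.separated_i₀_iE hq e'
    · obtain ⟨u, v, hu, hv, h1, h2, h3⟩ := S.separated_i₀_iE hq' e
      exact ⟨v, u, hv, hu, h2, h1, h3.symm⟩
    · exact S.separated_iE_iE (fun h' => h (by rw [h']))

/-- A compact part of the resolution. -/
def compactPart : Set E2 := {u | ‖u 0‖ ≤ 1 ∧ ‖u 1‖ ≤ S.d.ε / 2}

lemma node_ε (b : Bool) : (S.node b).ε = S.d.ε := by cases b <;> rfl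

lemma node_nhd (b : Bool) (δ : ℝ) : (S.node b).nhd δ = S.d.nhd δ := by
  cases b
  · exact S.d.swap_nhd δ
  · rfl

lemma compactPart_subset (b : Bool) : S.compactPart ⊆ (S.node b).dom := by
  rintro u ⟨h0, h1⟩
  have hε := S.d.ε_pos
  rw [Node.dom, S.node_ε]
  refine ⟨by linarith, ?_⟩
  rw [norm_mul, norm_pow]
  have : ‖u 0‖ ^ 2 ≤ 1 := pow_le_one₀ (norm_nonneg _) h0
  nlinarith [norm_nonneg (u 1)]

lemma isCompact_compactPart : IsCompact (S.compactPart) := by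
  have h : IsCompact (modelEquiv.symm ''
      (Metric.closedBall (0 : ℂ) 1 ×ˢ Metric.closedBall (0 : ℂ) (S.d.ε / 2))) :=
    ((isCompact_closedBall _ _).prod (isCompact_closedBall _ _)).image modelEquiv.symm.continuous
  convert h using 1
  ext u
  constructor
  · rintro ⟨h0, h1⟩
    exact ⟨(u 0, u 1), ⟨mem_closedBall_zero_iff.2 h0, mem_closedBall_zero_iff.2 h1⟩, mk2_eta u⟩
  · rintro ⟨p, ⟨h0, h1⟩, rfl⟩
    exact ⟨mem_closedBall_zero_iff.1 h0, mem_closedBall_zero_iff.1 h1⟩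

/-- By `c² = ab`, the modulus of `c` is at most the larger of those of `a` and `b`. Dividing by that
larger one gives the chart in which the slope is bounded by one. -/
lemma exists_coord_le_one {P : DoubleCover l} (hP : P ∈ S.d.nhd S.d.ε) (hPN : P ≠ N) :
    ∃ b, (S.node b).A P ≠ 0 ∧ ‖(S.node b).coord P 0‖ ≤ 1 := by
  have key : ∃ b, ‖(S.node b).B P‖ ≤ ‖(S.node b).A P‖ := by
    rcases le_total ‖S.d.B P‖ ‖S.d.A P‖ with h | h
    · exact ⟨true, h⟩
    · exact ⟨false, h⟩
  obtain ⟨b, hb⟩ := key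
  have hP' : P ∈ (S.node b).nhd (S.node b).ε := by rwa [S.node_nhd, S.node_ε]
  have hA : (S.node b).A P ≠ 0 := by
    intro h0
    rw [h0, norm_zero, norm_le_zero_iff] at hb
    exact hPN ((S.node b).eq_node_of_A_B hP' h0 hb)
  refine ⟨b, hA, ?_⟩
  have h5 := congrArg norm ((S.node b).sq_C hP')
  rw [norm_pow, norm_mul] at h5
  have hA' : 0 < ‖(S.node b).A P‖ := norm_pos_iff.2 hA
  simp only [Node.coord, mk2_zero, norm_div]
  rw [div_le_one hA']
  nlinarith [norm_nonneg ((S.node b).C P)]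

/-- A neighbourhood of the exceptional curve is covered by compact parts. -/
lemma mem_image_compactPart {y : S.Blow} (hy : S.ρ y ∈ S.d.nhd (S.d.ε / 2)) :
    ∃ b, y ∈ S.j b '' S.compactPart := by
  have hε := S.d.ε_pos
  rcases S.cases_blow y with ⟨q, hq, rfl⟩ | ⟨e, rfl⟩
  · rw [S.ρ_i₀ hq] at hy
    have hyε : π q ∈ S.d.nhd S.d.ε := by
      obtain ⟨p, hp, h1, h2⟩ := hy
      have : S.d.ε / 2 * ‖S.d.m p.1.1‖ ≤ S.d.ε * ‖S.d.m p.1.1‖ :=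
        mul_le_mul_of_nonneg_right (by linarith) (norm_nonneg _)
      exact ⟨p, hp, h1.trans_le this, h2.trans_le this⟩
    obtain ⟨b, hA, h0⟩ := S.exists_coord_le_one hyε hq
    have hyε' : π q ∈ (S.node b).nhd (S.node b).ε := by rwa [S.node_nhd, S.node_ε]
    have hy' : π q ∈ (S.node b).nhd (S.d.ε / 2) := by rwa [S.node_nhd]
    obtain ⟨h1, -, h3⟩ := S.coord_spec hyε' hA
    exact ⟨b, _, ⟨h0, (((S.node b).norm_lt hyε').1 hy').1.le⟩, h3⟩
  · obtain ⟨b, t, rfl⟩ := exists_pt e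
    by_cases ht : ‖t‖ ≤ 1
    · refine ⟨b, mk2 t 0, ⟨ht, ?_⟩, S.j_of_eq rfl⟩
      simp only [mk2_one, norm_zero]
      linarith
    · push Not at ht
      have ht0 : t ≠ 0 := by rintro rfl; simp at ht; linarith
      refine ⟨!b, mk2 t⁻¹ 0, ⟨?_, ?_⟩, ?_⟩
      · simp only [mk2_zero, norm_inv]
        exact inv_le_one_of_one_le₀ ht.le
      · simp only [mk2_one, norm_zero]
        linarith
      · rw [S.j_of_eq rfl, mk2_zero, pt_eq_pt_not.2 ⟨ht0, rfl⟩]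

/-- Over a neighbourhood of the node, everything lies in the union of two compact sets. Elsewhere
`ρ` is `π` transported by `i₀`, and properness of `π` applies. -/
lemma isProperMap_ρ : IsProperMap S.ρ := by
  rw [isProperMap_iff_ultrafilter]
  refine ⟨S.continuous_ρ, fun 𝒰 P hP => ?_⟩
  by_cases hPN : P = N
  · subst hPN
    have hε := S.d.ε_pos
    have h1 : S.ρ ⁻¹' S.d.nhd (S.d.ε / 2) ∈ 𝒰 :=
      hP ((S.d.isOpen_nhd _).mem_nhds (S.d.node_mem_nhd (by linarith)))
    have hK : IsCompact (⋃ b, S.j b '' S.compactPart) :=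
      isCompact_iUnion fun b => S.isCompact_compactPart.image_of_continuousOn
        ((S.continuousOn_j b).mono (S.compactPart_subset b))
    have h2 : (⋃ b, S.j b '' S.compactPart) ∈ 𝒰 := by
      filter_upwards [h1] with y hy
      exact mem_iUnion.2 (S.mem_image_compactPart hy)
    obtain ⟨y, -, hy⟩ := hK.ultrafilter_le_nhds 𝒰 (le_principal_iff.2 h2)
    refine ⟨y, ?_, hy⟩
    -- The limit must lie over the node: any other image could be separated from it.
    by_contra hne
    obtain ⟨δ, hδ, -, V, hV, hyV, hVd⟩ := S.d.exists_separation hne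
    have h3 : S.ρ ⁻¹' V ∈ 𝒰 := hy ((hV.preimage S.continuous_ρ).mem_nhds hyV)
    have h4 : S.ρ ⁻¹' S.d.nhd δ ∈ 𝒰 := hP ((S.d.isOpen_nhd δ).mem_nhds (S.d.node_mem_nhd hδ))
    obtain ⟨z, hz, hz'⟩ := 𝒰.neBot.nonempty_of_mem (inter_mem h3 h4)
    exact Set.disjoint_left.1 hVd hz hz'
  · have h1 : {y | S.ρ y ≠ N} ∈ 𝒰 := hP (S.isOpen_ne_node.mem_nhds hPN)
    have h2 : ∀ y, S.ρ y ≠ N → π (S.J₀.symm y) = S.ρ y ∧ S.i₀ (S.J₀.symm y) = y := by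
      intro y hy
      rcases S.cases_blow y with ⟨q, hq, rfl⟩ | ⟨e, rfl⟩
      · have hinv : S.J₀.symm (S.i₀ q) = q := S.J₀.left_inv hq
        rw [hinv, S.ρ_i₀ hq]
        exact ⟨rfl, rfl⟩
      · exact absurd rfl hy
    have h3 : Tendsto π (𝒰.map S.J₀.symm) (𝓝 P) := by
      rw [Ultrafilter.coe_map, tendsto_map'_iff]
      refine hP.congr' ?_
      filter_upwards [h1] with y hy
      exact (h2 y hy).1.symm
    obtain ⟨q, rfl, hq⟩ := (isProperMap_iff_ultrafilter.1 S.desing.proper).2 h3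
    refine ⟨S.i₀ q, S.ρ_i₀ hPN, ?_⟩
    have h4 : Tendsto S.i₀ (𝒰.map S.J₀.symm) (𝓝 (S.i₀ q)) :=
      Tendsto.mono_left ((S.continuousOn_i₀.continuousAt (S.isOpen_ne.mem_nhds hPN)).tendsto) hq
    rw [Ultrafilter.coe_map, tendsto_map'_iff] at h4
    refine (h4.congr' (f₂ := id) ?_)
    filter_upwards [h1] with y hy
    exact (h2 y hy).2

/-- A point `(t, 0)` of the exceptional line is the limit of the points `(t, a)` with `a ≠ 0`, which
lie over regular points. -/
lemma dense_preimage_ρ : Dense (S.ρ ⁻¹' regularLocus l) := by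
  intro y
  rcases S.cases_blow y with ⟨q, hq, rfl⟩ | ⟨e, rfl⟩
  · refine ContinuousWithinAt.mem_closure (s := π ⁻¹' regularLocus l) ?_
      (S.desing.dense_preimage q) ?_
    · exact (S.continuousOn_i₀.continuousAt (S.isOpen_ne.mem_nhds hq)).continuousWithinAt
    · intro q' hq'
      rw [mem_preimage, S.ρ_i₀ (S.ne_node_of_regular hq')]
      exact hq'
  · obtain ⟨b, t, rfl⟩ := exists_pt e
    have h0 : mk2 t 0 ∈ (S.node b).dom := (S.node b).mem_dom_of_one_eq_zero rfl
    have hc : Tendsto (fun a : ℂ => mk2 t a) (𝓝 0) (𝓝 (mk2 t 0)) :=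
      (continuous_mk2 continuous_const continuous_id).tendsto 0
    have h1 : Tendsto (fun a : ℂ => S.j b (mk2 t a)) (𝓝[≠] 0) (𝓝 (S.iE (pt b t))) := by
      have h2 := (S.continuousOn_j b).continuousAt ((S.node b).isOpen_dom.mem_nhds h0)
      have h3 : S.j b (mk2 t 0) = S.iE (pt b t) := S.j_of_eq rfl
      rw [← h3]
      exact (h2.tendsto.comp hc).mono_left nhdsWithin_le_nhds
    refine mem_closure_of_tendsto h1 ?_
    filter_upwards [nhdsWithin_le_nhds (hc ((S.node b).isOpen_dom.mem_nhds h0)),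
      self_mem_nhdsWithin] with a ha ha0
    rw [mem_preimage, S.ρ_j ha]
    exact S.proj_regular ha ha0

/-- This admits `Blow` as a competitor in the universal property of a minimal desingularisation.
Only the fibre over one node has been changed, so the other singular points need no treatment. -/
theorem isDesingularisation_ρ : IsDesingularisation S.ρ where
  hausdorff := inferInstance
  manifold := S.isManifold
  holomorphic := S.isHolomorphicToCover_ρ
  proper := S.isProperMap_ρ
  dense_preimage := S.dense_preimage_ρ
  exists_inverse := by
    refine ⟨S.i₀ ∘ S.s, ?_, ?_, ?_⟩
    · intro p hp
      obtain ⟨U, hU, hpU, G, hG, h⟩ := S.holo_s p hp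
      have hopen : IsOpen (U ∩ G ⁻¹' {q | π q ≠ N}) :=
        hG.continuousOn.isOpen_inter_preimage hU S.isOpen_ne
      refine ⟨_, hopen, ⟨hpU, ?_⟩, S.i₀ ∘ G, ?_, ?_⟩
      · rw [mem_preimage, ← h p hpU, mem_ofPred_eq, S.right_inv _ hp]
        exact S.ne_node_of_regular hp
      · intro x hx
        exact ((S.mdifferentiableAt_i₀ hx.2).comp x
          (hG.mdifferentiableAt (hU.mem_nhds hx.1))).mdifferentiableWithinAt
      · intro p' hp'
        rw [Function.comp_apply, h p' hp'.1, Function.comp_apply]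
    · intro P hP
      have h := S.right_inv P hP
      rw [Function.comp_apply, S.ρ_i₀, h]
      rw [h]
      exact S.ne_node_of_regular hP
    · intro y hy
      rcases S.cases_blow y with ⟨q, hq, rfl⟩ | ⟨e, rfl⟩
      · rw [S.ρ_i₀ hq] at hy ⊢
        rw [Function.comp_apply, S.left_inv q hy]
      · exact absurd hy S.d.node_notMem_regularLocus

/-- A minimal desingularisation is parametrised by the resolution of a node. -/
theorem exists_parametrisation (hπ : IsMinimalDesingularisation π) : ∃ φ : Bool → E2 → X,
    (∀ b, ∀ u ∈ (S.node b).dom, MDifferentiableAt 𝓘(ℂ, E2) 𝓘(ℂ, E2) (φ b) u) ∧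
    (∀ b, ∀ u ∈ (S.node b).dom, π (φ b u) = (S.node b).proj u) ∧
    (∀ b, ∀ u ∈ (S.node b).dom, u 0 ≠ 0 → φ (!b) (Node.flip u) = φ b u) ∧
    ∀ q, π q = N → ∃ b t, φ b (mk2 t 0) = q := by
  have := S.desing.hausdorff
  obtain ⟨f, hf, hπf⟩ := hπ.factors S.Blow S.ρ S.isDesingularisation_ρ
  have hπf' : ∀ y, π (f y) = S.ρ y := congrFun hπf
  -- As `π ∘ f` is proper and `X` is Hausdorff, `f` is proper. Its range is then closed and contains
  -- the dense preimage of the regular locus, so `f` is surjective.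
  have hclosed : IsClosedMap f :=
    (isProperMap_of_comp_of_t2 hf.continuous S.continuous_π
      (by rw [hπf]; exact S.isProperMap_ρ)).isClosedMap
  have hsurj : range f = univ := by
    rw [← hclosed.isClosed_range.closure_eq]
    refine Dense.mono ?_ S.desing.dense_preimage |>.closure_eq
    intro q hq
    have hqN := S.ne_node_of_regular hq
    have h1 : π (f (S.i₀ q)) = π q := by rw [hπf', S.ρ_i₀ hqN]
    refine ⟨S.i₀ q, ?_⟩
    rw [← S.left_inv (f (S.i₀ q)) (by rw [h1]; exact hq), h1, S.left_inv q hq]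
  refine ⟨fun b u => f (S.j b u), ?_, ?_, ?_, ?_⟩
  · intro b u hu
    exact (hf _).comp u (S.mdifferentiableAt_J hu)
  · intro b u hu
    rw [hπf', S.ρ_j hu]
  · intro b u hu h0
    have hv : Node.flip u ∈ (S.node (!b)).dom := by
      rw [S.node_not]; exact (S.node b).flip_mem_dom hu h0
    exact congrArg f ((S.j_eq_j_not_iff hu hv).2 ⟨h0, rfl⟩).symm
  · intro q hq
    obtain ⟨y, rfl⟩ : q ∈ range f := by rw [hsurj]; trivial
    rw [hπf'] at hq
    rcases S.cases_blow y with ⟨q', hq', rfl⟩ | ⟨e, rfl⟩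
    · rw [S.ρ_i₀ hq'] at hq
      exact absurd hq hq'
    · obtain ⟨b, t, rfl⟩ := exists_pt e
      exact ⟨b, t, congrArg f (S.j_of_eq rfl)⟩

end Setup

end Resolution

/-! ## Jacobian determinants -/

section Jacobian

open Set Filter

/-- The determinant of a linear map of the model space. -/
def det2 (T : E2 →L[ℂ] E2) : ℂ :=
  T (mk2 1 0) 0 * T (mk2 0 1) 1 - T (mk2 1 0) 1 * T (mk2 0 1) 0

lemma apply_coord (T : E2 →L[ℂ] E2) (v : E2) (i : Fin 2) :
    T v i = v 0 * T (mk2 1 0) i + v 1 * T (mk2 0 1) i := by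
  conv_lhs => rw [E2.eq_add v]
  simp

lemma det2_comp (T T' : E2 →L[ℂ] E2) : det2 (T.comp T') = det2 T * det2 T' := by
  simp only [det2, ContinuousLinearMap.comp_apply]
  rw [apply_coord T (T' (mk2 1 0)) 0, apply_coord T (T' (mk2 1 0)) 1,
    apply_coord T (T' (mk2 0 1)) 0, apply_coord T (T' (mk2 0 1)) 1]
  ring

lemma det2_ne_zero_iff {T : E2 →L[ℂ] E2} : det2 T ≠ 0 ↔ Function.Injective T := by
  constructor
  · intro h
    rw [injective_iff_map_eq_zero]
    intro v hv
    have h0 := apply_coord T v 0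
    have h1 := apply_coord T v 1
    rw [hv, PiLp.zero_apply] at h0 h1
    have e0 : det2 T * v 0 = 0 := by
      rw [det2]; linear_combination T (mk2 0 1) 0 * h1 - T (mk2 0 1) 1 * h0
    have e1 : det2 T * v 1 = 0 := by
      rw [det2]; linear_combination T (mk2 1 0) 1 * h0 - T (mk2 1 0) 0 * h1
    exact E2.ext ((mul_eq_zero.1 e0).resolve_left h) ((mul_eq_zero.1 e1).resolve_left h)
  · intro hT h
    have hs : Function.Surjective T := LinearMap.injective_iff_surjective (f := (T : E2 →ₗ[ℂ] E2)).1 hT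
    obtain ⟨u, hu⟩ := hs (mk2 1 0)
    obtain ⟨v, hv⟩ := hs (mk2 0 1)
    have h1 := apply_coord T u 0
    have h2 := apply_coord T u 1
    have h3 := apply_coord T v 0
    have h4 := apply_coord T v 1
    rw [hu] at h1 h2
    rw [hv] at h3 h4
    simp only [mk2_zero, mk2_one] at h1 h2 h3 h4
    have : (u 0 * v 1 - u 1 * v 0) * det2 T = 1 := by
      rw [det2]
      linear_combination (-(v 0 * T (mk2 1 0) 1 + v 1 * T (mk2 0 1) 1)) * h1 - h4 +
        (v 0 * T (mk2 1 0) 0 + v 1 * T (mk2 0 1) 0) * h2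
    rw [h, mul_zero] at this
    exact zero_ne_one this

/-- The Jacobian determinant. -/
def jac (ψ : E2 → E2) (u : E2) : ℂ := det2 (fderiv ℂ ψ u)

lemma jac_comp {ψ χ : E2 → E2} {u : E2} (hψ : DifferentiableAt ℂ ψ (χ u))
    (hχ : DifferentiableAt ℂ χ u) : jac (ψ ∘ χ) u = jac ψ (χ u) * jac χ u := by
  rw [jac, fderiv_comp u hψ hχ, det2_comp]; rfl

/-- By Osgood's lemma, the derivative of a holomorphic map is again holomorphic. -/
lemma differentiableOn_jac {ψ : E2 → E2} {U : Set E2} (hU : IsOpen U)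
    (hψ : DifferentiableOn ℂ ψ U) : DifferentiableOn ℂ (jac ψ) U := by
  intro u hu
  have h1 : ContDiffAt ℂ ω ψ u :=
    (contDiffOn_of_differentiableOn hψ hU).contDiffAt (hU.mem_nhds hu)
  have h2 : DifferentiableAt ℂ (fderiv ℂ ψ) u :=
    (h1.fderiv_right (m := 1) le_top).differentiableAt one_ne_zero
  have h3 : ∀ v i, DifferentiableAt ℂ (fun u => fderiv ℂ ψ u v i) u := fun v i =>
    (coordL i).differentiableAt.comp u (h2.clm_apply (differentiableAt_const v))
  exact (((h3 _ _).fun_mul (h3 _ _)).fun_sub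
    ((h3 _ _).fun_mul (h3 _ _))).differentiableWithinAt

lemma hasFDerivAt_flip {u : E2} (h : u 0 ≠ 0) : HasFDerivAt Node.flip
    ((modelEquiv.symm : ℂ × ℂ →L[ℂ] E2).comp (((-((u 0) ^ 2)⁻¹) • coordL 0).prod
      ((u 0 ^ 2) • coordL 1 + u 1 • ((2 * u 0) • coordL 0)))) u := by
  refine HasFDerivAt.mk2 ?_ ?_
  · exact (hasDerivAt_inv h).comp_hasFDerivAt u (coordL 0).hasFDerivAt
  · have h1 : HasFDerivAt (fun u : E2 => u 0 ^ 2) ((2 * u 0) • coordL 0) u := by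
      have := (hasDerivAt_pow 2 (u 0)).comp_hasFDerivAt u (coordL 0).hasFDerivAt
      exact this.congr_fderiv (by simp [coordL])
    exact h1.mul (coordL 1).hasFDerivAt

/-- Because this Jacobian is constant, the Jacobians of the parametrisation in the two charts differ
only by a sign, and so glue after a correction. -/
lemma jac_flip {u : E2} (h : u 0 ≠ 0) : jac Node.flip u = -1 := by
  rw [jac, (hasFDerivAt_flip h).fderiv]
  have h1 : ∀ v : E2, ((modelEquiv.symm : ℂ × ℂ →L[ℂ] E2).comp
      (((-((u 0) ^ 2)⁻¹) • coordL 0).prod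
      ((u 0 ^ 2) • coordL 1 + u 1 • ((2 * u 0) • coordL 0)))) v =
      mk2 ((-((u 0) ^ 2)⁻¹) * v 0) (u 0 ^ 2 * v 1 + u 1 * (2 * u 0 * v 0)) := fun v => rfl
  simp only [det2, h1, mk2_zero, mk2_one]
  field_simp
  ring

end Jacobian

/-! ## The parametrisation is immersive -/

section Immersive

open Set Filter

variable {l : Fin 6 → LinearForm} {X : Type} [TopologicalSpace X] [ChartedSpace E2 X]

namespace Setup

variable {π : X → DoubleCover l} {N : DoubleCover l}

/-- A parametrisation of a neighbourhood of the inverse image of a node by the resolution. -/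
structure IsParam (S : Setup π N) (φ : Bool → E2 → X) : Prop where
  mdifferentiableAt : ∀ b, ∀ u ∈ (S.node b).dom, MDifferentiableAt 𝓘(ℂ, E2) 𝓘(ℂ, E2) (φ b) u
  proj : ∀ b, ∀ u ∈ (S.node b).dom, π (φ b u) = (S.node b).proj u
  flip : ∀ b, ∀ u ∈ (S.node b).dom, u 0 ≠ 0 → φ (!b) (Node.flip u) = φ b u
  surj : ∀ q, π q = N → ∃ b t, φ b (mk2 t 0) = q

variable {S : Setup π N} {φ : Bool → E2 → X}

namespace IsParam

lemma eq_s (hφ : S.IsParam φ) {b : Bool} {u : E2} (hu : u ∈ (S.node b).dom) (h : u 1 ≠ 0) :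
    φ b u = S.s ((S.node b).proj u) := by
  rw [← hφ.proj b u hu, S.left_inv]
  rw [hφ.proj b u hu]
  exact S.proj_regular hu h

lemma coord (hφ : S.IsParam φ) {b : Bool} {u : E2} (hu : u ∈ (S.node b).dom) (h : u 1 ≠ 0) :
    (S.node b).coord (π (φ b u)) = u := by
  rw [hφ.proj b u hu, (S.node b).coord_proj hu h]

lemma of_coord (hφ : S.IsParam φ) {b : Bool} {q : X} (hq : π q ∈ (S.node b).nhd (S.node b).ε)
    (hA : (S.node b).A (π q) ≠ 0) : (S.node b).coord (π q) ∈ (S.node b).dom ∧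
      φ b ((S.node b).coord (π q)) = q := by
  obtain ⟨h1, h2⟩ := (S.node b).coord_mem_dom hq hA
  refine ⟨h1, ?_⟩
  rw [hφ.eq_s h1 hA, h2]
  refine S.left_inv _ ?_
  have := S.proj_regular h1 hA
  rwa [h2] at this

/-- The parametrisation is immersive outside the inverse image of the node. -/
lemma injective_mfderiv_of_ne (hφ : S.IsParam φ) {b : Bool} {u : E2} (hu : u ∈ (S.node b).dom)
    (h : u 1 ≠ 0) : Function.Injective (mfderiv 𝓘(ℂ, E2) 𝓘(ℂ, E2) (φ b) u) := by
  have h1 : π (φ b u) ∈ (S.node b).nhd (S.node b).ε := by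
    rw [hφ.proj b u hu]; exact (S.node b).proj_mem_nhd_self hu
  have h2 : (S.node b).A (π (φ b u)) ≠ 0 := by
    rwa [hφ.proj b u hu, (S.node b).A_proj hu]
  have h3 := (S.mdifferentiableAt_coord h1 h2).hasMFDerivAt.comp u
    (hφ.mdifferentiableAt b u hu).hasMFDerivAt
  -- Off the line, `coord ∘ π` is a holomorphic left inverse of the parametrisation.
  have h4 : HasMFDerivAt 𝓘(ℂ, E2) 𝓘(ℂ, E2)
      ((fun q => (S.node b).coord (π q)) ∘ φ b) u (ContinuousLinearMap.id ℂ E2) := by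
    refine (hasMFDerivAt_id u).congr_of_eventuallyEq ?_
    filter_upwards [(S.node b).isOpen_dom.mem_nhds hu,
      (continuous_coord 1).continuousAt.eventually_ne h] with v hv hv1
    exact hφ.coord hv hv1
  have h5 := hasMFDerivAt_unique h3 h4
  intro v w hvw
  have h6 : ∀ v : E2, (mfderiv 𝓘(ℂ, E2) 𝓘(ℂ, E2) (fun q => (S.node b).coord (π q)) (φ b u))
      (mfderiv 𝓘(ℂ, E2) 𝓘(ℂ, E2) (φ b) u v) = v := fun v => congrArg (fun T => T v) h5
  rw [← h6 v, ← h6 w]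
  exact congrArg _ hvw

/-- The set where the expression of the parametrisation in a chart is defined. -/
def chartDom (S : Setup π N) (φ : Bool → E2 → X) (e : OpenPartialHomeomorph X E2) (b : Bool) :
    Set E2 := (S.node b).dom ∩ φ b ⁻¹' e.source

lemma isOpen_chartDom (hφ : S.IsParam φ) (e : OpenPartialHomeomorph X E2) (b : Bool) :
    IsOpen (chartDom S φ e b) := by
  have hc : ContinuousOn (φ b) (S.node b).dom := fun u hu =>
    (hφ.mdifferentiableAt b u hu).continuousAt.continuousWithinAt
  exact hc.isOpen_inter_preimage (S.node b).isOpen_dom e.open_source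

lemma differentiableOn_chart (hφ : S.IsParam φ) {e : OpenPartialHomeomorph X E2}
    (he : e ∈ atlas E2 X) (b : Bool) : DifferentiableOn ℂ (e ∘ φ b) (chartDom S φ e b) :=
  fun u hu => (S.differentiableAt_of_chart he (hφ.mdifferentiableAt b u hu.1)
    hu.2).differentiableWithinAt

lemma differentiableOn_jac_chart (hφ : S.IsParam φ) {e : OpenPartialHomeomorph X E2}
    (he : e ∈ atlas E2 X) (b : Bool) : DifferentiableOn ℂ (jac (e ∘ φ b)) (chartDom S φ e b) :=
  differentiableOn_jac (hφ.isOpen_chartDom e b) (hφ.differentiableOn_chart he b)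

/-- The differential of a chart is invertible, so vanishing of the Jacobian does not depend on the
chart of `X`. -/
lemma jac_ne_zero_iff (hφ : S.IsParam φ) {e : OpenPartialHomeomorph X E2}
    (he : e ∈ atlas E2 X) {b : Bool} {u : E2} (hu : u ∈ chartDom S φ e b) :
    jac (e ∘ φ b) u ≠ 0 ↔ Function.Injective (mfderiv 𝓘(ℂ, E2) 𝓘(ℂ, E2) (φ b) u) := by
  have := S.desing.manifold
  have : IsManifold 𝓘(ℂ, E2) 1 X := IsManifold.of_le (n := ω) le_top
  rw [jac, det2_ne_zero_iff, ← mfderiv_eq_fderiv]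
  have hd := hφ.mdifferentiableAt b u hu.1
  have hed : MDifferentiableAt 𝓘(ℂ, E2) 𝓘(ℂ, E2) e (φ b u) := mdifferentiableAt_atlas he hu.2
  constructor
  · intro h
    rw [mfderiv_comp u hed hd] at h
    exact Function.Injective.of_comp (f := mfderiv 𝓘(ℂ, E2) 𝓘(ℂ, E2) e (φ b u)) h
  · intro h
    have h1 : MDifferentiableAt 𝓘(ℂ, E2) 𝓘(ℂ, E2) e.symm (e (φ b u)) :=
      mdifferentiableAt_atlas_symm he (e.map_source hu.2)
    have h2 : (e.symm ∘ (e ∘ φ b)) =ᶠ[𝓝 u] φ b := by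
      filter_upwards [(hφ.isOpen_chartDom e b).mem_nhds hu] with v hv
      exact e.left_inv hv.2
    have h3 := h2.mfderiv_eq (I := 𝓘(ℂ, E2)) (I' := 𝓘(ℂ, E2))
    rw [← h3, mfderiv_comp u h1 (hed.comp u hd)] at h
    exact Function.Injective.of_comp
      (f := mfderiv 𝓘(ℂ, E2) 𝓘(ℂ, E2) e.symm ((e ∘ φ b) u)) h

end IsParam

end Setup

end Immersive

/-! ### Degeneracy spreads along the exceptional line -/

section ImmersiveOnLine

open Set Filter

/-- A neighbourhood of a disc in the exceptional line contains a polydisc. -/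
lemma exists_polydisc_subset {O : Set E2} (hO : IsOpen O)
    (h : ∀ t : ℂ, ‖t‖ ≤ 1 → mk2 t 0 ∈ O) :
    ∃ δ : ℝ, 0 < δ ∧ ∀ u : E2, ‖u 0‖ ≤ 1 → ‖u 1‖ < δ → u ∈ O := by
  have hc : Continuous fun p : ℂ × ℂ => mk2 p.1 p.2 :=
    continuous_mk2 continuous_fst continuous_snd
  obtain ⟨V, W, -, hW, hV', hW', hVW⟩ := generalized_tube_lemma
    (isCompact_closedBall (0 : ℂ) 1) (isCompact_singleton (x := (0 : ℂ))) (hO.preimage hc) (by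
      rintro ⟨a, b⟩ ⟨ha, hb⟩
      obtain rfl : b = 0 := hb
      exact h a (mem_closedBall_zero_iff.1 ha))
  obtain ⟨δ, hδ, hball⟩ := Metric.isOpen_iff.1 hW 0 (hW' rfl)
  refine ⟨δ, hδ, fun u h0 h1 => ?_⟩
  have := hVW (mk_mem_prod (hV' (mem_closedBall_zero_iff.2 h0))
    (hball (mem_ball_zero_iff.2 h1)))
  rwa [mem_preimage, mk2_eta] at this

variable {l : Fin 6 → LinearForm} {X : Type} [TopologicalSpace X] [ChartedSpace E2 X]

namespace Setup

variable {π : X → DoubleCover l} {N : DoubleCover l} {S : Setup π N} {φ : Bool → E2 → X}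

namespace IsParam

lemma line_mem (S : Setup π N) (b : Bool) (t : ℂ) : mk2 t 0 ∈ (S.node b).dom :=
  (S.node b).mem_dom_of_one_eq_zero rfl

lemma continuous_line : Continuous fun t : ℂ => mk2 t 0 :=
  continuous_mk2 continuous_id continuous_const

lemma eventually_mem_chartDom (hφ : S.IsParam φ) {e : OpenPartialHomeomorph X E2} {b : Bool}
    {t : ℂ} (h : φ b (mk2 t 0) ∈ e.source) : ∀ᶠ t' in 𝓝 t, mk2 t' 0 ∈ chartDom S φ e b :=
  continuous_line.continuousAt.preimage_mem_nhds
    ((hφ.isOpen_chartDom e b).mem_nhds ⟨line_mem S b t, h⟩)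

/-- The Jacobian has no zeros off the line, so `eventually_zero_on_line` applies to it. -/
lemma eventually_not_injective (hφ : S.IsParam φ) {b : Bool} {t : ℂ}
    (h : ¬ Function.Injective (mfderiv 𝓘(ℂ, E2) 𝓘(ℂ, E2) (φ b) (mk2 t 0))) :
    ∀ᶠ t' in 𝓝 t, ¬ Function.Injective (mfderiv 𝓘(ℂ, E2) 𝓘(ℂ, E2) (φ b) (mk2 t' 0)) := by
  set e := chartAt E2 (φ b (mk2 t 0))
  have he : e ∈ atlas E2 X := chart_mem_atlas _ _
  have hs : φ b (mk2 t 0) ∈ e.source := mem_chart_source _ _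
  have h1 : mk2 t 0 ∈ chartDom S φ e b := ⟨line_mem S b t, hs⟩
  filter_upwards [hφ.eventually_mem_chartDom hs,
    eventually_zero_on_line (hφ.isOpen_chartDom e b) h1 (hφ.differentiableOn_jac_chart he b)
      (fun u hu hu1 => (hφ.jac_ne_zero_iff he hu).2 (hφ.injective_mfderiv_of_ne hu.1 hu1))
      (not_not.1 (mt (hφ.jac_ne_zero_iff he h1).1 h))] with t' ht' h0
  exact fun hinj => (hφ.jac_ne_zero_iff he ht').2 hinj h0

lemma eventually_injective (hφ : S.IsParam φ) {b : Bool} {t : ℂ}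
    (h : Function.Injective (mfderiv 𝓘(ℂ, E2) 𝓘(ℂ, E2) (φ b) (mk2 t 0))) :
    ∀ᶠ t' in 𝓝 t, Function.Injective (mfderiv 𝓘(ℂ, E2) 𝓘(ℂ, E2) (φ b) (mk2 t' 0)) := by
  set e := chartAt E2 (φ b (mk2 t 0))
  have he : e ∈ atlas E2 X := chart_mem_atlas _ _
  have hs : φ b (mk2 t 0) ∈ e.source := mem_chart_source _ _
  have h1 : mk2 t 0 ∈ chartDom S φ e b := ⟨line_mem S b t, hs⟩
  have hc : ContinuousAt (jac (e ∘ φ b)) (mk2 t 0) :=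
    ((hφ.differentiableOn_jac_chart he b).differentiableAt
      ((hφ.isOpen_chartDom e b).mem_nhds h1)).continuousAt
  have hc' := hc.comp (f := fun t : ℂ => mk2 t 0) continuous_line.continuousAt
  filter_upwards [hφ.eventually_mem_chartDom hs,
    hc'.eventually_ne ((hφ.jac_ne_zero_iff he h1).2 h)] with t' ht' h0
  exact (hφ.jac_ne_zero_iff he ht').1 h0

/-- The degenerate points form an open and closed subset of the connected line `ℂ`. -/
lemma not_injective_of_not_injective (hφ : S.IsParam φ) {b : Bool} {t : ℂ}
    (h : ¬ Function.Injective (mfderiv 𝓘(ℂ, E2) 𝓘(ℂ, E2) (φ b) (mk2 t 0))) (t' : ℂ) :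
    ¬ Function.Injective (mfderiv 𝓘(ℂ, E2) 𝓘(ℂ, E2) (φ b) (mk2 t' 0)) := by
  set D : Set ℂ := {t | ¬ Function.Injective (mfderiv 𝓘(ℂ, E2) 𝓘(ℂ, E2) (φ b) (mk2 t 0))}
  have h1 : IsOpen D := isOpen_iff_mem_nhds.2 fun t ht => hφ.eventually_not_injective ht
  have h2 : IsOpen Dᶜ := isOpen_iff_mem_nhds.2 fun t ht => by
    filter_upwards [hφ.eventually_injective (not_not.1 ht)] with t' ht'
    exact not_not.2 ht'
  have h3 : D = univ := IsClopen.eq_univ ⟨isOpen_compl_iff.1 h2, h1⟩ ⟨t, h⟩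
  exact (Set.ext_iff.1 h3 t').2 (mem_univ t')

lemma eventuallyEq_flip (hφ : S.IsParam φ) {b : Bool} {u : E2} (hu : u ∈ (S.node b).dom)
    (h : u 0 ≠ 0) : φ (!b) ∘ Node.flip =ᶠ[𝓝 u] φ b := by
  filter_upwards [(S.node b).isOpen_dom.mem_nhds hu,
    (continuous_coord 0).continuousAt.eventually_ne h] with v hv hv0
  exact hφ.flip b v hv hv0

lemma flip_mem_dom (S : Setup π N) {b : Bool} {u : E2} (hu : u ∈ (S.node b).dom) (h : u 0 ≠ 0) :
    Node.flip u ∈ (S.node (!b)).dom := by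
  rw [S.node_not]
  exact (S.node b).flip_mem_dom hu h

lemma injective_of_injective_flip (hφ : S.IsParam φ) {b : Bool} {u : E2}
    (hu : u ∈ (S.node b).dom) (h : u 0 ≠ 0)
    (hinj : Function.Injective (mfderiv 𝓘(ℂ, E2) 𝓘(ℂ, E2) (φ (!b)) (Node.flip u))) :
    Function.Injective (mfderiv 𝓘(ℂ, E2) 𝓘(ℂ, E2) (φ b) u) := by
  have h1 := hφ.mdifferentiableAt (!b) _ (flip_mem_dom S hu h)
  have h2 := (Node.differentiableAt_flip h).mdifferentiableAt
  rw [← (hφ.eventuallyEq_flip hu h).mfderiv_eq, mfderiv_comp u h1 h2, mfderiv_eq_fderiv]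
  have h3 : Function.Injective (fderiv ℂ Node.flip u) := by
    rw [← det2_ne_zero_iff]
    change jac Node.flip u ≠ 0
    rw [jac_flip h]
    simp
  exact hinj.comp h3

lemma flip_line {t : ℂ} : Node.flip (mk2 t 0) = mk2 t⁻¹ 0 := by
  simp [Node.flip]

/-- The two affine lines meet at the point `t = 1`, which is fixed by `t ↦ t⁻¹`, so degeneracy
passes from one chart to the other. -/
lemma not_injective_all (hφ : S.IsParam φ) {b : Bool} {t : ℂ}
    (h : ¬ Function.Injective (mfderiv 𝓘(ℂ, E2) 𝓘(ℂ, E2) (φ b) (mk2 t 0))) (b' : Bool) (t' : ℂ) :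
    ¬ Function.Injective (mfderiv 𝓘(ℂ, E2) 𝓘(ℂ, E2) (φ b') (mk2 t' 0)) := by
  have h1 := hφ.not_injective_of_not_injective h
  have h2 : ¬ Function.Injective (mfderiv 𝓘(ℂ, E2) 𝓘(ℂ, E2) (φ (!b)) (mk2 1 0)) := by
    intro h2
    refine h1 1 (hφ.injective_of_injective_flip (line_mem S b 1) one_ne_zero ?_)
    rwa [flip_line, inv_one]
  by_cases hb : b' = b
  · exact hb ▸ h1 t'
  · obtain rfl : b' = !b := by cases b <;> cases b' <;> simp_all
    exact hφ.not_injective_of_not_injective h2 t'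

/-- If the parametrisation is not immersive, it contracts the exceptional line. -/
lemma eventually_const (hφ : S.IsParam φ) {b : Bool}
    (h : ∀ t, ¬ Function.Injective (mfderiv 𝓘(ℂ, E2) 𝓘(ℂ, E2) (φ b) (mk2 t 0))) (t : ℂ) :
    ∀ᶠ t' in 𝓝 t, φ b (mk2 t' 0) = φ b (mk2 t 0) := by
  set e := chartAt E2 (φ b (mk2 t 0))
  have he : e ∈ atlas E2 X := chart_mem_atlas _ _
  have hs : φ b (mk2 t 0) ∈ e.source := mem_chart_source _ _
  obtain ⟨δ, hδ, hball⟩ := Metric.eventually_nhds_iff_ball.1 (hφ.eventually_mem_chartDom hs)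
  have hU := hφ.isOpen_chartDom e b
  have hψ := hφ.differentiableOn_chart he b
  -- Off the line the point `u` is recovered by `coord ∘ π`.
  have hinj : InjOn (e ∘ φ b) (chartDom S φ e b ∩ {u | u 1 ≠ 0}) := by
    intro u hu v hv huv
    have h1 : φ b u = φ b v := e.injOn hu.1.2 hv.1.2 huv
    rw [← hφ.coord hu.1.1 hu.2, ← hφ.coord hv.1.1 hv.2, h1]
  have hderiv : ∀ t' ∈ Metric.ball t δ,
      HasDerivAt (fun t : ℂ => e (φ b (mk2 t 0))) 0 t' := by
    intro t' ht'
    have hmem := hball t' ht'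
    have h1 := (hψ.differentiableAt (hU.mem_nhds hmem)).hasFDerivAt
    have h2 : HasDerivAt (fun t : ℂ => mk2 t 0) (mk2 1 0) t' := by
      have := HasFDerivAt.mk2 (hasFDerivAt_id (𝕜 := ℂ) t') (hasFDerivAt_const (0 : ℂ) t')
      exact this.hasDerivAt
    have h3 := h1.comp_hasDerivAt t' h2
    rwa [fderiv_line_eq_zero hU hmem rfl hψ hinj] at h3
    intro h4
    refine h t' ((hφ.jac_ne_zero_iff he hmem).1 ?_)
    rwa [jac, det2_ne_zero_iff]
  filter_upwards [Metric.ball_mem_nhds t hδ] with t' ht'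
  refine e.injOn (hball t' ht').2 hs ?_
  exact Metric.isOpen_ball.is_const_of_deriv_eq_zero (convex_ball t δ).isPreconnected
    (fun t' ht' => (hderiv t' ht').differentiableAt.differentiableWithinAt)
    (fun t' ht' => (hderiv t' ht').deriv) ht' (Metric.mem_ball_self hδ)

/-- A locally constant function on `ℂ` is constant, and the two constants agree at the common point
`1`. -/
lemma eq_of_not_injective (hφ : S.IsParam φ)
    (h : ∀ b t, ¬ Function.Injective (mfderiv 𝓘(ℂ, E2) 𝓘(ℂ, E2) (φ b) (mk2 t 0))) (b : Bool)
    (t : ℂ) : φ b (mk2 t 0) = φ true (mk2 1 0) := by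
  have h1 : ∀ b, φ b (mk2 t 0) = φ b (mk2 1 0) := fun b =>
    ((IsLocallyConstant.iff_eventually_eq fun t => φ b (mk2 t 0)).2
      (hφ.eventually_const (h b))).apply_eq_of_preconnectedSpace t 1
  rw [h1]
  cases b
  · have := hφ.flip true (mk2 1 0) (line_mem S _ _) one_ne_zero
    rwa [flip_line, inv_one] at this
  · rfl

end IsParam

end Setup

end ImmersiveOnLine

/-! ### The exceptional line is not contracted -/

section Immersion

open Set Filter

variable {l : Fin 6 → LinearForm} {X : Type} [TopologicalSpace X] [ChartedSpace E2 X]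

namespace Setup

variable {π : X → DoubleCover l} {N : DoubleCover l} {S : Setup π N} {φ : Bool → E2 → X}

namespace IsParam

lemma coord_not (S : Setup π N) {b : Bool} {P : DoubleCover l}
    (hP : P ∈ (S.node b).nhd (S.node b).ε)
    (hA : (S.node b).A P ≠ 0) (hA' : (S.node (!b)).A P ≠ 0) :
    (S.node b).coord P 0 ≠ 0 ∧ (S.node (!b)).coord P = Node.flip ((S.node b).coord P) := by
  have hP' : P ∈ (S.node (!b)).nhd (S.node (!b)).ε := by
    rwa [S.node_nhd, S.node_ε, ← S.node_nhd b, ← S.node_ε b]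
  obtain ⟨h1, h2⟩ := (S.node b).coord_mem_dom hP hA
  obtain ⟨h3, h4⟩ := (S.node (!b)).coord_mem_dom hP' hA'
  have h5 := S.node_not b
  generalize S.node (!b) = d' at *
  subst h5
  exact (S.node b).proj_eq_proj_swap h1 h3 hA (h2.trans h4.symm)

/-- The Jacobian determinants of the two parts of the parametrisation agree up to sign. -/
lemma jac_coord_not (hφ : S.IsParam φ) {e : OpenPartialHomeomorph X E2} (he : e ∈ atlas E2 X)
    {b : Bool} {q : X} (hqe : q ∈ e.source) (hq : π q ∈ (S.node b).nhd (S.node b).ε)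
    (hA : (S.node b).A (π q) ≠ 0) (hA' : (S.node (!b)).A (π q) ≠ 0) :
    jac (e ∘ φ b) ((S.node b).coord (π q)) =
      - jac (e ∘ φ (!b)) ((S.node (!b)).coord (π q)) := by
  obtain ⟨h0, h1⟩ := coord_not S hq hA hA'
  obtain ⟨hu, hu'⟩ := hφ.of_coord hq hA
  rw [h1]
  set u := (S.node b).coord (π q)
  have h2 : (e ∘ φ (!b)) ∘ Node.flip =ᶠ[𝓝 u] e ∘ φ b :=
    (hφ.eventuallyEq_flip hu h0).fun_comp e
  have h3 : Node.flip u ∈ chartDom S φ e (!b) :=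
    ⟨flip_mem_dom S hu h0, by rw [mem_preimage, hφ.flip b u hu h0, hu']; exact hqe⟩
  have h4 := (hφ.differentiableOn_chart he (!b)).differentiableAt
    ((hφ.isOpen_chartDom e (!b)).mem_nhds h3)
  have h5 : jac (e ∘ φ b) u = jac ((e ∘ φ (!b)) ∘ Node.flip) u := by
    rw [jac, jac, h2.fderiv_eq]
  rw [h5, jac_comp h4 (Node.differentiableAt_flip h0), jac_flip h0, mul_neg_one]

/-- The Jacobian determinant of the parametrisation, as a function on a chart. -/
def jacOn (S : Setup π N) (φ : Bool → E2 → X) (e : OpenPartialHomeomorph X E2) (v : E2) : ℂ :=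
  open Classical in
  if (S.node true).A (π (e.symm v)) ≠ 0 then
    jac (e ∘ φ true) ((S.node true).coord (π (e.symm v)))
  else - jac (e ∘ φ false) ((S.node false).coord (π (e.symm v)))

/-- The sign attached to the second chart compensates for `jac_flip`. Locally, the function may
therefore be computed in whichever chart is convenient. -/
lemma jacOn_eq (hφ : S.IsParam φ) {e : OpenPartialHomeomorph X E2} (he : e ∈ atlas E2 X)
    {v : E2} (hv : v ∈ e.target) (h : π (e.symm v) ∈ S.d.nhd S.d.ε) {b : Bool}
    (hA : (S.node b).A (π (e.symm v)) ≠ 0) :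
    jacOn S φ e v = (if b then 1 else -1) * jac (e ∘ φ b) ((S.node b).coord (π (e.symm v))) := by
  cases b
  · by_cases hA' : (S.node true).A (π (e.symm v)) ≠ 0
    · rw [jacOn, if_pos hA']
      have := hφ.jac_coord_not he (b := true) (e.map_target hv) h hA' hA
      simpa using this
    · rw [jacOn, if_neg hA']
      simp
  · rw [jacOn, if_pos hA]
    simp

/-- If the parametrisation degenerates somewhere, it contracts the whole line to a point `x`, which
is then the entire fibre over the node. The Jacobian becomes a function on a punctured neighbourhood
of `x`, holomorphic and without zeros, but tending to zero at `x`. This contradicts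
`no_isolated_zero`. -/
lemma injective_mfderiv_line (hφ : S.IsParam φ) (b : Bool) (t : ℂ) :
    Function.Injective (mfderiv 𝓘(ℂ, E2) 𝓘(ℂ, E2) (φ b) (mk2 t 0)) := by
  by_contra hdeg
  have hdeg := hφ.not_injective_all hdeg
  have hconst := hφ.eq_of_not_injective hdeg
  set x := φ true (mk2 1 0)
  set e := chartAt E2 x
  have he : e ∈ atlas E2 X := chart_mem_atlas _ _
  have hxe : x ∈ e.source := mem_chart_source _ _
  have hx : ∀ q, π q = N → q = x := by
    intro q hq
    obtain ⟨b, t, rfl⟩ := hφ.surj q hq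
    exact hconst b t
  have hπx : π x = N := by
    have := hφ.proj true (mk2 1 0) (line_mem S _ _)
    rw [((S.node true).proj_eq_node_iff (line_mem S _ _)).2 rfl] at this
    exact this
  have hcont : ContinuousAt (π ∘ e.symm) (e x) :=
    S.continuous_π.continuousAt.comp (e.continuousAt_symm (e.map_source hxe))
  have hval : (π ∘ e.symm) (e x) = N := by rw [Function.comp_apply, e.left_inv hxe, hπx]
  have hnhd : ∀ δ, 0 < δ → ∀ᶠ v in 𝓝 (e x), π (e.symm v) ∈ S.d.nhd δ := by
    intro δ hδ
    refine hcont.eventually_mem ?_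
    rw [hval]
    exact (S.d.isOpen_nhd δ).mem_nhds (S.d.node_mem_nhd hδ)
  have hne : ∀ v ∈ e.target, v ≠ e x → π (e.symm v) ≠ N := by
    intro v hv hvx h
    refine hvx ?_
    rw [← hx _ h, e.right_inv hv]
  have hspec : ∀ v ∈ e.target, π (e.symm v) ∈ S.d.nhd S.d.ε → ∀ b,
      (S.node b).A (π (e.symm v)) ≠ 0 →
      (S.node b).coord (π (e.symm v)) ∈ chartDom S φ e b := by
    intro v hv h b hA
    have h' : π (e.symm v) ∈ (S.node b).nhd (S.node b).ε := by rwa [S.node_nhd, S.node_ε]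
    obtain ⟨h1, h2⟩ := hφ.of_coord h' hA
    exact ⟨h1, by rw [mem_preimage, h2]; exact e.map_target hv⟩
  have hU : e.target ∩ {v | π (e.symm v) ∈ S.d.nhd S.d.ε} ∈ 𝓝 (e x) :=
    inter_mem (e.open_target.mem_nhds (e.map_source hxe)) (hnhd _ S.d.ε_pos)
  refine no_isolated_zero (r := jacOn S φ e) hU ?_ ?_ ?_
  · rintro v ⟨hv, h⟩ hvx
    obtain ⟨b, hA, -⟩ := S.exists_coord_le_one h (hne v hv hvx)
    have hmem := hspec v hv h b hA
    have h' : π (e.symm v) ∈ (S.node b).nhd (S.node b).ε := by rwa [S.node_nhd, S.node_ε]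
    have hP : HolAt (π ∘ e.symm) v :=
      (S.desing.holomorphic.holAt _).comp (S.mdifferentiableAt_chart_symm he hv)
    have h1 : MDifferentiableAt 𝓘(ℂ, E2) 𝓘(ℂ, E2)
        (fun v => (S.node b).coord ((π ∘ e.symm) v)) v :=
      (S.node b).mdifferentiableAt_coord hP h' hA
    have h2 := ((hφ.differentiableOn_jac_chart he b).differentiableAt
      ((hφ.isOpen_chartDom e b).mem_nhds hmem)).comp v h1.differentiableAt
    have hAc : ContinuousAt (fun v => (S.node b).A (π (e.symm v))) v :=
      ((S.node b).mdifferentiableAt_A hP h').continuousAt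
    refine (h2.const_mul (if b then 1 else -1)).congr_of_eventuallyEq ?_
    filter_upwards [hAc.eventually_ne hA, e.open_target.mem_nhds hv,
      hP.continuousAt.eventually_mem ((S.d.isOpen_nhd _).mem_nhds h)] with v' h3 h4 h5
    exact hφ.jacOn_eq he h4 h5 h3
  · rintro v ⟨hv, h⟩ hvx
    obtain ⟨b, hA, -⟩ := S.exists_coord_le_one h (hne v hv hvx)
    rw [hφ.jacOn_eq he hv h hA]
    refine mul_ne_zero (by cases b <;> simp) ?_
    have hmem := hspec v hv h b hA
    exact (hφ.jac_ne_zero_iff he hmem).2 (hφ.injective_mfderiv_of_ne hmem.1 hA)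
  -- The Jacobian vanishes on the line, hence is small on a polydisc around the compact disc `‖u 0‖
  -- ≤ 1`. Near `x` the coordinate `A` is small, and `exists_coord_le_one` places the point in such
  -- a polydisc.
  · rw [Metric.tendsto_nhds]
    intro η hη
    have hline : ∀ b t, mk2 t 0 ∈ chartDom S φ e b := fun b t =>
      ⟨line_mem S b t, by rw [mem_preimage, hconst b t]; exact hxe⟩
    have hO : ∀ b, ∃ δ : ℝ, 0 < δ ∧ ∀ u : E2, ‖u 0‖ ≤ 1 → ‖u 1‖ < δ →
        u ∈ chartDom S φ e b ∩ (jac (e ∘ φ b)) ⁻¹' Metric.ball 0 η := by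
      intro b
      refine exists_polydisc_subset ((hφ.differentiableOn_jac_chart he b).continuousOn
        |>.isOpen_inter_preimage (hφ.isOpen_chartDom e b) Metric.isOpen_ball) fun t _ => ?_
      refine ⟨hline b t, ?_⟩
      have : jac (e ∘ φ b) (mk2 t 0) = 0 := by
        by_contra h
        exact hdeg b t ((hφ.jac_ne_zero_iff he (hline b t)).1 h)
      rw [mem_preimage, this]
      exact Metric.mem_ball_self hη
    choose δ hδ hδ' using hO
    have hδ₀ : 0 < min (δ true) (δ false) := lt_min (hδ _) (hδ _)
    have hδb : ∀ b, min (δ true) (δ false) ≤ δ b := by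
      intro b; cases b
      · exact min_le_right _ _
      · exact min_le_left _ _
    filter_upwards [self_mem_nhdsWithin, mem_nhdsWithin_of_mem_nhds (hnhd _ hδ₀),
      mem_nhdsWithin_of_mem_nhds hU] with v hvx h1 hv
    obtain ⟨b, hA, hb⟩ := S.exists_coord_le_one hv.2 (hne v hv.1 hvx)
    have h' : π (e.symm v) ∈ (S.node b).nhd (S.node b).ε := by
      rw [S.node_nhd, S.node_ε]; exact hv.2
    have h2 : ‖(S.node b).A (π (e.symm v))‖ < min (δ true) (δ false) := by
      refine (((S.node b).norm_lt h').1 ?_).1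
      rw [S.node_nhd]
      exact h1
    have h3 := (hδ' b _ hb (h2.trans_le (hδb b))).2
    rw [hφ.jacOn_eq he hv.1 hv.2 hA, dist_zero_right, norm_mul]
    rw [mem_preimage, mem_ball_zero_iff] at h3
    cases b <;> simpa using h3

/-- The parametrisation of a minimal desingularisation near a node is immersive. -/
theorem injective_mfderiv (hφ : S.IsParam φ) {b : Bool} {u : E2} (hu : u ∈ (S.node b).dom) :
    Function.Injective (mfderiv 𝓘(ℂ, E2) 𝓘(ℂ, E2) (φ b) u) := by
  by_cases h : u 1 = 0
  · rw [← mk2_eta u, h]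
    exact hφ.injective_mfderiv_line b (u 0)
  · exact hφ.injective_mfderiv_of_ne hu h

end IsParam

end Setup

end Immersion

/-! ## Two-forms given locally by `u dα ∧ dβ` -/

section Forms

open Set Filter

lemma wedge_eq_smul (α β : E2 →L[ℂ] ℂ) : wedge α β =
    (α (mk2 1 0) * β (mk2 0 1) - α (mk2 0 1) * β (mk2 1 0)) • wedge (coordL 0) (coordL 1) := by
  ext v
  have h : ∀ (γ : E2 →L[ℂ] ℂ) (w : E2), γ w = w 0 * γ (mk2 1 0) + w 1 * γ (mk2 0 1) := by
    intro γ w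
    conv_lhs => rw [E2.eq_add w]
    simp
  change α (v 0) * β (v 1) - α (v 1) * β (v 0) =
    (α (mk2 1 0) * β (mk2 0 1) - α (mk2 0 1) * β (mk2 1 0)) * (v 0 0 * v 1 1 - v 1 0 * v 0 1)
  rw [h α (v 0), h α (v 1), h β (v 0), h β (v 1)]
  ring

lemma wedge_ne_zero {α β : E2 →L[ℂ] ℂ} (h : ∀ v, α v = 0 → β v = 0 → v = 0) :
    wedge α β ≠ 0 := by
  intro h0
  set T : E2 →L[ℂ] E2 := (modelEquiv.symm : ℂ × ℂ →L[ℂ] E2).comp (α.prod β)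
  have hT : ∀ v, T v = mk2 (α v) (β v) := fun v => rfl
  have hinj : Function.Injective T := by
    rw [injective_iff_map_eq_zero]
    intro v hv
    rw [hT, ← mk2_eta (0 : E2), mk2_eq_iff] at hv
    exact h v hv.1 hv.2
  refine det2_ne_zero_iff.2 hinj ?_
  have := congrArg (fun θ : E2 [⋀^Fin 2]→L[ℂ] ℂ => θ ![mk2 1 0, mk2 0 1]) h0
  change α (mk2 1 0) * β (mk2 0 1) - α (mk2 0 1) * β (mk2 1 0) = 0 at this
  simp only [det2, hT, mk2_zero, mk2_one]
  linear_combination this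

variable {X : Type} [TopologicalSpace X] [ChartedSpace E2 X]

/-- A two-form that is given near every point of `V` by the same expression `u dα ∧ dβ`. -/
def localForm (u α β : X → ℂ) : TwoForm X := fun q =>
  u q • wedge (mfderiv 𝓘(ℂ, E2) 𝓘(ℂ, ℂ) α q) (mfderiv 𝓘(ℂ, E2) 𝓘(ℂ, ℂ) β q)

lemma differentiableAt_comp_symm [IsManifold 𝓘(ℂ, E2) 1 X] {e : OpenPartialHomeomorph X E2}
    (he : e ∈ atlas E2 X) {f : X → ℂ} {v : E2} (hv : v ∈ e.target)
    (hf : MDifferentiableAt 𝓘(ℂ, E2) 𝓘(ℂ, ℂ) f (e.symm v)) :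
    DifferentiableAt ℂ (f ∘ e.symm) v :=
  (hf.comp v (mdifferentiableAt_atlas_symm he hv)).differentiableAt

lemma inChart_localForm [IsManifold 𝓘(ℂ, E2) 1 X] {e : OpenPartialHomeomorph X E2}
    (he : e ∈ atlas E2 X) {u α β : X → ℂ} {v : E2} (hv : v ∈ e.target)
    (hα : MDifferentiableAt 𝓘(ℂ, E2) 𝓘(ℂ, ℂ) α (e.symm v))
    (hβ : MDifferentiableAt 𝓘(ℂ, E2) 𝓘(ℂ, ℂ) β (e.symm v)) :
    (localForm u α β).inChart e v =
      u (e.symm v) • wedge (fderiv ℂ (α ∘ e.symm) v) (fderiv ℂ (β ∘ e.symm) v) := by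
  have h := mdifferentiableAt_atlas_symm (I := 𝓘(ℂ, E2)) he hv
  rw [← mfderiv_eq_fderiv, ← mfderiv_eq_fderiv, mfderiv_comp v hα h, mfderiv_comp v hβ h]
  rfl

/-- Alternating forms on the model space are multiples of one form. The coefficient is a polynomial
in `u` and first derivatives, which are holomorphic because holomorphic functions are analytic. -/
lemma differentiableOn_inChart_localForm [IsManifold 𝓘(ℂ, E2) 1 X]
    {e : OpenPartialHomeomorph X E2} (he : e ∈ atlas E2 X) {u α β : X → ℂ} {V : Set X}
    (hV : IsOpen V) (hu : ∀ y ∈ V, MDifferentiableAt 𝓘(ℂ, E2) 𝓘(ℂ, ℂ) u y)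
    (hα : ∀ y ∈ V, MDifferentiableAt 𝓘(ℂ, E2) 𝓘(ℂ, ℂ) α y)
    (hβ : ∀ y ∈ V, MDifferentiableAt 𝓘(ℂ, E2) 𝓘(ℂ, ℂ) β y) :
    DifferentiableOn ℂ ((localForm u α β).inChart e) (e.target ∩ e.symm ⁻¹' V) := by
  have hO : IsOpen (e.target ∩ e.symm ⁻¹' V) := e.isOpen_inter_preimage_symm hV
  have key : ∀ γ : X → ℂ, (∀ y ∈ V, MDifferentiableAt 𝓘(ℂ, E2) 𝓘(ℂ, ℂ) γ y) → ∀ w : E2,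
      DifferentiableOn ℂ (fun v => fderiv ℂ (γ ∘ e.symm) v w) (e.target ∩ e.symm ⁻¹' V) := by
    intro γ hγ w v hv
    have h1 : AnalyticAt ℂ (γ ∘ e.symm) v := analyticAt_of_differentiableOn
      (fun v' hv' => (differentiableAt_comp_symm he hv'.1
        (hγ _ hv'.2)).differentiableWithinAt) hO hv
    exact (h1.fderiv.differentiableAt.clm_apply (differentiableAt_const w)).differentiableWithinAt
  have h : DifferentiableOn ℂ (fun v => (u (e.symm v) * (
      fderiv ℂ (α ∘ e.symm) v (mk2 1 0) * fderiv ℂ (β ∘ e.symm) v (mk2 0 1) -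
      fderiv ℂ (α ∘ e.symm) v (mk2 0 1) * fderiv ℂ (β ∘ e.symm) v (mk2 1 0))) •
      wedge (coordL 0) (coordL 1)) (e.target ∩ e.symm ⁻¹' V) := by
    refine DifferentiableOn.smul_const (DifferentiableOn.mul ?_ (((key α hα _).mul
      (key β hβ _)).sub ((key α hα _).mul (key β hβ _)))) _
    exact fun v hv => (differentiableAt_comp_symm he hv.1 (hu _ hv.2)).differentiableWithinAt
  refine h.congr fun v hv => ?_
  rw [inChart_localForm he hv.1 (hα _ hv.2) (hβ _ hv.2), wedge_eq_smul, smul_smul]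

lemma TwoForm.inChart_congr {η ζ : TwoForm X} {e : OpenPartialHomeomorph X E2} {v : E2}
    (h : η (e.symm v) = ζ (e.symm v)) : η.inChart e v = ζ.inChart e v := by
  simp only [TwoForm.inChart, h]

lemma TwoForm.congr_point (η : TwoForm X) {y y' : X} (h : y = y') (v : Fin 2 → E2) :
    (η y : E2 [⋀^Fin 2]→L[ℂ] ℂ) v = (η y' : E2 [⋀^Fin 2]→L[ℂ] ℂ) v := by
  subst h; rfl

/-- The differential of `e` is a right inverse of that of `e.symm`, so a form is recovered from its
expression in the chart. -/
lemma TwoForm.eq_of_inChart_eq [IsManifold 𝓘(ℂ, E2) 1 X] {e : OpenPartialHomeomorph X E2}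
    (he : e ∈ atlas E2 X) {η ζ : TwoForm X} {q : X} (hq : q ∈ e.source)
    (h : η.inChart e (e q) = ζ.inChart e (e q)) : η q = ζ q := by
  have h1 := mdifferentiableAt_atlas (I := 𝓘(ℂ, E2)) he hq
  have h2 := mdifferentiableAt_atlas_symm (I := 𝓘(ℂ, E2)) he (e.map_source hq)
  have h3 : (mfderiv 𝓘(ℂ, E2) 𝓘(ℂ, E2) e.symm (e q)).comp (mfderiv 𝓘(ℂ, E2) 𝓘(ℂ, E2) e q) =
      ContinuousLinearMap.id ℂ E2 := by
    have h4 : HasMFDerivAt 𝓘(ℂ, E2) 𝓘(ℂ, E2) (e.symm ∘ e) q (ContinuousLinearMap.id ℂ E2) := by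
      refine (hasMFDerivAt_id q).congr_of_eventuallyEq ?_
      filter_upwards [e.open_source.mem_nhds hq] with y hy
      exact e.left_inv hy
    exact hasMFDerivAt_unique (h2.hasMFDerivAt.comp q h1.hasMFDerivAt) h4
  have h5 : ∀ w : E2, (mfderiv 𝓘(ℂ, E2) 𝓘(ℂ, E2) e.symm (e q) :
      E2 →L[ℂ] E2) ((mfderiv 𝓘(ℂ, E2) 𝓘(ℂ, E2) e q : E2 →L[ℂ] E2) w) = w :=
    fun w => congrArg (fun T : E2 →L[ℂ] E2 => T w) h3
  have h6 : ∀ (θ : TwoForm X) (v : Fin 2 → E2),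
      (θ.inChart e (e q)) (fun i => (mfderiv 𝓘(ℂ, E2) 𝓘(ℂ, E2) e q : E2 →L[ℂ] E2) (v i)) =
        (θ q : E2 [⋀^Fin 2]→L[ℂ] ℂ) v := by
    intro θ v
    rw [← θ.congr_point (e.left_inv hq) v]
    change (θ (e.symm (e q)) : E2 [⋀^Fin 2]→L[ℂ] ℂ) (fun i => _) = _
    congr 1
    funext i
    exact h5 (v i)
  have : (η q : E2 [⋀^Fin 2]→L[ℂ] ℂ) = ζ q := by
    ext v
    rw [← h6 η v, ← h6 ζ v, h]
  exact this

/-- A form on a dense set that is locally of the form `u dα ∧ dβ` extends. -/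
theorem exists_global_form [IsManifold 𝓘(ℂ, E2) 1 X] {η₀ : TwoForm X} {R : Set X}
    (hR : Dense R)
    (h : ∀ q : X, ∃ V : Set X, IsOpen V ∧ q ∈ V ∧ ∃ u α β : X → ℂ, ∀ y ∈ V,
      MDifferentiableAt 𝓘(ℂ, E2) 𝓘(ℂ, ℂ) u y ∧ MDifferentiableAt 𝓘(ℂ, E2) 𝓘(ℂ, ℂ) α y ∧
      MDifferentiableAt 𝓘(ℂ, E2) 𝓘(ℂ, ℂ) β y ∧ localForm u α β y ≠ 0 ∧
      (y ∈ R → η₀ y = localForm u α β y)) :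
    ∃ η : TwoForm X, (∀ q ∈ R, η q = η₀ q) ∧ η.IsHolomorphic ∧ ∀ q, η q ≠ 0 := by
  choose V hV hqV u α β hd using h
  have hdiff : ∀ q, ∀ e ∈ atlas E2 X, DifferentiableOn ℂ
      ((localForm (u q) (α q) (β q)).inChart e) (e.target ∩ e.symm ⁻¹' V q) := fun q e he =>
    differentiableOn_inChart_localForm he (hV q) (fun y hy => (hd q y hy).1)
      (fun y hy => (hd q y hy).2.1) (fun y hy => (hd q y hy).2.2.1)
  -- Both expressions are continuous in a chart and agree with `η₀` on the dense set `R`.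
  have hagree : ∀ q q' y, y ∈ V q → y ∈ V q' →
      localForm (u q) (α q) (β q) y = localForm (u q') (α q') (β q') y := by
    intro q q' y hy hy'
    set e := chartAt E2 y
    have he : e ∈ atlas E2 X := chart_mem_atlas _ _
    have hye : y ∈ e.source := mem_chart_source _ _
    refine TwoForm.eq_of_inChart_eq he hye ?_
    have hcont : ∀ q, y ∈ V q →
        ContinuousAt ((localForm (u q) (α q) (β q)).inChart e) (e y) := by
      intro q hy
      refine ((hdiff q e he).differentiableAt
        ((e.isOpen_inter_preimage_symm (hV q)).mem_nhds ⟨e.map_source hye, ?_⟩)).continuousAt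
      rwa [mem_preimage, e.left_inv hye]
    by_contra hne
    have hev := ((hcont q hy).ne_iff_eventually_ne (hcont q' hy')).1 hne
    have hev' : ∀ᶠ z in 𝓝 y, (localForm (u q) (α q) (β q)).inChart e (e z) ≠
        (localForm (u q') (α q') (β q')).inChart e (e z) := (e.continuousAt hye).eventually hev
    have hev2 : ∀ᶠ z in 𝓝 y, z ∈ V q ∩ V q' ∩ e.source :=
      inter_mem (inter_mem ((hV q).mem_nhds hy) ((hV q').mem_nhds hy'))
        (e.open_source.mem_nhds hye)
    obtain ⟨z, hzR, hz1, ⟨hz2, hz3⟩, hz4⟩ :=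
      ((mem_closure_iff_frequently.1 (hR y)).and_eventually (hev'.and hev2)).exists
    refine hz1 (TwoForm.inChart_congr ?_)
    rw [e.left_inv hz4, ← (hd q z hz2).2.2.2.2 hzR, ← (hd q' z hz3).2.2.2.2 hzR]
  refine ⟨fun q => localForm (u q) (α q) (β q) q, ?_, ?_, ?_⟩
  · exact fun q hq => ((hd q q (hqV q)).2.2.2.2 hq).symm
  · intro e he v hv
    set q := e.symm v
    have hO := e.isOpen_inter_preimage_symm (hV q)
    have hmem : v ∈ e.target ∩ e.symm ⁻¹' V q := ⟨hv, hqV q⟩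
    -- The chosen expression varies with the point, but by `hagree` a single one is valid near `v`.
    refine (((hdiff q e he).differentiableAt
      (hO.mem_nhds hmem)).congr_of_eventuallyEq ?_).differentiableWithinAt
    filter_upwards [hO.mem_nhds hmem] with v' hv'
    exact TwoForm.inChart_congr (hagree _ _ _ (hqV (e.symm v')) hv'.2)
  · exact fun q => (hd q q (hqV q)).2.2.2.1

end Forms

/-! ## The form in affine coordinates -/

section Affine

open Set Filter

/-- Two linear functionals without a common zero on the model space take arbitrary values. -/
lemma exists_apply_eq {α β : E2 →L[ℂ] ℂ} (h : ∀ v, α v = 0 → β v = 0 → v = 0) (a b : ℂ) :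
    ∃ v, α v = a ∧ β v = b := by
  set T : E2 →L[ℂ] E2 := (modelEquiv.symm : ℂ × ℂ →L[ℂ] E2).comp (α.prod β)
  have hT : ∀ v, T v = mk2 (α v) (β v) := fun v => rfl
  have hinj : Function.Injective T := by
    rw [injective_iff_map_eq_zero]
    intro v hv
    rw [hT, ← mk2_eta (0 : E2), mk2_eq_iff] at hv
    exact h v hv.1 hv.2
  obtain ⟨v, hv⟩ := LinearMap.injective_iff_surjective (f := (T : E2 →ₗ[ℂ] E2)).1 hinj (mk2 a b)
  exact ⟨v, mk2_eq_iff.1 ((hT v).symm.trans hv)⟩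

/-- A point of an affine plane in `ℂ³`. -/
def affinePoint (e₁ e₂ n : Fin 3 → ℂ) (a b : ℂ) : Fin 3 → ℂ := a • e₁ + b • e₂ + n

lemma apply_affinePoint (m : LinearForm) (e₁ e₂ n : Fin 3 → ℂ) (a b : ℂ) :
    m (affinePoint e₁ e₂ n a b) = a * m e₁ + b * m e₂ + m n := by
  simp [affinePoint]

/-- The determinant of the linear forms `x`, `y`, `L` on three vectors. -/
def frameDet (L : LinearForm) (e₁ e₂ n : Fin 3 → ℂ) : ℂ :=
  Matrix.det !![formX e₁, formX e₂, formX n; formY e₁, formY e₂, formY n; L e₁, L e₂, L n]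

/-- A relation between the rows of the matrix is a relation between `x, y, L` on spanning vectors,
hence everywhere. -/
lemma frameDet_ne_zero {L : LinearForm} (hL : LinearIndependent ℂ ![formX, formY, L])
    {e₁ e₂ n : Fin 3 → ℂ} (h : ∀ v : Fin 3 → ℂ, ∃ a b c : ℂ, v = a • e₁ + b • e₂ + c • n) :
    frameDet L e₁ e₂ n ≠ 0 := by
  intro h0
  obtain ⟨u, hu, hu'⟩ := Matrix.exists_vecMul_eq_zero_iff.2 h0
  refine hu ?_
  have h1 := congrFun hu' 0
  have h2 := congrFun hu' 1
  have h3 := congrFun hu' 2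
  simp only [Matrix.vecMul, dotProduct, Fin.sum_univ_three] at h1 h2 h3
  simp at h1 h2 h3
  have h4 : u 0 • formX + u 1 • formY + u 2 • L = 0 := by
    refine LinearMap.ext fun v => ?_
    obtain ⟨a, b, c, rfl⟩ := h v
    simp
    linear_combination a * h1 + b * h2 + c * h3
  have h5 := Fintype.linearIndependent_iff.1 hL u (by
    rw [Fin.sum_univ_three]
    exact h4)
  exact funext h5

variable {l : Fin 6 → LinearForm} {X : Type} [TopologicalSpace X] [ChartedSpace E2 X]
  {π : X → DoubleCover l}

/-- The differential of a function. -/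
def differential (f : X → ℂ) (q : X) : E2 →L[ℂ] ℂ := mfderiv 𝓘(ℂ, E2) 𝓘(ℂ, ℂ) f q

lemma _root_.HasMFDerivAt.pair {E E' : Type*} [NormedAddCommGroup E] [NormedSpace ℂ E]
    [NormedAddCommGroup E'] [NormedSpace ℂ E'] {f : X → E} {g : X → E'} {q : X} {f' : E2 →L[ℂ] E}
    {g' : E2 →L[ℂ] E'} (hf : HasMFDerivAt 𝓘(ℂ, E2) 𝓘(ℂ, E) f q f')
    (hg : HasMFDerivAt 𝓘(ℂ, E2) 𝓘(ℂ, E') g q g') :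
    HasMFDerivAt 𝓘(ℂ, E2) 𝓘(ℂ, E × E') (fun y => (f y, g y)) q (f'.prod g') :=
  ⟨hf.1.prodMk hg.1, hf.2.prodMk hg.2⟩

/-- The functions `A`, `B`, `c` are affine coordinates of the map to the double cover near `q`. -/
structure IsAffineAt (π : X → DoubleCover l) (e₁ e₂ n : Fin 3 → ℂ) (A B c : X → ℂ) (q : X) :
    Prop where
  diffA : MDifferentiableAt 𝓘(ℂ, E2) 𝓘(ℂ, ℂ) A q
  diffB : MDifferentiableAt 𝓘(ℂ, E2) 𝓘(ℂ, ℂ) B q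
  diffC : MDifferentiableAt 𝓘(ℂ, E2) 𝓘(ℂ, ℂ) c q
  eq : ∀ᶠ y in 𝓝 q, ∃ h, π y = DoubleCover.mk (Cone.mk (affinePoint e₁ e₂ n (A y) (B y), c y) h)

variable {e₁ e₂ n : Fin 3 → ℂ} {A B c : X → ℂ} {q : X}

namespace IsAffineAt

lemma eq_self (h : IsAffineAt π e₁ e₂ n A B c q) : ∃ h, π q =
    DoubleCover.mk (Cone.mk (affinePoint e₁ e₂ n (A q) (B q), c q) h) := h.eq.self_of_nhds

lemma mfderiv_linearRatio (h : IsAffineAt π e₁ e₂ n A B c q) {L : LinearForm} (m : LinearForm)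
    (hL : L (affinePoint e₁ e₂ n (A q) (B q)) ≠ 0) (v : E2) :
    differential (linearRatio m L ∘ π) q v =
      (L (affinePoint e₁ e₂ n (A q) (B q)) *
        (m e₁ * differential A q v +
          m e₂ * differential B q v) -
      m (affinePoint e₁ e₂ n (A q) (B q)) *
        (L e₁ * differential A q v +
          L e₂ * differential B q v)) /
      L (affinePoint e₁ e₂ n (A q) (B q)) ^ 2 := by
  have h1 : ∀ m : LinearForm, HasFDerivAt
      (fun p : ℂ × ℂ => m (affinePoint e₁ e₂ n p.1 p.2))
      (m e₁ • ContinuousLinearMap.fst ℂ ℂ ℂ + m e₂ • ContinuousLinearMap.snd ℂ ℂ ℂ) (A q, B q) := by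
    intro m
    have : (fun p : ℂ × ℂ => m (affinePoint e₁ e₂ n p.1 p.2)) =
        fun p => p.1 * m e₁ + p.2 * m e₂ + m n := by
      funext p; rw [apply_affinePoint]
    rw [this]
    exact ((hasFDerivAt_fst.mul_const _).add (hasFDerivAt_snd.mul_const _)).add_const _
  have h2 := (h1 m).mul ((hasDerivAt_inv hL).comp_hasFDerivAt (A q, B q) (h1 L))
  have h3 := HasMFDerivAt.comp (f := fun y => (A y, B y)) q h2.hasMFDerivAt (h.diffA.hasMFDerivAt.pair h.diffB.hasMFDerivAt)
  have h4 := h3.congr_of_eventuallyEq (f₁ := linearRatio m L ∘ π) (by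
    filter_upwards [h.eq] with y ⟨hy, hy'⟩
    simp only [Function.comp_apply, hy', linearRatio_mk, Cone.mk_val, div_eq_mul_inv]
    rfl)
  rw [differential, h4.mfderiv]
  change m (affinePoint e₁ e₂ n (A q) (B q)) *
      (-(L (affinePoint e₁ e₂ n (A q) (B q)) ^ 2)⁻¹ *
        (L e₁ * differential A q v +
          L e₂ * differential B q v)) +
    (L (affinePoint e₁ e₂ n (A q) (B q)))⁻¹ *
      (m e₁ * differential A q v +
          m e₂ * differential B q v) = _
  field_simp
  ring

/-- The change of affine coordinates multiplies `dA ∧ dB` by the determinant over `L³`, and the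
factor `L³` in `(w / L³)⁻¹` cancels the denominator. -/
theorem pullbackForm_eq (h : IsAffineAt π e₁ e₂ n A B c q) {L : LinearForm}
    (hL : L (affinePoint e₁ e₂ n (A q) (B q)) ≠ 0) :
    pullbackForm π L q = localForm (fun y => frameDet L e₁ e₂ n * (c y)⁻¹) A B q := by
  have key : (pullbackForm π L q : E2 [⋀^Fin 2]→L[ℂ] ℂ) =
      localForm (fun y => frameDet L e₁ e₂ n * (c y)⁻¹) A B q := by
    refine ContinuousAlternatingMap.ext fun v : Fin 2 → E2 => ?_
    change (cubicRatio L (π q))⁻¹ *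
      (differential (linearRatio formX L ∘ π) q (v 0) *
        differential (linearRatio formY L ∘ π) q (v 1) -
      differential (linearRatio formX L ∘ π) q (v 1) *
        differential (linearRatio formY L ∘ π) q (v 0)) =
      (frameDet L e₁ e₂ n * (c q)⁻¹) *
      (differential A q (v 0) *
        differential B q (v 1) -
      differential A q (v 1) *
        differential B q (v 0))
    obtain ⟨hq, hq'⟩ := h.eq_self
    rw [h.mfderiv_linearRatio formX hL, h.mfderiv_linearRatio formX hL,
      h.mfderiv_linearRatio formY hL, h.mfderiv_linearRatio formY hL, hq', cubicRatio_mk,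
      Cone.mk_val, inv_div, div_eq_mul_inv]
    have hΛ := apply_affinePoint L e₁ e₂ n (A q) (B q)
    simp only [apply_affinePoint formX, apply_affinePoint formY]
    generalize (c q)⁻¹ = k
    generalize L (affinePoint e₁ e₂ n (A q) (B q)) = Λ at *
    generalize differential A q (v 0) = a0
    generalize differential A q (v 1) = a1
    generalize differential B q (v 0) = b0
    generalize differential B q (v 1) = b1
    have hdet : frameDet L e₁ e₂ n = formX e₁ * formY e₂ * L n - formX e₁ * formY n * L e₂ -
        formX e₂ * formY e₁ * L n + formX e₂ * formY n * L e₁ + formX n * formY e₁ * L e₂ -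
        formX n * formY e₂ * L e₁ := by
      rw [frameDet, Matrix.det_fin_three]
      simp
    rw [hdet]
    -- Eliminating `L n` leaves an identity in independent quantities.
    have hLn : L n = Λ - A q * L e₁ - B q * L e₂ := by rw [hΛ]; ring
    rw [hLn]
    field_simp
    ring
  exact key

/-- The differential of the equation of the double cover. -/
lemma fderiv_relation (h : IsAffineAt π e₁ e₂ n A B c q) (v : E2) :
    differential A q v *
        fderiv ℂ (equation l) (affinePoint e₁ e₂ n (A q) (B q), c q) (e₁, 0) +
      differential B q v *
        fderiv ℂ (equation l) (affinePoint e₁ e₂ n (A q) (B q), c q) (e₂, 0) +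
      2 * c q * differential c q v = 0 := by
  have h1 : HasFDerivAt (fun p : ℂ × ℂ × ℂ => (affinePoint e₁ e₂ n p.1 p.2.1, p.2.2))
      ((((ContinuousLinearMap.fst ℂ ℂ (ℂ × ℂ)).smulRight e₁ +
        ((ContinuousLinearMap.fst ℂ ℂ ℂ).comp (ContinuousLinearMap.snd ℂ ℂ (ℂ × ℂ))).smulRight
          e₂)).prod ((ContinuousLinearMap.snd ℂ ℂ ℂ).comp (ContinuousLinearMap.snd ℂ ℂ (ℂ × ℂ))))
      (A q, B q, c q) := by
    refine HasFDerivAt.prodMk (HasFDerivAt.add_const _ (HasFDerivAt.add ?_ ?_)) ?_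
    · exact ((ContinuousLinearMap.fst ℂ ℂ (ℂ × ℂ)).hasFDerivAt).smul_const e₁
    · exact (ContinuousLinearMap.hasFDerivAt ((ContinuousLinearMap.fst ℂ ℂ ℂ).comp
        (ContinuousLinearMap.snd ℂ ℂ (ℂ × ℂ)))).smul_const e₂
    · exact ContinuousLinearMap.hasFDerivAt ((ContinuousLinearMap.snd ℂ ℂ ℂ).comp
        (ContinuousLinearMap.snd ℂ ℂ (ℂ × ℂ)))
  have h2 := (differentiable_equation (l := l)
    (affinePoint e₁ e₂ n (A q) (B q), c q)).hasFDerivAt.comp (A q, B q, c q) h1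
  have h3 := HasMFDerivAt.comp (f := fun y => (A y, B y, c y)) q h2.hasMFDerivAt (h.diffA.hasMFDerivAt.pair
    (h.diffB.hasMFDerivAt.pair h.diffC.hasMFDerivAt))
  have h4 := h3.congr_of_eventuallyEq (f₁ := fun _ => (0 : ℂ)) (by
    filter_upwards [h.eq] with y ⟨hy, hy'⟩
    exact hy.2.symm)
  have h5 := hasMFDerivAt_unique h4 (hasMFDerivAt_const (0 : ℂ) q)
  have h6 := congrArg (fun T : E2 →L[ℂ] ℂ => T v) h5
  set T := fderiv ℂ (equation l) (affinePoint e₁ e₂ n (A q) (B q), c q)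
  set a := differential A q v
  set b := differential B q v
  set g := differential c q v
  have h7 : T (a • e₁ + b • e₂, g) = 0 := h6
  have h8 : T (0, 1) = 2 * c q := by
    rw [fderiv_equation_apply]; simp
  have h9 : ((a • e₁ + b • e₂, g) : (Fin 3 → ℂ) × ℂ) =
      a • (e₁, (0 : ℂ)) + b • (e₂, (0 : ℂ)) + g • ((0 : Fin 3 → ℂ), (1 : ℂ)) := by
    simp
  rw [h9] at h7
  simp only [map_add, map_smul, h8, smul_eq_mul] at h7
  linear_combination h7

/-- Over the regular locus, the map to the double cover is an immersion. -/
lemma eq_zero_of_regular (h : IsAffineAt π e₁ e₂ n A B c q) (hπ : IsDesingularisation π)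
    (hq : π q ∈ regularLocus l) {v : E2}
    (hA : differential A q v = 0)
    (hB : differential B q v = 0)
    (hc : differential c q v = 0) : v = 0 := by
  obtain ⟨s, hs, -, hs'⟩ := hπ.exists_inverse
  obtain ⟨h0, h1⟩ := h.eq_self
  obtain ⟨U, hU, hpU, G, hG, hsG⟩ := hs (Cone.mk _ h0) (by rwa [← h1])
  have hΦ : DifferentiableAt ℂ (fun p : ℂ × ℂ × ℂ => (affinePoint e₁ e₂ n p.1 p.2.1, p.2.2))
      (A q, B q, c q) := by
    refine DifferentiableAt.prodMk (DifferentiableAt.add_const _ (DifferentiableAt.fun_add ?_ ?_)) ?_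
    · exact differentiableAt_fst.smul_const e₁
    · exact (differentiableAt_snd.fst).smul_const e₂
    · exact differentiableAt_snd.snd
  have h2 := (hG.mdifferentiableAt (hU.mem_nhds hpU)).comp (A q, B q, c q) hΦ.mdifferentiableAt
  have h3 := h.diffA.hasMFDerivAt.pair (h.diffB.hasMFDerivAt.pair h.diffC.hasMFDerivAt)
  have h4 := HasMFDerivAt.comp (f := fun y => (A y, B y, c y)) q h2.hasMFDerivAt h3
  have hcont : ContinuousAt (fun y => (affinePoint e₁ e₂ n (A y) (B y), c y)) q :=
    ContinuousAt.comp (f := fun y => (A y, B y, c y)) hΦ.continuousAt h3.continuousAt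
  -- The inverse over the regular locus recovers a point from `(A, B, c)`, so the three
  -- differentials have no common kernel.
  have h5 := h4.congr_of_eventuallyEq (f₁ := id) (by
    have hR : ∀ᶠ y in 𝓝 q, π y ∈ regularLocus l :=
      (hπ.holomorphic.holAt q).continuousAt.eventually_mem (isOpen_regularLocus.mem_nhds hq)
    filter_upwards [h.eq, hcont.eventually_mem (hU.mem_nhds hpU), hR] with y ⟨hy, hy'⟩ hyU hyR
    have := hsG (Cone.mk _ hy) hyU
    rw [← hy', hs' y hyR] at this
    exact this)
  have h6 := hasMFDerivAt_unique h5 (hasMFDerivAt_id q)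
  have h7 := congrArg (fun T : E2 →L[ℂ] E2 => T v) h6
  have h8 : ((differential A q).prod ((differential B q).prod (differential c q))) v = 0 := by
    simp only [ContinuousLinearMap.prod_apply, hA, hB, hc]; rfl
  exact h7.symm.trans ((congrArg (mfderiv 𝓘(ℂ, ℂ × ℂ × ℂ) 𝓘(ℂ, E2)
    (G ∘ fun p : ℂ × ℂ × ℂ => (affinePoint e₁ e₂ n p.1 p.2.1, p.2.2)) (A q, B q, c q) :
      ℂ × ℂ × ℂ →L[ℂ] E2) h8).trans (map_zero _))

end IsAffineAt

end Affine

/-! ### Local expressions over the regular locus -/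

section LocalForms

open Set Filter

variable {l : Fin 6 → LinearForm}

lemma isOpen_nonvanishing (m : LinearForm) : IsOpen (nonvanishing l m) := by
  have h : nonvanishing l m = DoubleCover.mk '' {p : Cone l | m p.1.1 ≠ 0} := by
    ext P
    constructor
    · rintro ⟨p, h, h'⟩; exact ⟨p, h', h⟩
    · rintro ⟨p, h', h⟩; exact ⟨p, h, h'⟩
  rw [h]
  exact isOpenMap_mk _ (isOpen_ne.preimage
    ((continuous_linearForm m).comp (continuous_fst.comp continuous_coneVal)))

lemma mk_mem_affineUnramified {L : LinearForm} {p : Cone l} :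
    DoubleCover.mk p ∈ affineUnramified L ↔ L p.1.1 ≠ 0 ∧ p.1.2 ≠ 0 := by
  constructor
  · rintro ⟨q, hq, h, h'⟩
    obtain ⟨t, ht, h1⟩ := mk_eq_mk.1 hq.symm
    rw [h1, act_apply] at h h'
    simp only [map_smul, smul_eq_mul] at h h'
    exact ⟨right_ne_zero_of_mul h, right_ne_zero_of_mul h'⟩
  · exact fun h => ⟨p, rfl, h.1, h.2⟩

lemma isOpen_affineUnramified (L : LinearForm) : IsOpen (affineUnramified (l := l) L) := by
  have h : affineUnramified L = DoubleCover.mk '' {p : Cone l | L p.1.1 ≠ 0 ∧ p.1.2 ≠ 0} := by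
    ext P
    constructor
    · rintro ⟨p, h, h'⟩; exact ⟨p, h', h⟩
    · rintro ⟨p, h', h⟩; exact ⟨p, h, h'⟩
  rw [h]
  exact isOpenMap_mk _ ((isOpen_ne.preimage
    ((continuous_linearForm L).comp (continuous_fst.comp continuous_coneVal))).inter
    (isOpen_ne.preimage (continuous_snd.comp continuous_coneVal)))

/-- A basis of `ℂ³`, with its dual basis. -/
structure Frame where
  e₁ : Fin 3 → ℂ
  e₂ : Fin 3 → ℂ
  n : Fin 3 → ℂ
  a₁ : LinearForm
  a₂ : LinearForm
  m : LinearForm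
  decomp : ∀ v, v = a₁ v • e₁ + a₂ v • e₂ + m v • n
  dual : a₁ n = 0 ∧ a₂ n = 0 ∧ m n = 1

lemma exists_frame {e n : Fin 3 → ℂ} (h : LinearIndependent ℂ ![e, n]) :
    ∃ T : Frame, T.e₁ = e ∧ T.n = n := by
  obtain ⟨e₂, he₂⟩ := exists_linearIndependent_cons_of_lt_finrank h (by simp)
  let b := basisOfLinearIndependentOfCardEqFinrank he₂ (by simp)
  have hb0 : b 0 = e₂ := by simp [b]
  have hb1 : b 1 = e := by simp [b]
  have hb2 : b 2 = n := by simp [b]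
  refine ⟨⟨e, e₂, n, b.coord 1, b.coord 0, b.coord 2, fun v => ?_, ?_, ?_, ?_⟩, rfl, rfl⟩
  · conv_lhs => rw [← b.sum_repr v]
    rw [Fin.sum_univ_three, hb0, hb1, hb2]
    simp only [Module.Basis.coord_apply]
    abel
  · rw [← hb2]; simp
  · rw [← hb2]; simp
  · rw [← hb2]; simp

lemma exists_frame_of_ne_zero {n : Fin 3 → ℂ} (h : n ≠ 0) : ∃ T : Frame, T.n = n := by
  obtain ⟨e, he⟩ := exists_linearIndependent_cons_of_lt_finrank
    (R := ℂ) (v := ![n]) (linearIndependent_unique_iff.2 h) (by simp)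
  obtain ⟨T, -, hT⟩ := exists_frame he
  exact ⟨T, hT⟩

variable {X : Type} [TopologicalSpace X] [ChartedSpace E2 X] {π : X → DoubleCover l}

namespace Frame

variable (T : Frame)

lemma affinePoint_eq {v : Fin 3 → ℂ} (h : T.m v ≠ 0) :
    affinePoint T.e₁ T.e₂ T.n (T.a₁ v / T.m v) (T.a₂ v / T.m v) = (T.m v)⁻¹ • v := by
  refine Eq.trans ?_ (congrArg (fun w => (T.m v)⁻¹ • w) (T.decomp v)).symm
  simp only [affinePoint, smul_add, smul_smul, inv_mul_cancel₀ h, one_smul, div_eq_inv_mul]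

lemma frameDet_ne_zero {L : LinearForm} (hL : LinearIndependent ℂ ![formX, formY, L]) :
    frameDet L T.e₁ T.e₂ T.n ≠ 0 :=
  SixLines.frameDet_ne_zero hL fun v => ⟨_, _, _, T.decomp v⟩

lemma exists_eq_mk {P : DoubleCover l} (hP : P ∈ nonvanishing l T.m) :
    ∃ h, P = DoubleCover.mk (Cone.mk (affinePoint T.e₁ T.e₂ T.n (linearRatio T.a₁ T.m P)
      (linearRatio T.a₂ T.m P), cubicRatio T.m P) h) := by
  obtain ⟨p, rfl⟩ := mk_surjective P
  rw [mk_mem_nonvanishing] at hP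
  have h1 : (affinePoint T.e₁ T.e₂ T.n (linearRatio T.a₁ T.m (DoubleCover.mk p))
      (linearRatio T.a₂ T.m (DoubleCover.mk p)), cubicRatio T.m (DoubleCover.mk p)) =
      act (T.m p.1.1)⁻¹ p.1 := by
    refine Prod.ext (T.affinePoint_eq hP) ?_
    change p.1.2 / T.m p.1.1 ^ 3 = (T.m p.1.1)⁻¹ ^ 3 * p.1.2
    rw [inv_pow, div_eq_inv_mul]
  refine ⟨h1 ▸ act_mem (inv_ne_zero hP) p.2, ?_⟩
  exact mk_eq_mk.2 ⟨_, inv_ne_zero hP, h1⟩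

lemma isAffineAt (hπ : IsHolomorphicToCover π) {q : X} (hq : π q ∈ nonvanishing l T.m) :
    IsAffineAt π T.e₁ T.e₂ T.n (linearRatio T.a₁ T.m ∘ π) (linearRatio T.a₂ T.m ∘ π)
      (cubicRatio T.m ∘ π) q where
  diffA := (hπ.holAt q).linearRatio _ hq
  diffB := (hπ.holAt q).linearRatio _ hq
  diffC := (hπ.holAt q).cubicRatio hq
  eq := by
    filter_upwards [(hπ.holAt q).continuousAt.eventually_mem
      ((isOpen_nonvanishing T.m).mem_nhds hq)] with y hy
    exact T.exists_eq_mk hy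

end Frame

/-- Near `q`, the form is given by a holomorphic expression without zeros. -/
def HasLocalForm (π : X → DoubleCover l) (L : LinearForm) (q : X) : Prop :=
  ∃ V : Set X, IsOpen V ∧ q ∈ V ∧ ∃ u α β : X → ℂ, ∀ y ∈ V,
      MDifferentiableAt 𝓘(ℂ, E2) 𝓘(ℂ, ℂ) u y ∧ MDifferentiableAt 𝓘(ℂ, E2) 𝓘(ℂ, ℂ) α y ∧
      MDifferentiableAt 𝓘(ℂ, E2) 𝓘(ℂ, ℂ) β y ∧ localForm u α β y ≠ 0 ∧
      (y ∈ π ⁻¹' affineUnramified L → pullbackForm π L y = localForm u α β y)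

lemma localForm_ne_zero {u α β : X → ℂ} {y : X} (hu : u y ≠ 0)
    (h : ∀ v, differential α y v = 0 → differential β y v = 0 → v = 0) :
    localForm u α β y ≠ 0 :=
  smul_ne_zero hu (wedge_ne_zero (α := differential α y) (β := differential β y) h)

namespace IsAffineAt

variable {e₁ e₂ n : Fin 3 → ℂ} {A B c : X → ℂ} {q : X}

lemma regular_of_ne_zero (h : IsAffineAt π e₁ e₂ n A B c q) (hc : c q ≠ 0) :
    π q ∈ regularLocus l := by
  obtain ⟨h1, h2⟩ := h.eq_self
  rw [h2]
  exact mem_regularLocus_of_snd_ne_zero hc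

/-- Where `w ≠ 0`, the differentiated equation determines `dc` from `dA` and `dB`. -/
lemma eq_zero_of_ne_zero (h : IsAffineAt π e₁ e₂ n A B c q) (hπ : IsDesingularisation π)
    (hc : c q ≠ 0) {v : E2} (hA : differential A q v = 0) (hB : differential B q v = 0) :
    v = 0 := by
  refine h.eq_zero_of_regular hπ (h.regular_of_ne_zero hc) hA hB ?_
  have := h.fderiv_relation v
  rw [hA, hB, zero_mul, zero_mul, zero_add, zero_add] at this
  exact (mul_eq_zero.1 this).resolve_left (mul_ne_zero two_ne_zero hc)

/-- Where the partial derivative along `e₁` is nonzero, the differentiated equation determines `dA`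
from `dB` and `dc`. -/
lemma eq_zero_of_fderiv_ne_zero (h : IsAffineAt π e₁ e₂ n A B c q) (hπ : IsDesingularisation π)
    (ht : fderiv ℂ (equation l) (affinePoint e₁ e₂ n (A q) (B q), c q) (e₁, 0) ≠ 0) {v : E2}
    (hB : differential B q v = 0) (hc : differential c q v = 0) : v = 0 := by
  obtain ⟨h1, h2⟩ := h.eq_self
  refine h.eq_zero_of_regular hπ ?_ ?_ hB hc
  · rw [h2, mk_mem_regularLocus]
    intro h0
    exact ht (by simp only [Cone.mk_val] at h0; rw [h0]; rfl)
  · have := h.fderiv_relation v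
    rw [hB, hc, zero_mul, mul_zero, add_zero, add_zero] at this
    exact (mul_eq_zero.1 this).resolve_right ht

lemma apply_ne_zero (h : IsAffineAt π e₁ e₂ n A B c q) {L : LinearForm}
    (hq : π q ∈ affineUnramified L) : L (affinePoint e₁ e₂ n (A q) (B q)) ≠ 0 ∧ c q ≠ 0 := by
  obtain ⟨h1, h2⟩ := h.eq_self
  rw [h2, mk_mem_affineUnramified] at hq
  exact hq

/-- Wedging the differentiated equation with `dB` gives `f_{e₁} dA ∧ dB = -2c dc ∧ dB`. The apparent
pole along `w = 0` thus cancels. -/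
lemma localForm_eq (h : IsAffineAt π e₁ e₂ n A B c q) (hc : c q ≠ 0) (δ : ℂ)
    (ht : fderiv ℂ (equation l) (affinePoint e₁ e₂ n (A q) (B q), c q) (e₁, 0) ≠ 0) :
    localForm (fun y => δ * (c y)⁻¹) A B q = localForm (fun y => (-2 * δ) *
      (fderiv ℂ (equation l) (affinePoint e₁ e₂ n (A y) (B y), c y) (e₁, 0))⁻¹) c B q := by
  have key : (localForm (fun y => δ * (c y)⁻¹) A B q : E2 [⋀^Fin 2]→L[ℂ] ℂ) =
      localForm (fun y => (-2 * δ) *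
      (fderiv ℂ (equation l) (affinePoint e₁ e₂ n (A y) (B y), c y) (e₁, 0))⁻¹) c B q := by
    refine ContinuousAlternatingMap.ext fun v : Fin 2 → E2 => ?_
    change (δ * (c q)⁻¹) * (differential A q (v 0) * differential B q (v 1) -
        differential A q (v 1) * differential B q (v 0)) = ((-2 * δ) *
      (fderiv ℂ (equation l) (affinePoint e₁ e₂ n (A q) (B q), c q) (e₁, 0))⁻¹) *
        (differential c q (v 0) * differential B q (v 1) -
        differential c q (v 1) * differential B q (v 0))
    have h0 := h.fderiv_relation (v 0)
    have h1 := h.fderiv_relation (v 1)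
    field_simp
    linear_combination δ * (differential B q (v 1)) * h0 - δ * (differential B q (v 0)) * h1
  exact key

end IsAffineAt

lemma hasLocalForm_of_ne_zero (hπ : IsDesingularisation π) {L : LinearForm}
    (hL : LinearIndependent ℂ ![formX, formY, L]) {q : X} {p : Cone l}
    (hp : DoubleCover.mk p = π q) (hw : p.1.2 ≠ 0) : HasLocalForm π L q := by
  obtain ⟨T, hT⟩ := exists_frame_of_ne_zero p.2.1
  have hm : T.m p.1.1 = 1 := by rw [← hT]; exact T.dual.2.2
  have hq : π q ∈ nonvanishing l T.m := by
    rw [← hp, mk_mem_nonvanishing, hm]; exact one_ne_zero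
  have hopen : IsOpen (π ⁻¹' nonvanishing l T.m) :=
    (isOpen_nonvanishing T.m).preimage hπ.proper.continuous
  set c := cubicRatio T.m ∘ π with hcdef
  have hc : ContinuousOn c (π ⁻¹' nonvanishing l T.m) := fun y hy =>
    (T.isAffineAt hπ.holomorphic hy).diffC.continuousAt.continuousWithinAt
  have hcq : c q ≠ 0 := by
    rw [hcdef, Function.comp_apply, ← hp, cubicRatio_mk, hm]
    simpa using hw
  refine ⟨_, hc.isOpen_inter_preimage hopen isOpen_ne, ⟨hq, hcq⟩,
    fun y => frameDet L T.e₁ T.e₂ T.n * (c y)⁻¹, linearRatio T.a₁ T.m ∘ π,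
    linearRatio T.a₂ T.m ∘ π, ?_⟩
  rintro y ⟨hy, hcy⟩
  have h := T.isAffineAt hπ.holomorphic hy
  refine ⟨?_, h.diffA, h.diffB, ?_, ?_⟩
  · exact MDifferentiableAt.comp (g := fun z : ℂ => frameDet L T.e₁ T.e₂ T.n * z⁻¹) y
      ((differentiableAt_inv hcy).const_mul _).mdifferentiableAt h.diffC
  · exact localForm_ne_zero (mul_ne_zero (T.frameDet_ne_zero hL) (inv_ne_zero hcy))
      fun v => h.eq_zero_of_ne_zero hπ hcy
  · exact fun hyR => h.pullbackForm_eq (h.apply_ne_zero hyR).1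

/-- At a regular point with `w = 0`, there is a frame for which `w` is a local coordinate. -/
lemma exists_frame_of_regular {p : Cone l} (hp : DoubleCover.mk p ∈ regularLocus l)
    (hw : p.1.2 = 0) : ∃ T : Frame, T.n = p.1.1 ∧ fderiv ℂ (equation l) p.1 (T.e₁, 0) ≠ 0 := by
  rw [mk_mem_regularLocus] at hp
  -- Euler's relation: the derivative in the direction of the point itself is a multiple of the
  -- product, which is zero. A direction `e` with nonzero derivative is therefore independent of
  -- `p`, and the two extend to a frame.
  have hn : fderiv ℂ (equation l) p.1 (p.1.1, 0) = 0 := by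
    rw [fderiv_equation_apply]
    have h0 : ∏ i, l i p.1.1 = 0 := by
      have := p.2.2
      rw [equation, hw] at this
      simpa using this
    simp only [Finset.prod_erase_mul _ _ (Finset.mem_univ _), h0]
    simp
  have : ∃ e, fderiv ℂ (equation l) p.1 (e, 0) ≠ 0 := by
    by_contra! h
    refine hp (ContinuousLinearMap.ext fun v => ?_)
    have h2 : v = (v.1, 0) + (0, v.2) := by simp
    rw [h2, map_add, h, fderiv_equation_apply, hw]
    simp
  obtain ⟨e, he⟩ := this
  have hli : LinearIndependent ℂ ![e, p.1.1] := by
    rw [LinearIndependent.pair_iff' (x := e) (y := p.1.1)]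
    · intro a ha
      have h1 : ((p.1.1, 0) : (Fin 3 → ℂ) × ℂ) = a • (e, 0) := by simp [ha]
      rw [h1, map_smul, smul_eq_mul] at hn
      rcases mul_eq_zero.1 hn with h2 | h2
      · rw [h2, zero_smul] at ha
        exact p.2.1 ha.symm
      · exact he h2
    · rintro rfl
      exact he (by rw [fderiv_equation_apply]; simp)
  obtain ⟨T, h1, h2⟩ := exists_frame hli
  exact ⟨T, h2, by rwa [h1]⟩

lemma Frame.affinePoint_self {T : Frame} {p : Cone l} (hT : T.n = p.1.1) :
    affinePoint T.e₁ T.e₂ T.n (linearRatio T.a₁ T.m (DoubleCover.mk p))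
      (linearRatio T.a₂ T.m (DoubleCover.mk p)) = p.1.1 ∧
      cubicRatio T.m (DoubleCover.mk p) = p.1.2 := by
  obtain ⟨h1, h2, h3⟩ := T.dual
  rw [hT] at h1 h2 h3
  rw [linearRatio_mk, linearRatio_mk, cubicRatio_mk, h1, h2, h3, hT]
  simp [affinePoint]

/-- On the branch curve `w` and `B` serve as coordinates, and `localForm_eq` identifies the two
expressions where both make sense. -/
lemma hasLocalForm_of_eq_zero (hπ : IsDesingularisation π) {L : LinearForm}
    (hL : LinearIndependent ℂ ![formX, formY, L]) {q : X} {p : Cone l}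
    (hp : DoubleCover.mk p = π q) (hw : p.1.2 = 0) (hreg : π q ∈ regularLocus l) :
    HasLocalForm π L q := by
  obtain ⟨T, hT, hTe⟩ := exists_frame_of_regular (hp ▸ hreg) hw
  have hm : T.m p.1.1 = 1 := by rw [← hT]; exact T.dual.2.2
  have hq : π q ∈ nonvanishing l T.m := by
    rw [← hp, mk_mem_nonvanishing, hm]; exact one_ne_zero
  have hopen : IsOpen (π ⁻¹' nonvanishing l T.m) :=
    (isOpen_nonvanishing T.m).preimage hπ.proper.continuous
  set A := linearRatio T.a₁ T.m ∘ π with hA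
  set B := linearRatio T.a₂ T.m ∘ π with hB
  set c := cubicRatio T.m ∘ π with hc
  set t : X → ℂ := fun y =>
    fderiv ℂ (equation l) (affinePoint T.e₁ T.e₂ T.n (A y) (B y), c y) (T.e₁, 0) with ht
  have htd : ∀ y, π y ∈ nonvanishing l T.m → MDifferentiableAt 𝓘(ℂ, E2) 𝓘(ℂ, ℂ) t y := by
    intro y hy
    have h := T.isAffineAt hπ.holomorphic hy
    have h1 : Differentiable ℂ (fderiv ℂ (equation l)) :=
      (contDiff_equation.fderiv_right (m := 1) le_top).differentiable one_ne_zero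
    have h2 : Differentiable ℂ (fun z : ℂ × ℂ × ℂ =>
        fderiv ℂ (equation l) (affinePoint T.e₁ T.e₂ T.n z.1 z.2.1, z.2.2) (T.e₁, 0)) := by
      refine Differentiable.clm_apply (h1.fun_comp (Differentiable.prodMk ?_ ?_))
        (differentiable_const _)
      · exact ((differentiable_fst.smul_const _).fun_add
          (differentiable_snd.fst.smul_const _)).add_const _
      · exact differentiable_snd.snd
    exact MDifferentiableAt.comp (f := fun y => (A y, B y, c y)) y
      (h2 _).mdifferentiableAt (h.diffA.prodMk_space (h.diffB.prodMk_space h.diffC))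
  have htc : ContinuousOn t (π ⁻¹' nonvanishing l T.m) := fun y hy =>
    (htd y hy).continuousAt.continuousWithinAt
  have htq : t q ≠ 0 := by
    obtain ⟨h1, h2⟩ := Frame.affinePoint_self hT
    simp only [ht, hA, hB, hc, Function.comp_apply, ← hp, h1, h2]
    exact hTe
  refine ⟨_, htc.isOpen_inter_preimage hopen isOpen_ne, ⟨hq, htq⟩,
    fun y => (-2 * frameDet L T.e₁ T.e₂ T.n) * (t y)⁻¹, c, B, ?_⟩
  rintro y ⟨hy, hty⟩
  have h := T.isAffineAt hπ.holomorphic hy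
  refine ⟨?_, h.diffC, h.diffB, ?_, ?_⟩
  · exact MDifferentiableAt.comp (g := fun z : ℂ => (-2 * frameDet L T.e₁ T.e₂ T.n) * z⁻¹) y
      ((differentiableAt_inv hty).const_mul _).mdifferentiableAt (htd y hy)
  · exact localForm_ne_zero (mul_ne_zero (mul_ne_zero (by norm_num) (T.frameDet_ne_zero hL))
      (inv_ne_zero hty)) fun v hv hv' => h.eq_zero_of_fderiv_ne_zero hπ hty hv' hv
  · intro hyR
    obtain ⟨h1, h2⟩ := h.apply_ne_zero hyR
    rw [h.pullbackForm_eq h1, h.localForm_eq h2 _ hty]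

lemma hasLocalForm_of_regular (hπ : IsDesingularisation π) {L : LinearForm}
    (hL : LinearIndependent ℂ ![formX, formY, L]) {q : X} (hq : π q ∈ regularLocus l) :
    HasLocalForm π L q := by
  obtain ⟨p, hp⟩ := mk_surjective (π q)
  by_cases hw : p.1.2 = 0
  · exact hasLocalForm_of_eq_zero hπ hL hp hw hq
  · exact hasLocalForm_of_ne_zero hπ hL hp hw

end LocalForms

/-! ### The local expression near the exceptional line -/

section Exceptional

open Set Filter

variable {l : Fin 6 → LinearForm} {X : Type} [TopologicalSpace X] [ChartedSpace E2 X]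

namespace Setup

variable {π : X → DoubleCover l} {N : DoubleCover l} {S : Setup π N} {φ : Bool → E2 → X}

namespace IsParam

/-- An immersion between surfaces has invertible differential, so the inverse function theorem
applies in a chart. -/
lemma exists_local_inverse (hφ : S.IsParam φ) {b : Bool} {y : E2} (hy : y ∈ (S.node b).dom) :
    ∃ V : Set X, IsOpen V ∧ φ b y ∈ V ∧ ∃ σ : X → E2, ∀ q ∈ V, σ q ∈ (S.node b).dom ∧
      MDifferentiableAt 𝓘(ℂ, E2) 𝓘(ℂ, E2) σ q ∧ φ b (σ q) = q := by
  have := S.desing.manifold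
  have : IsManifold 𝓘(ℂ, E2) 1 X := IsManifold.of_le (n := ω) le_top
  set e := chartAt E2 (φ b y)
  have he : e ∈ atlas E2 X := chart_mem_atlas _ _
  have hs : φ b y ∈ e.source := mem_chart_source _ _
  have hU := hφ.isOpen_chartDom e b
  have hyU : y ∈ chartDom S φ e b := ⟨hy, hs⟩
  have h1 : ContDiffAt ℂ ω (e ∘ φ b) y :=
    (contDiffOn_of_differentiableOn (hφ.differentiableOn_chart he b) hU).contDiffAt
      (hU.mem_nhds hyU)
  have hinj : Function.Injective (fderiv ℂ (e ∘ φ b) y) :=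
    det2_ne_zero_iff.1 ((hφ.jac_ne_zero_iff he hyU).2 (hφ.injective_mfderiv hy))
  have hn : (ω : WithTop ℕ∞) ≠ 0 := by simp
  have hd := (h1.differentiableAt hn).hasFDerivAt
  set T : E2 ≃L[ℂ] E2 := (LinearEquiv.ofInjectiveEndo
    (fderiv ℂ (e ∘ φ b) y : E2 →ₗ[ℂ] E2) hinj).toContinuousLinearEquiv
  have hT : HasFDerivAt (e ∘ φ b) (T : E2 →L[ℂ] E2) y :=
    hd.congr_fderiv (ContinuousLinearMap.ext fun v => rfl)
  set g := h1.localInverse hT hn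
  have hg : ContDiffAt ℂ ω g ((e ∘ φ b) y) := h1.to_localInverse hT hn
  have hgy : g ((e ∘ φ b) y) = y := h1.localInverse_apply_image hT hn
  have hright : ∀ᶠ v in 𝓝 ((e ∘ φ b) y), (e ∘ φ b) (g v) = v :=
    (h1.hasStrictFDerivAt' hT hn).eventually_right_inverse
  have hgU : ∀ᶠ v in 𝓝 ((e ∘ φ b) y), g v ∈ chartDom S φ e b :=
    hg.continuousAt.eventually_mem (by rw [hgy]; exact hU.mem_nhds hyU)
  have hev : ∀ᶠ q in 𝓝 (φ b y), q ∈ e.source ∧ (e ∘ φ b) (g (e q)) = e q ∧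
      g (e q) ∈ chartDom S φ e b ∧ ContDiffAt ℂ ω g (e q) :=
    (e.open_source.eventually_mem hs).and
      ((e.continuousAt hs).eventually (hright.and (hgU.and (hg.eventually (by simp)))))
  obtain ⟨V, hV, hVo, hyV⟩ := mem_nhds_iff.1 hev
  refine ⟨V, hVo, hyV, g ∘ e, fun q hq => ?_⟩
  obtain ⟨h2, h3, h4, h5⟩ := hV hq
  refine ⟨h4.1, ?_, e.injOn h4.2 h2 h3⟩
  exact (h5.differentiableAt hn).mdifferentiableAt.comp q (mdifferentiableAt_atlas he h2)

/-- Since `da ∧ d(s²a) = 2sa da ∧ ds` and `w = h s a`, the factor `sa` cancels and `(2δ/h) da ∧ ds`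
remains. This cancellation is why the form acquires neither zero nor pole along the exceptional
line. -/
lemma hasLocalForm (hφ : S.IsParam φ) {L : LinearForm}
    (hL : LinearIndependent ℂ ![formX, formY, L]) {b : Bool} {y : E2}
    (hy : y ∈ (S.node b).dom) : HasLocalForm π L (φ b y) := by
  obtain ⟨V, hV, hyV, σ, hσ⟩ := hφ.exists_local_inverse hy
  set d := S.node b
  set δ := frameDet L d.e₁ d.e₂ d.n
  have hδ : δ ≠ 0 := frameDet_ne_zero hL fun v => ⟨_, _, _, d.decomp v⟩
  set s : X → ℂ := fun q => σ q 0
  set a : X → ℂ := fun q => σ q 1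
  set B : X → ℂ := fun q => s q ^ 2 * a q
  refine ⟨V, hV, hyV, fun q => (2 * δ) * (d.h (a q, B q))⁻¹, a, s, fun q hq => ?_⟩
  obtain ⟨h1, h2, h3⟩ := hσ q hq
  have hs : MDifferentiableAt 𝓘(ℂ, E2) 𝓘(ℂ, ℂ) s q :=
    MDifferentiableAt.comp (g := fun u : E2 => u 0) q
      (differentiable_coord 0).differentiableAt.mdifferentiableAt h2
  have ha : MDifferentiableAt 𝓘(ℂ, E2) 𝓘(ℂ, ℂ) a q :=
    MDifferentiableAt.comp (g := fun u : E2 => u 1) q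
      (differentiable_coord 1).differentiableAt.mdifferentiableAt h2
  have hds : ∀ v, differential s q v =
      coordL 0 ((mfderiv 𝓘(ℂ, E2) 𝓘(ℂ, E2) σ q : E2 →L[ℂ] E2) v) := by
    intro v
    have := ((coordL 0).hasFDerivAt (x := σ q)).hasMFDerivAt.comp q h2.hasMFDerivAt
    exact congrArg (fun T : E2 →L[ℂ] ℂ => T v) this.mfderiv
  have hda : ∀ v, differential a q v =
      coordL 1 ((mfderiv 𝓘(ℂ, E2) 𝓘(ℂ, E2) σ q : E2 →L[ℂ] E2) v) := by
    intro v
    have := ((coordL 1).hasFDerivAt (x := σ q)).hasMFDerivAt.comp q h2.hasMFDerivAt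
    exact congrArg (fun T : E2 →L[ℂ] ℂ => T v) this.mfderiv
  have hB : HasMFDerivAt 𝓘(ℂ, E2) 𝓘(ℂ, ℂ) B q
      ((s q ^ 2) • differential a q + a q • (2 * s q) • differential s q) := by
    have h4 : HasFDerivAt (fun z : ℂ × ℂ => z.1 ^ 2 * z.2)
        ((s q ^ 2) • ContinuousLinearMap.snd ℂ ℂ ℂ +
          a q • (2 * s q) • ContinuousLinearMap.fst ℂ ℂ ℂ) (s q, a q) := by
      have h5 : HasFDerivAt (fun z : ℂ × ℂ => z.1 ^ 2)
          ((2 * s q) • ContinuousLinearMap.fst ℂ ℂ ℂ) (s q, a q) :=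
        ((hasFDerivAt_fst (𝕜 := ℂ) (p := (s q, a q))).pow 2).congr_fderiv
          (ContinuousLinearMap.ext fun v => by simp)
      exact h5.mul hasFDerivAt_snd
    exact HasMFDerivAt.comp (f := fun q => (s q, a q)) q h4.hasMFDerivAt
      (hs.hasMFDerivAt.pair ha.hasMFDerivAt)
  have hh : MDifferentiableAt 𝓘(ℂ, E2) 𝓘(ℂ, ℂ) (fun q => d.h (a q, B q)) q :=
    MDifferentiableAt.comp (f := fun q => (a q, B q)) q
      (d.differentiableAt_h _ _ h1.1 h1.2).mdifferentiableAt
      (ha.prodMk_space hB.mdifferentiableAt)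
  have hu : MDifferentiableAt 𝓘(ℂ, E2) 𝓘(ℂ, ℂ) (fun q => (2 * δ) * (d.h (a q, B q))⁻¹) q :=
    MDifferentiableAt.comp (g := fun z : ℂ => (2 * δ) * z⁻¹) q
      ((differentiableAt_inv (d.h_ne_zero _ _)).const_mul _).mdifferentiableAt hh
  refine ⟨hu, ha, hs, localForm_ne_zero (mul_ne_zero (mul_ne_zero two_ne_zero hδ)
    (inv_ne_zero (d.h_ne_zero _ _))) ?_, ?_⟩
  · intro v hv hv'
    rw [hda] at hv
    rw [hds] at hv'
    have h4 : (mfderiv 𝓘(ℂ, E2) 𝓘(ℂ, E2) σ q : E2 →L[ℂ] E2) v = 0 := E2.ext hv' hv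
    have h5 := (hφ.mdifferentiableAt b _ h1).hasMFDerivAt.comp q h2.hasMFDerivAt
    have h6 : HasMFDerivAt 𝓘(ℂ, E2) 𝓘(ℂ, E2) (φ b ∘ σ) q (ContinuousLinearMap.id ℂ E2) := by
      refine (hasMFDerivAt_id q).congr_of_eventuallyEq ?_
      filter_upwards [hV.mem_nhds hq] with q' hq'
      exact (hσ q' hq').2.2
    have h7 := congrArg (fun T : E2 →L[ℂ] E2 => T v) (hasMFDerivAt_unique h6 h5)
    exact h7.trans ((congrArg (mfderiv 𝓘(ℂ, E2) 𝓘(ℂ, E2) (φ b) (σ q) : E2 →L[ℂ] E2) h4).trans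
      (map_zero _))
  · intro hqR
    have haff : IsAffineAt π d.e₁ d.e₂ d.n a B (fun q => d.h (a q, B q) * (s q * a q)) q := by
      refine ⟨ha, hB.mdifferentiableAt, hh.mul (hs.mul ha), ?_⟩
      filter_upwards [hV.mem_nhds hq] with q' hq'
      obtain ⟨h4, -, h5⟩ := hσ q' hq'
      refine ⟨d.F_mem h4, ?_⟩
      exact (congrArg π h5).symm.trans ((hφ.proj b _ h4).trans (d.proj_eq h4))
    obtain ⟨h4, h5⟩ := haff.apply_ne_zero hqR
    rw [haff.pullbackForm_eq h4]
    have key : (localForm (fun y => δ * (d.h (a y, B y) * (s y * a y))⁻¹) a B q :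
        E2 [⋀^Fin 2]→L[ℂ] ℂ) = localForm (fun q => (2 * δ) * (d.h (a q, B q))⁻¹) a s q := by
      refine ContinuousAlternatingMap.ext fun v : Fin 2 → E2 => ?_
      change (δ * (d.h (a q, B q) * (s q * a q))⁻¹) *
        (differential a q (v 0) * differential B q (v 1) -
          differential a q (v 1) * differential B q (v 0)) = ((2 * δ) * (d.h (a q, B q))⁻¹) *
        (differential a q (v 0) * differential s q (v 1) -
          differential a q (v 1) * differential s q (v 0))
      have h6 : ∀ v : E2, differential B q v =
          s q ^ 2 * differential a q v + a q * (2 * s q * differential s q v) := fun v =>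
        congrArg (fun T : E2 →L[ℂ] ℂ => T v) hB.mfderiv
      rw [h6, h6]
      have h7 := left_ne_zero_of_mul h5
      have h8 := left_ne_zero_of_mul (right_ne_zero_of_mul h5)
      have h9 := right_ne_zero_of_mul (right_ne_zero_of_mul h5)
      generalize d.h (a q, B q) = k at *
      field_simp
      ring
    exact key

end IsParam

end Setup

/-! ## The domain of definition of the form is dense -/

/-- If `L` vanished near the point, so would `L e₁ dA + L e₂ dB`. As `dA` and `dB` are independent,
this kills `L e₁` and `L e₂`, then `L n`, so `L = 0`. -/
lemma mem_closure_of_ne_zero {π : X → DoubleCover l} (hπ : IsDesingularisation π) {L : LinearForm}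
    (hL : L ≠ 0) {q : X} {p : Cone l} (hp : DoubleCover.mk p = π q) (hw : p.1.2 ≠ 0) :
    q ∈ closure (π ⁻¹' affineUnramified L) := by
  rw [mem_closure_iff_frequently]
  intro hnot
  obtain ⟨T, hT⟩ := exists_frame_of_ne_zero p.2.1
  have hm : T.m p.1.1 = 1 := by rw [← hT]; exact T.dual.2.2
  have hq : π q ∈ nonvanishing l T.m := by
    rw [← hp, mk_mem_nonvanishing, hm]; exact one_ne_zero
  have h := T.isAffineAt hπ.holomorphic hq
  have hcq : (cubicRatio T.m ∘ π) q ≠ 0 := by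
    rw [Function.comp_apply, ← hp, (Frame.affinePoint_self hT).2]
    exact hw
  have hzero : ∀ᶠ y in 𝓝 q, L (affinePoint T.e₁ T.e₂ T.n ((linearRatio T.a₁ T.m ∘ π) y)
      ((linearRatio T.a₂ T.m ∘ π) y)) = 0 := by
    filter_upwards [hnot, h.eq, h.diffC.continuousAt.eventually_ne hcq] with y hy ⟨h0, h1⟩ hcy
    by_contra hne
    refine hy ?_
    rw [mem_preimage, h1, mk_mem_affineUnramified]
    exact ⟨hne, hcy⟩
  have hlin : ∀ v, L T.e₁ * differential (linearRatio T.a₁ T.m ∘ π) q v +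
      L T.e₂ * differential (linearRatio T.a₂ T.m ∘ π) q v = 0 := by
    intro v
    have h1 : HasFDerivAt (fun p : ℂ × ℂ => p.1 * L T.e₁ + p.2 * L T.e₂ + L T.n)
        (L T.e₁ • ContinuousLinearMap.fst ℂ ℂ ℂ + L T.e₂ • ContinuousLinearMap.snd ℂ ℂ ℂ)
        ((linearRatio T.a₁ T.m ∘ π) q, (linearRatio T.a₂ T.m ∘ π) q) :=
      ((hasFDerivAt_fst.mul_const _).add (hasFDerivAt_snd.mul_const _)).add_const _
    have h2 := HasMFDerivAt.comp
      (f := fun y => ((linearRatio T.a₁ T.m ∘ π) y, (linearRatio T.a₂ T.m ∘ π) y)) q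
      h1.hasMFDerivAt (h.diffA.hasMFDerivAt.pair h.diffB.hasMFDerivAt)
    have h3 := h2.congr_of_eventuallyEq (f₁ := fun _ => (0 : ℂ)) (by
      filter_upwards [hzero] with y hy
      rw [apply_affinePoint] at hy
      exact hy.symm)
    exact congrArg (fun T : E2 →L[ℂ] ℂ => T v)
      (hasMFDerivAt_unique h3 (hasMFDerivAt_const (0 : ℂ) q))
  have hinj := fun v => h.eq_zero_of_ne_zero hπ hcq (v := v)
  obtain ⟨v, hv1, hv2⟩ := exists_apply_eq hinj 1 0
  obtain ⟨v', hv1', hv2'⟩ := exists_apply_eq hinj 0 1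
  have h1 := hlin v
  have h2 := hlin v'
  rw [hv1, hv2] at h1
  rw [hv1', hv2'] at h2
  have h3 := hzero.self_of_nhds
  rw [apply_affinePoint] at h3
  simp only [mul_one, mul_zero, add_zero, zero_add] at h1 h2
  rw [h1, h2, mul_zero, mul_zero, zero_add, zero_add] at h3
  refine hL (LinearMap.ext fun w => ?_)
  rw [T.decomp w]
  simp [h1, h2, h3]

/-- At a regular point with `w = 0`, `w` is part of a coordinate system and cannot vanish on a
neighbourhood. -/
lemma mem_closure_of_regular {π : X → DoubleCover l} (hπ : IsDesingularisation π) {L : LinearForm}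
    (hL : L ≠ 0) {q : X} (hq : π q ∈ regularLocus l) :
    q ∈ closure (π ⁻¹' affineUnramified L) := by
  obtain ⟨p, hp⟩ := mk_surjective (π q)
  by_cases hw : p.1.2 = 0
  · rw [← closure_closure, mem_closure_iff_frequently]
    intro hnot
    obtain ⟨T, hT, hTe⟩ := exists_frame_of_regular (hp ▸ hq) hw
    have hm : T.m p.1.1 = 1 := by rw [← hT]; exact T.dual.2.2
    have hq : π q ∈ nonvanishing l T.m := by
      rw [← hp, mk_mem_nonvanishing, hm]; exact one_ne_zero
    have h := T.isAffineAt hπ.holomorphic hq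
    have hzero : ∀ᶠ y in 𝓝 q, (cubicRatio T.m ∘ π) y = 0 := by
      filter_upwards [hnot, h.eq] with y hy ⟨h0, h1⟩
      by_contra hne
      exact hy (mem_closure_of_ne_zero hπ hL h1.symm hne)
    have hc : ∀ v, differential (cubicRatio T.m ∘ π) q v = 0 := by
      intro v
      have h3 := (hasMFDerivAt_const (I := 𝓘(ℂ, E2)) (I' := 𝓘(ℂ, ℂ))
        (0 : ℂ) q).congr_of_eventuallyEq hzero
      exact congrArg (fun T : E2 →L[ℂ] ℂ => T v) h3.mfderiv
    have hTe' : fderiv ℂ (equation l) (affinePoint T.e₁ T.e₂ T.n ((linearRatio T.a₁ T.m ∘ π) q)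
        ((linearRatio T.a₂ T.m ∘ π) q), (cubicRatio T.m ∘ π) q) (T.e₁, 0) ≠ 0 := by
      obtain ⟨h1, h2⟩ := Frame.affinePoint_self hT
      simp only [Function.comp_apply, ← hp, h1, h2]
      exact hTe
    obtain ⟨v, -, hv⟩ := exists_apply_eq
      (fun v hv hv' => h.eq_zero_of_fderiv_ne_zero hπ hTe' (v := v) hv hv') 0 1
    rw [hc] at hv
    exact zero_ne_one hv
  · exact mem_closure_of_ne_zero hπ hL hp hw

lemma dense_preimage_affineUnramified {π : X → DoubleCover l} (hπ : IsDesingularisation π)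
    {L : LinearForm} (hL : L ≠ 0) : Dense (π ⁻¹' affineUnramified L) := by
  have h := hπ.dense_preimage.mono (s₂ := closure (π ⁻¹' affineUnramified L))
    fun q hq => mem_closure_of_regular hπ hL hq
  exact dense_closure.1 h

end Exceptional

end SixLines

end

/-! ### The global form -/

theorem mainTheorem5
    (l : Fin 6 → SixLines.LinearForm) (hl : SixLines.NoThreeConcurrent l)
    (X : Type) [TopologicalSpace X] [ChartedSpace SixLines.E2 X]
    (π : X → SixLines.DoubleCover l) (hπ : SixLines.IsMinimalDesingularisation π)
    (L : SixLines.LinearForm)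
    (hL : LinearIndependent ℂ ![SixLines.formX, SixLines.formY, L]) :
    (IsOpen (π ⁻¹' SixLines.affineUnramified L) ∧ Dense (π ⁻¹' SixLines.affineUnramified L)) ∧
    ∃ η : SixLines.TwoForm X,
      (∀ q ∈ π ⁻¹' SixLines.affineUnramified L, η q = SixLines.pullbackForm π L q) ∧
      η.IsHolomorphic ∧
      ∀ q : X, η q ≠ 0 := by
  have hd := hπ.isDesingularisation
  have := hd.manifold
  have : IsManifold 𝓘(ℂ, SixLines.E2) 1 X := IsManifold.of_le (n := ω) le_top
  have hdense := SixLines.dense_preimage_affineUnramified hd (hL.ne_zero 2 : L ≠ 0)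
  refine ⟨⟨(SixLines.isOpen_affineUnramified L).preimage hd.proper.continuous, hdense⟩,
    SixLines.exists_global_form hdense fun q => ?_⟩
  by_cases hq : π q ∈ SixLines.regularLocus l
  · exact SixLines.hasLocalForm_of_regular hd hL hq
  · obtain ⟨d⟩ := SixLines.exists_node hl hq
    obtain ⟨s, hs, hs1, hs2⟩ := hd.exists_inverse
    -- The node to be resolved is the image of the given point, so each point over a singularity is
    -- treated with its own modification of `X`.
    let S : SixLines.Setup π (π q) := ⟨hl, hd, s, hs, hs1, hs2, d⟩
    obtain ⟨φ, h1, h2, h3, h4⟩ := S.exists_parametrisation hπ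
    obtain ⟨b, t, ht⟩ := h4 q rfl
    have hφ : S.IsParam φ := ⟨h1, h2, h3, h4⟩
    have := hφ.hasLocalForm hL (SixLines.Setup.IsParam.line_mem S b t)
    rwa [ht] at this
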